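/- All manifolds are smooth, finite-dimensional, Hausdorff and second countable, without boundary. A \emph{singular foliation} on a manifold $M$ is a $C^\infty_c(M)$-submodule $\mathcal F\subset\mathfrak X_c(M)$ of the compactly supported vector fields that is involutive ($[\mathcal F,\mathcal F]\subset\mathcal F$) and locally finitely generated: every point has an open neighbourhood $U$ and vector fields $Y_1,\dots,Y_n\in\mathfrak X(U)$ such that $\{X|_U : X\in\mathcal F,\ \mathrm{supp}X\subset U\}$ is the $C^\infty_c(U)$-span of $Y_1,\dots,Y_n$. For $x\in M$ put $F_x=\{X(x):X\in\mathcal F\}\subset T_xM$ and $I_x=\{f\in C^\infty(M): f(x)=0\}$. The \emph{isotropy Lie algebra} of $\mathcal F$ at $x$ is $\mathfrak g_x^{\mathcal F}=\ker(\mathcal F/I_x\mathcal F\to F_x)=\{X\in\mathcal F: X(x)=0\}/I_x\mathcal F$, with the bracket of vector fields. The \emph{leaves} of $\mathcal F$ are the orbits of the group generated by the time-one flows of the elements of $\mathcal F$; the leaf through $x$ has tangent space $F_x$ at $x$ and codimension $\dim(T_xM/F_x)$. The \emph{leaf space} is the set of leaves with the quotient topology. For a smooth map $\pi\colon P\to M$,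 the pullback $\pi^{-1}\mathcal F$ consists of the $Y\in\mathfrak X_c(P)$ such that $d\pi\,Y$ lies in the $C^\infty_c(P)$-span of $\{X\circ\pi : X\in\mathcal F\}$. A \emph{slice} at $x$ is an embedded submanifold $\iota\colon S_x\hookrightarrow M$ through $x$ with $T_xS_x\oplus F_x=T_xM$. Let $(M,\mathcal F_M)$ and $(N,\mathcal F_N)$ be manifolds with singular foliations which are Hausdorff Morita equivalent by means of $(P,\pi_M,\pi_N)$, i.e. $P$ is a manifold and $\pi_M\colon P\to M$, $\pi_N\colon P\to N$ are surjective submersions with connected fibres such that $\pi_M^{-1}\mathcal F_M=\pi_N^{-1}\mathcal F_N$. Then: (i) There is a homeomorphism from the leaf space of $(M,\mathcal F_M)$ to the leaf space of $(N,\mathcal F_N)$ that maps the leaf through $x\in M$ to the leaf of $\mathcal F_N$ containing $\pi_N(\pi_M^{-1}(x))$. It preserves the codimension of leaves and the property of being an embedded leaf. (ii) Let $x\in M$ and $y\in N$ be points lying in corresponding leaves, and let $S_x$, $S_y$ be slices at $x$ and at $y$. Then, after shrinking $S_x$ and $S_y$ to suitable open neighbourhoods of $x$ and $y$ in them, there is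 a diffeomorphism $\psi\colon S_x\to S_y$ with $\psi(x)=y$ and $\psi^{-1}(\iota_{S_y}^{-1}\mathcal F_N)=\iota_{S_x}^{-1}\mathcal F_M$. (iii) Let $x\in M$ and $y\in N$ be points lying in corresponding leaves. Then the isotropy Lie algebras $\mathfrak g_x^{\mathcal F_M}$ and $\mathfrak g_y^{\mathcal F_N}$ are isomorphic. -/

import Mathlib

open scoped Manifold ContDiff Topology

noncomputable section

section VectorFields

variable (E : Type*) [NormedAddCommGroup E] [NormedSpace ℝ E]
  (M : Type*) [TopologicalSpace M] [ChartedSpace E M] [IsManifold 𝓘(ℝ, E) ∞ M]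

/-- Smooth real functions on a manifold `M` without boundary modelled on `E`. -/
abbrev SmoothFun : Type _ := C^∞⟮𝓘(ℝ, E), M; 𝓘(ℝ, ℝ), ℝ⟯

/-- Smooth vector fields: smooth sections of the tangent bundle. -/
abbrev SmoothVF : Type _ :=
  Cₛ^∞⟮𝓘(ℝ, E); E, (TangentSpace 𝓘(ℝ, E) : M → Type _)⟯

variable {E M}

namespace SmoothVF

/-- The support of a vector field. -/
def supp (X : SmoothVF E M) : Set M := closure {x | X x ≠ 0}

/-- The product of a smooth function and a vector field. -/
def fsmul (f : SmoothFun E M) (X : SmoothVF E M) : SmoothVF E M :=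
  ⟨fun x => f x • X x, fun x => (f.contMDiff x).smul_section (X.contMDiff x)⟩

/-- Evaluation of vector fields at a point. -/
def eval (x : M) : SmoothVF E M →ₗ[ℝ] TangentSpace 𝓘(ℝ, E) x where
  toFun X := X x
  map_add' _ _ := rfl
  map_smul' _ _ := rfl

lemma mdifferentiableAt (X : SmoothVF E M) (x : M) :
    MDifferentiableAt 𝓘(ℝ, E) 𝓘(ℝ, E).tangent
      (fun y => (X y : TangentBundle 𝓘(ℝ, E) M)) x :=
  (X.contMDiff x).mdifferentiableAt (by simp)

/-- The derivative `X(f)` of a smooth function along a vector field. -/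
def derivFun (X : SmoothVF E M) (f : SmoothFun E M) : SmoothFun E M :=
  ⟨fun x => (mfderiv 𝓘(ℝ, E) 𝓘(ℝ, ℝ) f x (X x) : ℝ), by
    have h := (ContMDiff.contMDiff_tangentMap (m := ∞) f.contMDiff (by simp)).comp X.contMDiff
    intro x
    have h2 := (Bundle.contMDiffAt_totalSpace.1 (h x)).2
    simpa [tangentMap] using h2⟩

lemma two_le_infty : (2 : WithTop ℕ∞) ≤ ∞ := by
  exact WithTop.coe_le_coe.2 (le_top : (2 : ℕ∞) ≤ ⊤)

lemma three_le_infty : (3 : WithTop ℕ∞) ≤ ∞ := by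
  exact WithTop.coe_le_coe.2 (le_top : (3 : ℕ∞) ≤ ⊤)

variable [FiniteDimensional ℝ E]

/-- The Lie bracket of vector fields. -/
instance : Bracket (SmoothVF E M) (SmoothVF E M) where
  bracket X Y := ⟨VectorField.mlieBracket 𝓘(ℝ, E) X Y, by
    have : CompleteSpace E := FiniteDimensional.complete ℝ E
    have : IsManifold 𝓘(ℝ, E) ((⊤ : ℕ∞) + 1) M :=
      IsManifold.of_le (n := ∞) (by simp)
    have : IsManifold 𝓘(ℝ, E) (minSmoothness ℝ 2) M :=
      IsManifold.of_le (n := ∞) (by simpa using two_le_infty)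
    exact ContDiff.mlieBracket_vectorField (m := ⊤) (n := ⊤) X.contMDiff Y.contMDiff (by simp)⟩

lemma bracket_apply (X Y : SmoothVF E M) (x : M) :
    ⁅X, Y⁆ x = VectorField.mlieBracket 𝓘(ℝ, E) X Y x := rfl

instance : LieRing (SmoothVF E M) where
  add_lie X Y Z := by
    ext x
    exact VectorField.mlieBracket_add_left (X.mdifferentiableAt x) (Y.mdifferentiableAt x)
  lie_add X Y Z := by
    ext x
    exact VectorField.mlieBracket_add_right (Y.mdifferentiableAt x) (Z.mdifferentiableAt x)
  lie_self X := by
    ext x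
    simp [bracket_apply]
  leibniz_lie X Y Z := by
    have : CompleteSpace E := FiniteDimensional.complete ℝ E
    ext x
    have h2 : minSmoothness ℝ 2 ≤ ∞ := by simpa using two_le_infty
    have : IsManifold 𝓘(ℝ, E) (minSmoothness ℝ 3) M :=
      IsManifold.of_le (n := ∞) (by simpa using three_le_infty)
    exact VectorField.leibniz_identity_mlieBracket_apply ((X.contMDiff x).of_le h2)
      ((Y.contMDiff x).of_le h2) ((Z.contMDiff x).of_le h2)

instance : LieAlgebra ℝ (SmoothVF E M) where
  lie_smul c X Y := by
    ext x
    exact VectorField.mlieBracket_const_smul_right (Y.mdifferentiableAt x)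

lemma lie_fsmul (Z : SmoothVF E M) (f : SmoothFun E M) (Y : SmoothVF E M) :
    ⁅Z, fsmul f Y⁆ = fsmul (derivFun Z f) Y + fsmul f ⁅Z, Y⁆ := by
  ext x
  exact VectorField.mlieBracket_smul_right
    ((f.contMDiff x).mdifferentiableAt (by simp)) (Y.mdifferentiableAt x)

end SmoothVF

end VectorFields

section Foliations

variable {E : Type*} [NormedAddCommGroup E] [NormedSpace ℝ E]
  {M : Type*} [TopologicalSpace M] [ChartedSpace E M] [IsManifold 𝓘(ℝ, E) ∞ M]

/-- A submodule `F` of compactly supported vector fields is locally finitely generated: every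
point has an open neighbourhood `U` and finitely many vector fields `Y i` on `U` such that the
elements of `F` with support in `U` are exactly the combinations `∑ f i • Y i` with
`f i ∈ C^∞_c(U)` (functions and vector fields with compact support in `U` being extended
by zero to `M`). -/
def IsLocallyFinitelyGenerated (F : Submodule ℝ (SmoothVF E M)) : Prop :=
  ∀ x : M, ∃ U : Set M, IsOpen U ∧ x ∈ U ∧
    ∃ (n : ℕ) (Y : Fin n → (z : M) → TangentSpace 𝓘(ℝ, E) z),
      (∀ i, ContMDiffOn 𝓘(ℝ, E) 𝓘(ℝ, E).tangent ∞
        (fun z => (Y i z : TangentBundle 𝓘(ℝ, E) M)) U) ∧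
      ∀ X : SmoothVF E M, (X ∈ F ∧ X.supp ⊆ U) ↔
        ∃ f : Fin n → SmoothFun E M,
          (∀ i, HasCompactSupport (f i) ∧ tsupport (f i) ⊆ U) ∧
          ∀ z, X z = ∑ i, f i z • Y i z

variable (E M) in
/-- A singular foliation: an involutive, locally finitely generated `C^∞_c(M)`-submodule of the
compactly supported vector fields on `M`. -/
structure SingularFoliation [FiniteDimensional ℝ E] where
  toSubmodule : Submodule ℝ (SmoothVF E M)
  isCompact_supp : ∀ X ∈ toSubmodule, IsCompact X.supp
  fsmul_mem : ∀ f : SmoothFun E M, HasCompactSupport f →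
    ∀ X ∈ toSubmodule, SmoothVF.fsmul f X ∈ toSubmodule
  locallyFinitelyGenerated : IsLocallyFinitelyGenerated toSubmodule
  lie_mem : ∀ X ∈ toSubmodule, ∀ Y ∈ toSubmodule, ⁅X, Y⁆ ∈ toSubmodule

section Pullback

variable {E' : Type*} [NormedAddCommGroup E'] [NormedSpace ℝ E']
  {P : Type*} [TopologicalSpace P] [ChartedSpace E' P] [IsManifold 𝓘(ℝ, E') ∞ P]

variable (E') in
/-- The `C^∞_c(P)`-span of `{X ∘ π | X ∈ F}` inside the sections of `π^* TM`. -/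
def pullbackSections (π : P → M) (F : Submodule ℝ (SmoothVF E M)) :
    Submodule ℝ ((p : P) → TangentSpace 𝓘(ℝ, E) (π p)) :=
  Submodule.span ℝ {ξ | ∃ g : SmoothFun E' P, HasCompactSupport g ∧
    ∃ X ∈ F, ξ = fun p => g p • X (π p)}

/-- The pullback `π⁻¹ F` of `F` under a smooth map `π`: the compactly supported vector fields `Y`
on `P` such that `dπ Y` lies in the `C^∞_c(P)`-span of `{X ∘ π | X ∈ F}`. -/
def pullbackFoliation (π : P → M) (F : Submodule ℝ (SmoothVF E M)) :
    Submodule ℝ (SmoothVF E' P) where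
  carrier := {Y | IsCompact Y.supp ∧
    (fun p => mfderiv 𝓘(ℝ, E') 𝓘(ℝ, E) π p (Y p)) ∈ pullbackSections E' π F}
  zero_mem' := by
    refine ⟨by simp [SmoothVF.supp], ?_⟩
    convert (pullbackSections E' π F).zero_mem using 1
    ext p
    exact map_zero _
  add_mem' := by
    rintro Y Z ⟨hY, hY'⟩ ⟨hZ, hZ'⟩
    refine ⟨(hY.union hZ).of_isClosed_subset isClosed_closure ?_, ?_⟩
    · rw [SmoothVF.supp, SmoothVF.supp, SmoothVF.supp, ← closure_union]
      refine closure_mono fun p hp => ?_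
      by_contra hc
      simp only [Set.mem_union, Set.mem_ofPred_eq, not_or, not_not] at hc
      exact hp (by simp [hc.1, hc.2])
    · convert (pullbackSections E' π F).add_mem hY' hZ' using 1
      ext p
      exact map_add _ _ _
  smul_mem' := by
    rintro c Y ⟨hY, hY'⟩
    refine ⟨hY.of_isClosed_subset isClosed_closure ?_, ?_⟩
    · refine closure_mono fun p hp hc => ?_
      exact hp (by simp [hc])
    · convert (pullbackSections E' π F).smul_mem c hY' using 1
      ext p
      exact map_smul _ _ _

end Pullback

/-- A subset of `M` is an embedded submanifold if around each of its points there is a smooth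
chart of `M` in which it becomes a linear subspace of the model space. (It is only used for
leaves, which are connected, so that the dimension of the subspace is constant.) -/
def IsEmbeddedSubmanifold (L : Set M) : Prop :=
  ∀ x ∈ L, ∃ φ ∈ IsManifold.maximalAtlas 𝓘(ℝ, E) ∞ M, x ∈ φ.source ∧
    ∃ V : Submodule ℝ E, ∀ z ∈ φ.source, z ∈ L ↔ φ z ∈ V

namespace SingularFoliation

variable [FiniteDimensional ℝ E] (F : SingularFoliation E M)

/-- The tangent space `F_x = {X(x) | X ∈ F} ⊆ T_x M` of the foliation at `x`. -/
def tangent (x : M) : Submodule ℝ (TangentSpace 𝓘(ℝ, E) x) :=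
  F.toSubmodule.map (SmoothVF.eval x)

/-- `y = exp(X)(x)` for some `X ∈ F`, where `exp(X)` is the time-one flow of `X`. -/
def ExpStep (x y : M) : Prop :=
  ∃ X ∈ F.toSubmodule, ∃ γ : ℝ → M, IsMIntegralCurve (I := 𝓘(ℝ, E)) γ X ∧ γ 0 = x ∧ γ 1 = y

/-- Two points lie in the same leaf iff they are in the same orbit of the group `exp(F)` of
diffeomorphisms generated by the time-one flows of the elements of `F`. -/
def leafSetoid : Setoid M := Relation.EqvGen.setoid F.ExpStep

/-- The leaf through `x`, as a subset of `M`. -/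
def leaf (x : M) : Set M := {y | F.leafSetoid x y}

/-- The space of leaves, with the quotient topology. -/
abbrev LeafSpace : Type _ := Quotient F.leafSetoid

/-- The leaf through `x`, as a point of the leaf space. -/
def leafClass (x : M) : F.LeafSpace := Quotient.mk F.leafSetoid x

/-- The codimension in `M` of the leaf `L` through `x`, that is `dim T_x M / T_x L`, where
`T_x L = F_x` because `L` is the integral manifold through `x` of the distribution `F_x`. -/
def leafCodim (x : M) : ℕ := Module.finrank ℝ (TangentSpace 𝓘(ℝ, E) x ⧸ F.tangent x)

/-- The Lie algebra of the elements of `F` that vanish at `x`. -/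
def vanishingAt (x : M) : LieSubalgebra ℝ (SmoothVF E M) where
  toSubmodule := F.toSubmodule ⊓ LinearMap.ker (SmoothVF.eval x)
  lie_mem' := by
    rintro X Y ⟨hX, hX'⟩ ⟨hY, hY'⟩
    refine ⟨F.lie_mem X hX Y hY, ?_⟩
    change ⁅X, Y⁆ x = 0
    rw [SmoothVF.bracket_apply, ← VectorField.mlieBracketWithin_univ]
    exact VectorField.mlieBracketWithin_eq_zero_of_eq_zero hX' hY'

/-- The subspace `I_x F`, spanned by the products `f X` with `f(x) = 0` and `X ∈ F`. -/
def idealMul (x : M) : Submodule ℝ (SmoothVF E M) :=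
  Submodule.span ℝ {Z | ∃ f : SmoothFun E M, f x = 0 ∧
    ∃ X ∈ F.toSubmodule, Z = SmoothVF.fsmul f X}

lemma lie_mem_idealMul (x : M) {Z W : SmoothVF E M} (hZ : Z ∈ F.vanishingAt x)
    (hW : W ∈ F.idealMul x) : ⁅Z, W⁆ ∈ F.idealMul x := by
  induction hW using Submodule.span_induction with
  | mem W hW =>
    obtain ⟨f, hf, X, hX, rfl⟩ := hW
    rw [SmoothVF.lie_fsmul]
    refine Submodule.add_mem _ (Submodule.subset_span ⟨_, ?_, X, hX, rfl⟩)
      (Submodule.subset_span ⟨f, hf, _, F.lie_mem Z hZ.1 X hX, rfl⟩)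
    have hZx : Z x = 0 := hZ.2
    change mfderiv 𝓘(ℝ, E) 𝓘(ℝ, ℝ) f x (Z x) = 0
    rw [hZx]
    exact map_zero _
  | zero => rw [lie_zero]; exact Submodule.zero_mem _
  | add _ _ _ _ h₁ h₂ => rw [lie_add]; exact Submodule.add_mem _ h₁ h₂
  | smul c _ _ h => rw [lie_smul]; exact Submodule.smul_mem _ c h

/-- `I_x F` as a Lie ideal of the Lie algebra of elements of `F` vanishing at `x`. -/
def isotropyIdeal (x : M) : LieIdeal ℝ (F.vanishingAt x) where
  toSubmodule := (F.idealMul x).comap (F.vanishingAt x).toSubmodule.subtype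
  lie_mem := fun {Z _} hW => F.lie_mem_idealMul x Z.2 hW

/-- The isotropy Lie algebra at `x`: the kernel of the evaluation map
`F / I_x F → F_x`, that is `{X ∈ F | X(x) = 0} / I_x F` with the bracket of vector fields. -/
abbrev isotropy (x : M) : Type _ := F.vanishingAt x ⧸ F.isotropyIdeal x

/-- A slice of `F` at `ι s`: an embedded submanifold `ι : S → M` whose tangent space at that point
is complementary to the tangent space of the leaf. -/
structure IsSlice {E' : Type*} [NormedAddCommGroup E'] [NormedSpace ℝ E']
    {S : Type*} [TopologicalSpace S] [ChartedSpace E' S] (ι : S → M) (s : S) : Prop where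
  isSmoothEmbedding : Manifold.IsSmoothEmbedding 𝓘(ℝ, E') 𝓘(ℝ, E) ∞ ι
  isCompl : IsCompl (LinearMap.range (mfderiv 𝓘(ℝ, E') 𝓘(ℝ, E) ι s).toLinearMap)
    (F.tangent (ι s))

end SingularFoliation

/-- A surjective submersion with connected fibres. -/
structure IsConnectedFibreSubmersion {E' : Type*} [NormedAddCommGroup E'] [NormedSpace ℝ E']
    {P : Type*} [TopologicalSpace P] [ChartedSpace E' P] (π : P → M) : Prop where
  isSubmersion : Manifold.IsSubmersion 𝓘(ℝ, E') 𝓘(ℝ, E) ∞ π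
  surjective : Function.Surjective π
  isConnected_fibre : ∀ x, IsConnected (π ⁻¹' {x})

/-- `(P, πM, πN)` is a Hausdorff Morita equivalence between two foliated manifolds. -/
structure IsHausdorffMoritaEquivalence [FiniteDimensional ℝ E]
    {E₁ : Type*} [NormedAddCommGroup E₁] [NormedSpace ℝ E₁] [FiniteDimensional ℝ E₁]
    {N : Type*} [TopologicalSpace N] [ChartedSpace E₁ N] [IsManifold 𝓘(ℝ, E₁) ∞ N]
    {E₂ : Type*} [NormedAddCommGroup E₂] [NormedSpace ℝ E₂]
    {P : Type*} [TopologicalSpace P] [ChartedSpace E₂ P] [IsManifold 𝓘(ℝ, E₂) ∞ P]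
    (FM : SingularFoliation E M) (FN : SingularFoliation E₁ N)
    (πM : P → M) (πN : P → N) : Prop where
  left : IsConnectedFibreSubmersion (E := E) (E' := E₂) πM
  right : IsConnectedFibreSubmersion (E := E₁) (E' := E₂) πN
  pullback_eq : pullbackFoliation (E' := E₂) πM FM.toSubmodule =
    pullbackFoliation (E' := E₂) πN FN.toSubmodule

end Foliations

end

/-! Everything is read off from a transverse model. By the splitting theorem, near a point `x` a
singular foliation is the pullback, under a submersion `pr` onto some `ℝᵏ` with `pr x = 0`, of a
module spanned by vector fields `Z · a` that all vanish at `0`. The model `Z` determines each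
invariant in question. `F_x` is the kernel of `d pr`, so the codimension is `k`. The map `pr`
restricts to a chart of any slice, in which the restricted foliation is the module spanned by `Z`.
The isotropy Lie algebra is the space of coefficients modulo the values at `0` of the relations
among the fields `Z · a`, with a bracket computed from `Z` alone.

It remains to see that points of corresponding leaves have a common model
(`IsHausdorffMoritaEquivalence.exists_hasModel`). At `p : P`, the models at the two projections of
`p` give submersions `f`, `f'` from a neighbourhood of `p` onto two transverse spaces, and the same
vector fields project to combinations of `Z` and of `Z'`. Since `Z'` vanishes at `0`, each field
vertical for `f` satisfies `‖d f' v‖ ≤ C ‖f'‖`, and Grönwall's inequality puts the zero fibre of `f`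
inside that of `f'`; at `p` itself `d f` and `d f'` have the same kernel. For a local section `σ` of
`f` the map `θ = f' ∘ σ` is therefore a local diffeomorphism, and it carries one module to the other
(`PullbackGermLE.exists_pullsBack`). With identity maps in place of the two projections this shows
that all models at one point are interchangeable. Models are also constant along leaves, because an
integral curve of the foliation stays, again by Grönwall, in the zero fibre of a local model.

For the leaf spaces, zero fibres of local models lie in leaves, so the inclusion of zero fibres says
that, locally on `P`, moving along a leaf on one side is moving along a leaf on the other.
Connectedness of the fibres and of `ℝ` makes this global. Both leaf spaces are then quotients of `P`
by the same relation, and the projections, being open, make them homeomorphic. Embeddedness of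
leaves is compared on `P`, where corresponding leaves have the same preimage.

The splitting theorem is an induction on dimension: a field that does not vanish at the point is
straightened by its flow, and a linear differential equation for the coefficients removes the
dependence of the module on the flow time. Smooth flows come from the inverse function theorem in
`C([0,1], E)`. -/

set_option linter.unusedSectionVars false

open scoped Manifold ContDiff Topology
open Filter

/-! ### Germs of smooth maps: one neighbourhood for all orders of differentiability, unlike
`ContDiffAt ℝ ∞` at a point -/

section SmoothNear

variable {E F G : Type*} [NormedAddCommGroup E] [NormedSpace ℝ E] [NormedAddCommGroup F]
  [NormedSpace ℝ F] [NormedAddCommGroup G] [NormedSpace ℝ G]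

/-- `f` is smooth on a neighbourhood of `x`. -/
def SmoothNear (f : E → F) (x : E) : Prop := ∀ᶠ z in 𝓝 x, ContDiffAt ℝ ∞ f z

namespace SmoothNear

variable {f g : E → F} {x : E}

lemma contDiffAt (h : SmoothNear f x) : ContDiffAt ℝ ∞ f x := Eventually.self_of_nhds h

lemma differentiableAt (h : SmoothNear f x) : DifferentiableAt ℝ f x :=
  h.contDiffAt.differentiableAt (by simp)

lemma continuousAt (h : SmoothNear f x) : ContinuousAt f x := h.contDiffAt.continuousAt

lemma eventually (h : SmoothNear f x) : ∀ᶠ z in 𝓝 x, SmoothNear f z := eventually_eventually_nhds.2 h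

lemma of_contDiff (h : ContDiff ℝ ∞ f) : SmoothNear f x := Eventually.of_forall fun _ => h.contDiffAt

lemma const (c : F) : SmoothNear (fun _ : E => c) x := of_contDiff contDiff_const

lemma id : SmoothNear (fun z : E => z) x := of_contDiff contDiff_id

lemma of_clm (L : E →L[ℝ] F) : SmoothNear L x := of_contDiff L.contDiff

lemma congr (h : SmoothNear f x) (hfg : g =ᶠ[𝓝 x] f) : SmoothNear g x := by
  filter_upwards [h, eventually_eventually_nhds.2 hfg] with z hz hz'
  exact hz.congr_of_eventuallyEq hz'

lemma comp {h : F → G} (hh : SmoothNear h (f x)) (hf : SmoothNear f x) :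
    SmoothNear (fun z => h (f z)) x := by
  filter_upwards [hf, hf.continuousAt.eventually hh] with z hz hz'
  exact hz'.comp z hz

lemma comp_of_eq {h : F → G} {y : F} (hh : SmoothNear h y) (hf : SmoothNear f x) (hy : f x = y) :
    SmoothNear (fun z => h (f z)) x := by
  subst hy; exact hh.comp hf

lemma add (hf : SmoothNear f x) (hg : SmoothNear g x) : SmoothNear (fun z => f z + g z) x := by
  filter_upwards [hf, hg] with z h1 h2 using h1.add h2

lemma sub (hf : SmoothNear f x) (hg : SmoothNear g x) : SmoothNear (fun z => f z - g z) x := by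
  filter_upwards [hf, hg] with z h1 h2 using h1.sub h2

lemma neg (hf : SmoothNear f x) : SmoothNear (fun z => - f z) x := by
  filter_upwards [hf] with z h1 using h1.neg

lemma smul {c : E → ℝ} (hc : SmoothNear c x) (hf : SmoothNear f x) :
    SmoothNear (fun z => c z • f z) x := by
  filter_upwards [hf, hc] with z h1 h2 using h2.smul h1

lemma prodMk {h : E → G} (hf : SmoothNear f x) (hh : SmoothNear h x) :
    SmoothNear (fun z => (f z, h z)) x := by
  filter_upwards [hf, hh] with z h1 h2 using h1.prodMk h2

lemma snd {h : E → F × G} (hh : SmoothNear h x) : SmoothNear (fun z => (h z).2) x := by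
  filter_upwards [hh] with z h1 using h1.snd

lemma clm_apply {L : E → F →L[ℝ] G} (hL : SmoothNear L x) (hf : SmoothNear f x) :
    SmoothNear (fun z => L z (f z)) x := by
  filter_upwards [hf, hL] with z h1 h2 using h2.clm_apply h1

lemma clm_comp {H : Type*} [NormedAddCommGroup H] [NormedSpace ℝ H] {L : E → F →L[ℝ] G}
    {L' : E → H →L[ℝ] F} (hL : SmoothNear L x) (hL' : SmoothNear L' x) :
    SmoothNear (fun z => L z ∘L L' z) x := by
  filter_upwards [hL, hL'] with z h1 h2 using h1.clm_comp h2

lemma fderiv (hf : SmoothNear f x) : SmoothNear (fun z => fderiv ℝ f z) x := by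
  filter_upwards [hf] with z h1 using h1.fderiv_right (m := ∞) (by simp)

lemma sum {ι : Type*} {s : Finset ι} {f : ι → E → F} (h : ∀ i ∈ s, SmoothNear (f i) x) :
    SmoothNear (fun z => ∑ i ∈ s, f i z) x := by
  have : ∀ᶠ z in 𝓝 x, ∀ i ∈ s, ContDiffAt ℝ ∞ (f i) z := by
    rw [Filter.eventually_all_finset]; exact h
  filter_upwards [this] with z hz using ContDiffAt.sum hz

lemma pi {ι : Type*} [Fintype ι] {f : E → ι → F} (h : ∀ i, SmoothNear (fun z => f z i) x) :
    SmoothNear f x := by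
  filter_upwards [Filter.eventually_all.2 h] with z hz using contDiffAt_pi.2 hz

/-- A pointwise continuous linear family is smooth when all its values are, on a
finite-dimensional space. -/
lemma of_apply [FiniteDimensional ℝ F] {L : E → F →L[ℝ] G}
    (h : ∀ v, SmoothNear (fun z => L z v) x) : SmoothNear L x := by
  let b := Module.finBasis ℝ F
  have key : L = fun z => ∑ i, ContinuousLinearMap.smulRightL ℝ F G
      (LinearMap.toContinuousLinearMap (b.coord i)) (L z (b i)) := by
    ext z y
    have : (L z) y = ∑ i, (b.repr y) i • (L z) (b i) := by
      conv_lhs => rw [← b.sum_repr y, map_sum]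
      simp only [map_smul]
    simpa using this
  rw [key]
  exact sum fun i _ => comp (h := ContinuousLinearMap.smulRightL ℝ F G
    (LinearMap.toContinuousLinearMap (b.coord i))) (of_clm _) (h (b i))

end SmoothNear

lemma ContinuousLinearMap.IsInvertible.eventually [CompleteSpace E] {L : E →L[ℝ] F}
    (h : L.IsInvertible) : ∀ᶠ L' in 𝓝 L, L'.IsInvertible := by
  obtain ⟨e, rfl⟩ := h
  filter_upwards [ContinuousLinearEquiv.nhds e] with L' hL'
  obtain ⟨e₁, rfl⟩ := hL'
  exact ⟨e₁, rfl⟩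

/-- A partial homeomorphism of normed spaces that is smooth together with its inverse. -/
structure OpenPartialHomeomorph.IsSmooth (e : OpenPartialHomeomorph E F) : Prop where
  contDiffAt : ∀ z ∈ e.source, ContDiffAt ℝ ∞ e z
  contDiffAt_symm : ∀ w ∈ e.target, ContDiffAt ℝ ∞ e.symm w

namespace OpenPartialHomeomorph.IsSmooth

variable {e : OpenPartialHomeomorph E F}

lemma symm (he : e.IsSmooth) : e.symm.IsSmooth := ⟨he.contDiffAt_symm, he.contDiffAt⟩

lemma smoothNear (he : e.IsSmooth) {z : E} (hz : z ∈ e.source) : SmoothNear e z := by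
  filter_upwards [e.open_source.mem_nhds hz] with w hw using he.contDiffAt w hw

lemma fderiv_symm_comp_fderiv (he : e.IsSmooth) {z : E} (hz : z ∈ e.source) :
    fderiv ℝ e.symm (e z) ∘L fderiv ℝ e z = ContinuousLinearMap.id ℝ E := by
  have h1 := ((he.contDiffAt_symm _ (e.map_source hz)).differentiableAt (by simp)).hasFDerivAt.comp
    z ((he.contDiffAt z hz).differentiableAt (by simp)).hasFDerivAt
  refine (h1.congr_of_eventuallyEq ?_).unique (hasFDerivAt_id z)
  filter_upwards [e.open_source.mem_nhds hz] with w hw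
  exact (e.left_inv hw).symm

lemma fderiv_comp_fderiv_symm (he : e.IsSmooth) {z : E} (hz : z ∈ e.source) :
    fderiv ℝ e z ∘L fderiv ℝ e.symm (e z) = ContinuousLinearMap.id ℝ F := by
  have := he.symm.fderiv_symm_comp_fderiv (e.map_source hz)
  rwa [OpenPartialHomeomorph.symm_symm, e.left_inv hz] at this

lemma isInvertible_fderiv (he : e.IsSmooth) {z : E} (hz : z ∈ e.source) :
    (fderiv ℝ e z).IsInvertible :=
  .of_inverse (he.fderiv_comp_fderiv_symm hz) (he.fderiv_symm_comp_fderiv hz)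

lemma fderiv_symm_eq (he : e.IsSmooth) {z : E} (hz : z ∈ e.source) :
    fderiv ℝ e.symm (e z) = (fderiv ℝ e z).inverse :=
  (ContinuousLinearMap.inverse_eq (he.fderiv_comp_fderiv_symm hz)
    (he.fderiv_symm_comp_fderiv hz)).symm

end OpenPartialHomeomorph.IsSmooth

/-- Inverse function theorem for maps smooth near a point. -/
lemma SmoothNear.exists_openPartialHomeomorph [CompleteSpace E] {f : E → F} {x : E}
    (hf : SmoothNear f x) (hinv : (_root_.fderiv ℝ f x).IsInvertible) :
    ∃ e : OpenPartialHomeomorph E F, x ∈ e.source ∧ ⇑e = f ∧ e.IsSmooth := by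
  obtain ⟨L, hL⟩ := hinv
  have hd : HasFDerivAt f (L : E →L[ℝ] F) x := by
    rw [hL]; exact hf.differentiableAt.hasFDerivAt
  let e₀ := hf.contDiffAt.toOpenPartialHomeomorph f hd (by simp)
  have he₀ : ∀ z, e₀ z = f z := fun z => rfl
  have hx : x ∈ e₀.source := hf.contDiffAt.mem_toOpenPartialHomeomorph_source hd (by simp)
  -- Smoothness of the inverse is needed on the whole target, so the source is cut down to points
  -- where `f` is smooth with invertible derivative.
  have hev : ∀ᶠ z in 𝓝 x, ContDiffAt ℝ ∞ f z ∧ (_root_.fderiv ℝ f z).IsInvertible := by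
    have h2 := hf.fderiv.continuousAt.eventually
      (ContinuousLinearMap.IsInvertible.eventually (L := _root_.fderiv ℝ f x) ⟨L, hL⟩)
    filter_upwards [hf, h2] with z h1 h2 using ⟨h1, h2⟩
  obtain ⟨U, hU, hUo, hxU⟩ := eventually_nhds_iff.1 hev
  refine ⟨e₀.restrOpen U hUo, ⟨hx, hxU⟩, funext he₀, fun z hz => (hU z hz.2).1, ?_⟩
  intro w hw
  have hw' := (e₀.restrOpen U hUo).map_target hw
  set z := (e₀.restrOpen U hUo).symm w with hz
  obtain ⟨h1, L', hL'⟩ := hU z hw'.2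
  refine OpenPartialHomeomorph.contDiffAt_symm _ hw (f₀' := L') ?_ ?_
  · rw [hL']; exact (h1.differentiableAt (by simp)).hasFDerivAt
  · exact h1

end SmoothNear

/-! ### Smoothness of composition operators on spaces of continuous functions -/

section Superposition

universe u

variable {K : Type*} [TopologicalSpace K] [CompactSpace K]
  {E F : Type u} [NormedAddCommGroup E] [NormedSpace ℝ E] [NormedAddCommGroup F] [NormedSpace ℝ F]

/-- The pointwise application of a continuous family of continuous linear maps. -/
noncomputable def ContinuousMap.clmApplyL :
    C(K, E →L[ℝ] F) →L[ℝ] C(K, E) →L[ℝ] C(K, F) :=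
  LinearMap.mkContinuous₂
    (LinearMap.mk₂ ℝ (fun (L : C(K, E →L[ℝ] F)) (u : C(K, E)) =>
        (⟨fun k => L k (u k), L.continuous.clm_apply u.continuous⟩ : C(K, F)))
      (fun _ _ _ => by ext; simp) (fun _ _ _ => by ext; simp)
      (fun _ _ _ => by ext; simp) (fun _ _ _ => by ext; simp)) 1 (by
    intro L u
    rw [ContinuousMap.norm_le _ (by positivity), one_mul]
    intro k
    exact (ContinuousLinearMap.le_opNorm _ _).trans
      (mul_le_mul (L.norm_coe_le_norm k) (u.norm_coe_le_norm k) (norm_nonneg _) (norm_nonneg L)))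

/-- Composition with the continuous map `fderiv ℝ f` is continuous at `u` in the sup norm, so
`fderiv ℝ f` oscillates by at most `c` on balls of one radius `δ` around all values `u k`. The mean
value inequality on these balls bounds the remainder uniformly in `k`. -/
lemma ContinuousMap.hasFDerivAt_comp_left {f : E → F} (hf : ContDiff ℝ 1 f) (u : C(K, E)) :
    HasFDerivAt (fun u : C(K, E) => (⟨f, hf.continuous⟩ : C(E, F)).comp u)
      (ContinuousMap.clmApplyL
        ((⟨fderiv ℝ f, hf.continuous_fderiv (by simp)⟩ : C(E, E →L[ℝ] F)).comp u)) u := by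
  set D : C(E, E →L[ℝ] F) := ⟨fderiv ℝ f, hf.continuous_fderiv (by simp)⟩
  rw [hasFDerivAt_iff_isLittleO_nhds_zero, Asymptotics.isLittleO_iff]
  intro c hc
  have hcont : ContinuousAt (fun u : C(K, E) => D.comp u) u :=
    (ContinuousMap.continuous_postcomp D).continuousAt
  obtain ⟨δ, hδ, hD⟩ := (Metric.continuousAt_iff (α := C(K, E)) (β := C(K, E →L[ℝ] F))
    (f := fun u => D.comp u)).1 hcont c hc
  filter_upwards [Metric.ball_mem_nhds (0 : C(K, E)) hδ] with v hv
  rw [ContinuousMap.norm_le _ (by positivity)]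
  intro k
  have hvk : ‖v k‖ < δ := (v.norm_coe_le_norm k).trans_lt (by simpa using hv)
  have key : ∀ z ∈ Metric.ball (u k) δ, ‖fderiv ℝ f z - fderiv ℝ f (u k)‖ ≤ c := by
    intro z hz
    -- The translate of `u` by the constant `z - u k` is `δ`-close to `u` and takes the value `z` at
    -- `k`.
    have h1 : dist (u + ContinuousMap.const K (z - u k)) u < δ := by
      rw [dist_eq_norm, add_sub_cancel_left]
      refine lt_of_le_of_lt ?_ (mem_ball_iff_norm.1 hz)
      rw [ContinuousMap.norm_le _ (norm_nonneg _)]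
      intro k'; simp
    have h2 := (ContinuousMap.dist_apply_le_dist k).trans_lt (hD h1)
    simp only [D, ContinuousMap.comp_apply, ContinuousMap.add_apply, ContinuousMap.const_apply,
      ContinuousMap.coe_mk, add_sub_cancel, dist_eq_norm] at h2
    exact h2.le
  have h3 := Convex.norm_image_sub_le_of_norm_hasFDerivWithin_le' (𝕜 := ℝ) (f := f)
    (fun z _ => ((hf.differentiable (by simp)) z).hasFDerivAt.hasFDerivWithinAt) key
    (convex_ball (u k) δ) (Metric.mem_ball_self hδ) (y := u k + v k)
    (by simpa [Metric.mem_ball, dist_eq_norm] using hvk)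
  simp only [add_sub_cancel_left] at h3
  exact h3.trans (mul_le_mul_of_nonneg_left (v.norm_coe_le_norm k) hc.le)

/-- The derivative of composition with `f` is composition with `fderiv ℝ f`, followed by a bounded
linear operator; hence an induction on the order. It replaces `F` by `E →L[ℝ] F`, which is why `E`
and `F` share a universe. -/
lemma ContinuousMap.contDiff_comp_left {f : E → F} (hf : ContDiff ℝ ∞ f) :
    ContDiff ℝ ∞ (fun u : C(K, E) => (⟨f, hf.continuous⟩ : C(E, F)).comp u) := by
  rw [contDiff_infty]
  intro n
  induction n generalizing F with
  | zero => exact contDiff_zero.2 (ContinuousMap.continuous_postcomp _)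
  | succ n ih =>
    push_cast
    have h1 : ContDiff ℝ 1 f := hf.of_le (by simp)
    have hD : ContDiff ℝ ∞ (fderiv ℝ f) := hf.fderiv_right (by simp)
    rw [contDiff_succ_iff_hasFDerivAt]
    refine ⟨_, ?_, fun u => ContinuousMap.hasFDerivAt_comp_left h1 u⟩
    exact ContinuousMap.clmApplyL.contDiff.comp (ih hD)

end Superposition

/-! ### Smooth local flows -/

section Flow

universe u

variable {E : Type u} [NormedAddCommGroup E] [NormedSpace ℝ E]

/-- The primitive `t ↦ ∫₀ᵗ u` as an operator on continuous functions on the unit interval. -/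
noncomputable def primitiveL : C(Set.Icc (0 : ℝ) 1, E) →L[ℝ] C(Set.Icc (0 : ℝ) 1, E) :=
  LinearMap.mkContinuous
    { toFun := fun u => ⟨fun t => ∫ s in (0 : ℝ)..t, u.IccExtend zero_le_one s,
        (intervalIntegral.continuous_primitive (fun a b =>
          (u.IccExtend zero_le_one).continuous.intervalIntegrable a b) 0).comp
          continuous_subtype_val⟩
      map_add' := fun u v => by
        ext t
        exact intervalIntegral.integral_add
          ((u.IccExtend zero_le_one).continuous.intervalIntegrable _ _)
          ((v.IccExtend zero_le_one).continuous.intervalIntegrable _ _)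
      map_smul' := fun c u => by
        ext t
        exact intervalIntegral.integral_smul c _ } 1 (by
    intro u
    rw [one_mul, ContinuousMap.norm_le _ (norm_nonneg _)]
    intro t
    have := intervalIntegral.norm_integral_le_of_norm_le_const (a := 0) (b := (t : ℝ)) (C := ‖u‖)
      (f := u.IccExtend zero_le_one) (fun s _ => u.norm_coe_le_norm _)
    refine this.trans ?_
    rw [sub_zero, abs_of_nonneg t.2.1]
    exact mul_le_of_le_one_right (norm_nonneg _) t.2.2)

lemma primitiveL_apply (u : C(Set.Icc (0 : ℝ) 1, E)) (t : Set.Icc (0 : ℝ) 1) :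
    primitiveL u t = ∫ s in (0 : ℝ)..t, u.IccExtend zero_le_one s := rfl

/-- Rescaled to the unit interval, the orbit `s ↦ φ (s t, x)` is a zero of `u - x - t ∫ f ∘ u` in
`C([0,1], E)`. At `t = 0` the zero is the constant path and the derivative in `u` is the identity,
so the inverse function theorem gives a zero depending smoothly on `(t, x)`, and `φ (t, x)` is its
end point. -/
lemma exists_flow_of_contDiff [CompleteSpace E] {f : E → E} (hf : ContDiff ℝ ∞ f) (x₀ : E) :
    ∃ φ : ℝ × E → E, SmoothNear φ (0, x₀) ∧ (∀ᶠ x in 𝓝 x₀, φ (0, x) = x) ∧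
      ∀ᶠ p in 𝓝 ((0 : ℝ), x₀), HasDerivAt (fun t => φ (t, p.2)) (f (φ p)) p.1 := by
  let c : E →L[ℝ] C(Set.Icc (0 : ℝ) 1, E) := ContinuousLinearMap.const ℝ (Set.Icc (0 : ℝ) 1)
  let N : C(Set.Icc (0 : ℝ) 1, E) → C(Set.Icc (0 : ℝ) 1, E) := fun u => (⟨f, hf.continuous⟩ : C(E, E)).comp u
  have hN : ContDiff ℝ ∞ N := ContinuousMap.contDiff_comp_left hf
  -- The parameters are kept as a first component, so that the implicit function is obtained by
  -- inverting `G`.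
  let G : (ℝ × E) × C(Set.Icc (0 : ℝ) 1, E) → (ℝ × E) × C(Set.Icc (0 : ℝ) 1, E) :=
    fun p => (p.1, p.2 - c p.1.2 - p.1.1 • primitiveL (N p.2))
  have hG : ContDiff ℝ ∞ G := by
    refine contDiff_fst.prodMk ((contDiff_snd.sub (c.contDiff.comp contDiff_fst.snd)).sub ?_)
    exact contDiff_fst.fst.smul (primitiveL.contDiff.comp (hN.comp contDiff_snd))
  let p₀ : (ℝ × E) × C(Set.Icc (0 : ℝ) 1, E) := ((0, x₀), c x₀)
  have hinv : (fderiv ℝ G p₀).IsInvertible := by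
    -- The derivative of `G` at `p₀` is unipotent: `(a, v) ↦ (a, v + T a)`.
    let T : ℝ × E →L[ℝ] C(Set.Icc (0 : ℝ) 1, E) :=
      - (c ∘L ContinuousLinearMap.snd ℝ ℝ E) -
        (ContinuousLinearMap.fst ℝ ℝ E).smulRight (primitiveL (N (c x₀)))
    refine ⟨(ContinuousLinearEquiv.refl ℝ (ℝ × E)).skewProd
      (ContinuousLinearEquiv.refl ℝ C(Set.Icc (0 : ℝ) 1, E)) T, ?_⟩
    have hd : DifferentiableAt ℝ
        (fun p : (ℝ × E) × C(Set.Icc (0 : ℝ) 1, E) => primitiveL (N p.2)) p₀ := by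
      have : ContDiff ℝ ∞
          (fun p : (ℝ × E) × C(Set.Icc (0 : ℝ) 1, E) => primitiveL (N p.2)) :=
        primitiveL.contDiff.comp (hN.comp contDiff_snd)
      exact this.differentiable (by simp) p₀
    have h1 : HasFDerivAt (fun p : (ℝ × E) × C(Set.Icc (0 : ℝ) 1, E) => p.1.1)
        (ContinuousLinearMap.fst ℝ ℝ E ∘L ContinuousLinearMap.fst ℝ (ℝ × E) C(Set.Icc (0 : ℝ) 1, E)) p₀ :=
      (ContinuousLinearMap.fst ℝ ℝ E ∘L
        ContinuousLinearMap.fst ℝ (ℝ × E) C(Set.Icc (0 : ℝ) 1, E)).hasFDerivAt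
    have h2 : HasFDerivAt (fun p : (ℝ × E) × C(Set.Icc (0 : ℝ) 1, E) => p.2 - c p.1.2)
        (ContinuousLinearMap.snd ℝ (ℝ × E) C(Set.Icc (0 : ℝ) 1, E) -
          c ∘L ContinuousLinearMap.snd ℝ ℝ E ∘L ContinuousLinearMap.fst ℝ (ℝ × E) C(Set.Icc (0 : ℝ) 1, E)) p₀ :=
      hasFDerivAt_snd.sub (c.hasFDerivAt.comp p₀ (hasFDerivAt_snd.comp p₀ hasFDerivAt_fst))
    have h3 := (hasFDerivAt_fst (𝕜 := ℝ) (p := p₀)).prodMk (h2.sub (h1.smul hd.hasFDerivAt))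
    refine Eq.trans ?_ (HasFDerivAt.fderiv (f := G) h3).symm
    refine ContinuousLinearMap.ext fun v => Prod.ext rfl ?_
    simp only [ContinuousLinearEquiv.coe_coe, ContinuousLinearEquiv.skewProd_apply]
    change v.2 + (-c v.1.2 - v.1.1 • primitiveL (N (c x₀))) =
      v.2 - c v.1.2 - ((0 : ℝ) • _ + v.1.1 • primitiveL (N (c x₀)))
    rw [zero_smul]
    abel
  obtain ⟨e, he0, heG', he⟩ :=
    (SmoothNear.of_contDiff hG (x := p₀)).exists_openPartialHomeomorph hinv
  have hesymm := he.contDiffAt_symm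
  have heG : ∀ z, e z = G z := fun z => congrFun heG' z
  have hGp₀ : G p₀ = ((0, x₀), 0) := by simp [G, p₀]
  let q : ℝ × E → (ℝ × E) × C(Set.Icc (0 : ℝ) 1, E) := fun p => (p, 0)
  have hq : ContDiff ℝ ∞ q := contDiff_id.prodMk contDiff_const
  have hqt : ∀ᶠ p in 𝓝 ((0 : ℝ), x₀), q p ∈ e.target := by
    refine hq.continuous.continuousAt.eventually (e.open_target.mem_nhds ?_)
    have := e.map_source he0
    rwa [heG, hGp₀] at this
  let u : ℝ × E → C(Set.Icc (0 : ℝ) 1, E) := fun p => (e.symm (q p)).2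
  have hu : SmoothNear u (0, x₀) := by
    filter_upwards [hqt] with p hp
    exact ((hesymm _ hp).comp p hq.contDiffAt).snd
  have hu₀ : u (0, x₀) = c x₀ := by
    have : e.symm (e p₀) = p₀ := e.left_inv he0
    rw [heG, hGp₀] at this
    simp only [u, q, this, p₀]
  -- a product neighbourhood in the source of `e`
  obtain ⟨δ, hδ, hball⟩ := Metric.isOpen_iff.1 e.open_source p₀ he0
  have hnear : ∀ᶠ p in 𝓝 ((0 : ℝ), x₀), q p ∈ e.target ∧ ‖u p - c x₀‖ < δ := by
    refine hqt.and ?_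
    have := Metric.continuousAt_iff'.1 hu.continuousAt δ hδ
    rw [hu₀] at this
    simpa only [dist_eq_norm] using this
  obtain ⟨η, hη, hnear⟩ := Metric.eventually_nhds_iff_ball.1 hnear
  let ρ := min η δ
  have hρ : 0 < ρ := lt_min hη hδ
  have hfix : ∀ p ∈ Metric.ball ((0 : ℝ), x₀) ρ,
      u p = c p.2 + p.1 • primitiveL (N (u p)) := by
    intro p hp
    have h1 := e.right_inv (hnear p (Metric.ball_subset_ball (min_le_left _ _) hp)).1
    rw [heG] at h1
    have h2 : (e.symm (q p)).1 = p := congrArg Prod.fst h1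
    have h3 : (e.symm (q p)).2 - c (e.symm (q p)).1.2 -
      (e.symm (q p)).1.1 • primitiveL (N (e.symm (q p)).2) = 0 := congrArg Prod.snd h1
    rw [h2] at h3
    rw [← sub_eq_zero, ← sub_sub]
    exact h3
  -- Injectivity of `e` on its source makes solutions close to the constant path unique.
  have huniq : ∀ p ∈ Metric.ball ((0 : ℝ), x₀) ρ, ∀ w : C(Set.Icc (0 : ℝ) 1, E), ‖w - c x₀‖ < δ →
      w = c p.2 + p.1 • primitiveL (N w) → w = u p := by
    intro p hp w hw hfw
    have hmem : (p, w) ∈ e.source := by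
      apply hball
      rw [← ball_prod_same]
      exact ⟨Metric.ball_subset_ball (min_le_right _ _) hp, mem_ball_iff_norm.2 hw⟩
    have h1 : e (p, w) = q p := by
      rw [heG]
      refine Prod.ext rfl ?_
      change w - c p.2 - p.1 • primitiveL (N w) = 0
      rw [sub_sub, sub_eq_zero]
      exact hfw
    have h2 := e.left_inv hmem
    rw [h1] at h2
    simp only [u, h2]
  let φ : ℝ × E → E := fun p => u p ⟨1, by simp⟩
  -- The path `r ↦ u p (s r)` solves the equation for the time `s t`; by uniqueness it is the path
  -- chosen there, and its end point is `u p s`.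
  have hscale : ∀ p ∈ Metric.ball ((0 : ℝ), x₀) ρ, ∀ s : Set.Icc (0 : ℝ) 1, u p s = φ (s * p.1, p.2) := by
    intro p hp s
    have hp' : ((s : ℝ) * p.1, p.2) ∈ Metric.ball ((0 : ℝ), x₀) ρ := by
      rw [← ball_prod_same] at hp ⊢
      refine ⟨?_, hp.2⟩
      have := hp.1
      simp only [mem_ball_zero_iff, norm_mul] at this ⊢
      refine lt_of_le_of_lt (mul_le_of_le_one_left (norm_nonneg _) ?_) this
      rw [Real.norm_of_nonneg s.2.1]; exact s.2.2
    let m : C(Set.Icc (0 : ℝ) 1, Set.Icc (0 : ℝ) 1) := ⟨fun r => ⟨s * r, mul_nonneg s.2.1 r.2.1,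
      mul_le_one₀ s.2.2 r.2.1 r.2.2⟩, by fun_prop⟩
    have := huniq _ hp' ((u p).comp m) ?_ ?_
    · have h1 := congrArg (fun w : C(Set.Icc (0 : ℝ) 1, E) => w ⟨1, by simp⟩) this
      simp only [ContinuousMap.comp_apply] at h1
      refine Eq.trans ?_ h1
      congr 1
      apply Subtype.ext
      simp [m]
    · refine lt_of_le_of_lt ?_ (hnear p (Metric.ball_subset_ball (min_le_left _ _) hp)).2
      rw [ContinuousMap.norm_le _ (norm_nonneg _)]
      intro r
      exact (u p - c x₀).norm_coe_le_norm (m r)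
    · ext r
      have h1 := congrArg (fun w : C(Set.Icc (0 : ℝ) 1, E) => w (m r)) (hfix p hp)
      simp only [ContinuousMap.add_apply, ContinuousMap.smul_apply, primitiveL_apply] at h1
      simp only [ContinuousMap.add_apply, ContinuousMap.smul_apply, primitiveL_apply,
        ContinuousMap.comp_apply]
      rw [h1]
      change c p.2 (m r) + _ = c p.2 r + _
      rw [mul_comm, mul_smul]
      refine congrArg₂ _ rfl (congrArg _ ?_)
      have h2 := intervalIntegral.smul_integral_comp_mul_left (a := 0) (b := (r : ℝ))
        (fun x => (N (u p)).IccExtend zero_le_one x) (s : ℝ)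
      rw [mul_zero] at h2
      change ∫ x in (0 : ℝ)..(s * r : ℝ), _ = _
      rw [← h2]
      congr 1
      apply intervalIntegral.integral_congr
      intro x hx
      rw [Set.uIcc_of_le r.2.1] at hx
      have hx1 : x ∈ Set.Icc (0 : ℝ) 1 := ⟨hx.1, hx.2.trans r.2.2⟩
      change (N (u p)).IccExtend zero_le_one (s * x) = (N ((u p).comp m)).IccExtend zero_le_one x
      simp only [ContinuousMap.coe_IccExtend]
      rw [Set.IccExtend_of_mem _ _ hx1,
        Set.IccExtend_of_mem _ _ (show (s : ℝ) * x ∈ Set.Icc (0 : ℝ) 1 from (m ⟨x, hx1⟩).2)]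
      rfl
  have hφ : SmoothNear φ (0, x₀) := by
    filter_upwards [hu] with p hp
    exact (ContinuousMap.evalCLM ℝ (⟨1, by simp⟩ : Set.Icc (0 : ℝ) 1)).contDiff.contDiffAt.comp p hp
  -- Undoing the rescaling by a substitution gives the usual integral equation, which can be
  -- differentiated in time.
  have hint : ∀ p ∈ Metric.ball ((0 : ℝ), x₀) ρ,
      φ p = p.2 + ∫ t in (0 : ℝ)..p.1, f (φ (t, p.2)) := by
    intro p hp
    have h1 := congrArg (fun w : C(Set.Icc (0 : ℝ) 1, E) => w ⟨1, by simp⟩) (hfix p hp)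
    simp only [ContinuousMap.add_apply, ContinuousMap.smul_apply, primitiveL_apply] at h1
    change φ p = _ at h1
    rw [h1]
    congr 1
    have h2 := intervalIntegral.smul_integral_comp_mul_left (a := 0) (b := 1)
        (fun t => f (φ (t, p.2))) p.1
    rw [mul_zero, mul_one] at h2
    rw [← h2]
    congr 1
    apply intervalIntegral.integral_congr
    intro x hx
    rw [Set.uIcc_of_le zero_le_one] at hx
    change (N (u p)).IccExtend zero_le_one x = f (φ (p.1 * x, p.2))
    rw [mul_comm, ← hscale p hp ⟨x, hx⟩, ContinuousMap.coe_IccExtend, Set.IccExtend_of_mem _ _ hx]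
    rfl
  refine ⟨φ, hφ, ?_, ?_⟩
  · filter_upwards [Metric.ball_mem_nhds x₀ hρ] with x hx
    have := hint (0, x) (by rw [← ball_prod_same]; exact ⟨Metric.mem_ball_self hρ, hx⟩)
    simpa using this
  · obtain ⟨r, hr, hsm⟩ := Metric.eventually_nhds_iff_ball.1 hφ
    filter_upwards [Metric.ball_mem_nhds ((0 : ℝ), x₀) (lt_min hρ hr)] with p hp
    have hb : ∀ t ∈ Metric.ball (0 : ℝ) (min ρ r),
        (t, p.2) ∈ Metric.ball ((0 : ℝ), x₀) (min ρ r) := by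
      intro t ht
      rw [← ball_prod_same] at hp ⊢
      exact ⟨ht, hp.2⟩
    have hp1 : p.1 ∈ Metric.ball (0 : ℝ) (min ρ r) := by
      rw [← ball_prod_same] at hp; exact hp.1
    have hcont : ContinuousOn (fun t => f (φ (t, p.2))) (Metric.ball (0 : ℝ) (min ρ r)) := by
      intro t ht
      apply ContinuousAt.continuousWithinAt
      apply hf.continuous.continuousAt.comp
      exact ContinuousAt.comp (f := fun t : ℝ => (t, p.2)) (hsm _ (Metric.ball_subset_ball (min_le_right _ _) (hb t ht))).continuousAt
        (by fun_prop)
    have hsub : Set.uIcc 0 p.1 ⊆ Metric.ball (0 : ℝ) (min ρ r) :=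
      (convex_ball (0 : ℝ) _).ordConnected.uIcc_subset
        (Metric.mem_ball_self (lt_min hρ hr)) hp1
    have hder := intervalIntegral.integral_hasDerivAt_right
      ((hcont.mono hsub).intervalIntegrable)
      (hcont.stronglyMeasurableAtFilter Metric.isOpen_ball p.1 hp1)
      (hcont.continuousAt (Metric.isOpen_ball.mem_nhds hp1))
    have := (hder.const_add p.2)
    refine this.congr_of_eventuallyEq ?_
    filter_upwards [Metric.isOpen_ball.mem_nhds hp1] with t ht
    exact hint (t, p.2) (Metric.ball_subset_ball (min_le_left _ _) (hb t ht))

/-- A vector field smooth near a point has a smooth local flow. -/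
lemma SmoothNear.exists_flow [FiniteDimensional ℝ E] {f : E → E} {x₀ : E} (hf : SmoothNear f x₀) :
    ∃ φ : ℝ × E → E, SmoothNear φ (0, x₀) ∧ (∀ᶠ x in 𝓝 x₀, φ (0, x) = x) ∧
      ∀ᶠ p in 𝓝 ((0 : ℝ), x₀), HasDerivAt (fun t => φ (t, p.2)) (f (φ p)) p.1 := by
  have : CompleteSpace E := FiniteDimensional.complete ℝ E
  obtain ⟨r, hr, hfr⟩ := Metric.eventually_nhds_iff_ball.1 hf
  -- The field is cut off to a globally smooth one. Its flow is a flow of `f` as long as it stays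
  -- where the cutoff is `1`.
  let χ : ContDiffBump x₀ := ⟨r / 3, r / 2, by positivity, by linarith⟩
  have hg : ContDiff ℝ ∞ (fun x => χ x • f x) := by
    rw [contDiff_iff_contDiffAt]
    intro x
    by_cases hx : x ∈ Metric.ball x₀ r
    · exact χ.contDiffAt.smul (hfr x hx)
    · have : (fun x => χ x • f x) =ᶠ[𝓝 x] fun _ => 0 := by
        have hx' : x ∈ (Metric.closedBall x₀ (r / 2))ᶜ := by
          simp only [Metric.mem_ball, not_lt] at hx
          simp only [Set.mem_compl_iff, Metric.mem_closedBall, not_le]; linarith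
        filter_upwards [Metric.isClosed_closedBall.isOpen_compl.mem_nhds hx'] with z hz
        have : χ z = 0 := χ.zero_of_le_dist (by
          simp only [Set.mem_compl_iff, Metric.mem_closedBall, not_le] at hz
          exact hz.le)
        simp [this]
      exact contDiffAt_const.congr_of_eventuallyEq this
  obtain ⟨φ, h1, h2, h3⟩ := exists_flow_of_contDiff hg x₀
  refine ⟨φ, h1, h2, ?_⟩
  have h4 : ∀ᶠ p in 𝓝 ((0 : ℝ), x₀), χ (φ p) = 1 := by
    have h5 : ∀ᶠ z in 𝓝 (φ (0, x₀)), χ z = 1 := by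
      rw [h2.self_of_nhds]; exact χ.eventuallyEq_one
    exact h1.continuousAt.eventually h5
  filter_upwards [h3, h4] with p hp hp'
  simpa [hp'] using hp

end Flow

/-! ### Finite families of vector fields, their pullbacks and involutivity -/

section Anchors

variable {E K V W : Type*} [NormedAddCommGroup E] [NormedSpace ℝ E] [NormedAddCommGroup K]
  [NormedSpace ℝ K] [NormedAddCommGroup V] [NormedSpace ℝ V] [NormedAddCommGroup W]
  [NormedSpace ℝ W]

lemma SmoothNear.clm_prod {L : E → V →L[ℝ] K} {L' : E → V →L[ℝ] W} {x : E} (hL : SmoothNear L x)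
    (hL' : SmoothNear L' x) : SmoothNear (fun z => (L z).prod (L' z)) x := by
  have : (fun z => (L z).prod (L' z)) = fun z =>
      ContinuousLinearMap.inl ℝ K W ∘L L z + ContinuousLinearMap.inr ℝ K W ∘L L' z := by
    ext z v <;> simp
  rw [this]
  exact ((SmoothNear.const _).clm_comp hL).add ((SmoothNear.const _).clm_comp hL')

/-- The module of vector fields spanned by `Y` is, near `x`, the pullback under the submersion `f`
of the module of vector fields spanned by `Z`. A finite family of vector fields is encoded as a
map `Y : E → V →L[ℝ] E`, `V` being the space of coefficients. -/
structure PullsBack (Y : E → V →L[ℝ] E) (x : E) (f : E → K) (Z : K → W →L[ℝ] K) : Prop where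
  smooth : SmoothNear f x
  surj : ∀ᶠ z in 𝓝 x, Function.Surjective (fderiv ℝ f z)
  push : ∃ a : E → V →L[ℝ] W, SmoothNear a x ∧
    ∀ᶠ z in 𝓝 x, ∀ v, fderiv ℝ f z (Y z v) = Z (f z) (a z v)
  lift : ∃ C : E → (E × W) →L[ℝ] V, SmoothNear C x ∧
    ∀ᶠ z in 𝓝 x, ∀ v g, fderiv ℝ f z v = Z (f z) g → Y z (C z (v, g)) = v

/-- The vector fields `Y · a` are in involution near `x`. -/
def Involutive (Y : E → V →L[ℝ] E) (x : E) : Prop :=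
  ∃ c : E → V →L[ℝ] V →L[ℝ] V, SmoothNear c x ∧ ∀ᶠ z in 𝓝 x, ∀ a b,
    VectorField.lieBracket ℝ (fun z => Y z a) (fun z => Y z b) z = Y z (c z a b)

/-- Transitivity allows splitting off one dimension at a time. To lift through the composite, `D`
first gives coefficients for the projected vector `d f v`, and `C` then lifts `v` with these
coefficients. -/
lemma PullsBack.comp {K' W' : Type*} [NormedAddCommGroup K'] [NormedSpace ℝ K']
    [NormedAddCommGroup W'] [NormedSpace ℝ W']
    {Y : E → V →L[ℝ] E} {x : E} {f : E → K} {Z : K → W →L[ℝ] K} {y : K} {f' : K → K'}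
    {Z' : K' → W' →L[ℝ] K'} (h : PullsBack Y x f Z) (hxy : f x = y) (h' : PullsBack Z y f' Z') :
    PullsBack Y x (fun z => f' (f z)) Z' := by
  subst hxy
  have hcont := h.smooth.continuousAt
  have hder : ∀ᶠ z in 𝓝 x, fderiv ℝ (fun z => f' (f z)) z = fderiv ℝ f' (f z) ∘L fderiv ℝ f z := by
    filter_upwards [h.smooth, hcont.eventually h'.smooth] with z h1 h2
    exact fderiv_comp z (h2.differentiableAt (by simp)) (h1.differentiableAt (by simp))
  obtain ⟨a, ha, ha'⟩ := h.push
  obtain ⟨b, hb, hb'⟩ := h'.push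
  obtain ⟨C, hC, hC'⟩ := h.lift
  obtain ⟨D, hD, hD'⟩ := h'.lift
  refine ⟨h'.smooth.comp h.smooth, ?_, ⟨fun z => b (f z) ∘L a z,
    (hb.comp h.smooth).clm_comp ha, ?_⟩, ⟨fun z => C z ∘L
      (ContinuousLinearMap.fst ℝ E W').prod (D (f z) ∘L
        (fderiv ℝ f z ∘L ContinuousLinearMap.fst ℝ E W').prod
          (ContinuousLinearMap.snd ℝ E W')), ?_, ?_⟩⟩
  · filter_upwards [hder, h.surj, hcont.eventually h'.surj] with z h1 h2 h3
    rw [h1]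
    exact h3.comp h2
  · filter_upwards [hder, ha', hcont.eventually hb'] with z h1 h2 h3 v
    rw [h1, ContinuousLinearMap.comp_apply, h2, h3]
    rfl
  · refine hC.clm_comp ?_
    have h1 : SmoothNear (fun z => (fderiv ℝ f z ∘L ContinuousLinearMap.fst ℝ E W').prod
          (ContinuousLinearMap.snd ℝ E W')) x := by
      exact (h.smooth.fderiv.clm_comp (.const _)).clm_prod (.const _)
    exact SmoothNear.clm_prod (.const _) ((hD.comp h.smooth).clm_comp h1)
  · filter_upwards [hder, hC', hcont.eventually hD'] with z h1 h2 h3 v g hvg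
    rw [h1, ContinuousLinearMap.comp_apply] at hvg
    exact h2 _ _ (h3 _ _ hvg).symm

variable {E' : Type*} [NormedAddCommGroup E'] [NormedSpace ℝ E']

lemma SmoothNear.inverse [CompleteSpace E'] {L : E → E' →L[ℝ] K} {x : E} (hL : SmoothNear L x)
    (h : (L x).IsInvertible) : SmoothNear (fun z => (L z).inverse) x := by
  filter_upwards [hL, hL.continuousAt.eventually h.eventually] with z h1 h2
  exact h2.contDiffAt_map_inverse.comp z h1

/-- A family and its transport under a diffeomorphism have the same coefficients, so both
coefficient maps are trivial. -/
lemma PullsBack.of_chart {e : OpenPartialHomeomorph E' E} (he : e.IsSmooth) {w : E'}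
    (hw : w ∈ e.source) (Y : E → V →L[ℝ] E) :
    PullsBack Y (e w) e.symm (fun w => (fderiv ℝ e w).inverse ∘L Y (e w)) := by
  have hmem : ∀ᶠ z in 𝓝 (e w), z ∈ e.target := e.open_target.mem_nhds (e.map_source hw)
  have hd : ∀ z ∈ e.target, fderiv ℝ e.symm z = (fderiv ℝ e (e.symm z)).inverse := by
    intro z hz
    have := he.fderiv_symm_eq (e.map_target hz)
    rwa [e.right_inv hz] at this
  refine ⟨he.symm.smoothNear (e.map_source hw), ?_, ⟨fun _ => ContinuousLinearMap.id ℝ V,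
    .const _, ?_⟩, ⟨fun _ => ContinuousLinearMap.snd ℝ E V, .const _, ?_⟩⟩
  · filter_upwards [hmem] with z hz
    exact (he.symm.isInvertible_fderiv hz).surjective
  · filter_upwards [hmem] with z hz v
    simp [hd z hz, e.right_inv hz]
  · filter_upwards [hmem] with z hz v g hvg
    rw [ContinuousLinearMap.comp_apply, e.right_inv hz, ← hd z hz] at hvg
    exact ((he.symm.isInvertible_fderiv hz).injective hvg).symm

/-- By naturality of the Lie bracket the structure functions are merely composed with `e`. -/
lemma Involutive.of_chart [CompleteSpace E'] [CompleteSpace E]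
    {e : OpenPartialHomeomorph E' E} (he : e.IsSmooth) {w : E'}
    (hw : w ∈ e.source) {Y : E → V →L[ℝ] E} (hY : SmoothNear Y (e w)) (h : Involutive Y (e w)) :
    Involutive (fun w => (fderiv ℝ e w).inverse ∘L Y (e w)) w := by
  obtain ⟨c, hc, hc'⟩ := h
  have hcont := (he.contDiffAt w hw).continuousAt
  refine ⟨fun w => c (e w), hc.comp (he.smoothNear hw), ?_⟩
  filter_upwards [hcont.eventually hc', hcont.eventually hY, e.open_source.mem_nhds hw]
    with z h1 h2 h3 a b
  have h4 : ∀ a, DifferentiableAt ℝ (fun z => Y z a) (e z) := fun a =>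
    (h2.clm_apply contDiffAt_const).differentiableAt (by simp)
  have := VectorField.pullback_lieBracket (n := ∞)
    (by simpa using SmoothVF.two_le_infty) (he.contDiffAt z h3)
    (h4 a) (h4 b)
  refine this.symm.trans ?_
  simp [VectorField.pullback, h1]

lemma SmoothNear.of_chart [CompleteSpace E'] {e : OpenPartialHomeomorph E' E} (he : e.IsSmooth)
    {w : E'} (hw : w ∈ e.source) {Y : E → V →L[ℝ] E} (hY : SmoothNear Y (e w)) :
    SmoothNear (fun w => (_root_.fderiv ℝ e w).inverse ∘L Y (e w)) w :=
  ((he.smoothNear hw).fderiv.inverse (he.isInvertible_fderiv hw)).clm_comp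
    (hY.comp (he.smoothNear hw))

end Anchors

/-! ### The splitting theorem -/

section Splitting

lemma eventually_eq_of_hasDerivAt_zero {H G : Type*} [NormedAddCommGroup H] [NormedAddCommGroup G] [NormedSpace ℝ G]
    {g : ℝ × H → G} {h₀ : H}
    (hg : ∀ᶠ p in 𝓝 ((0 : ℝ), h₀), HasDerivAt (fun t => g (t, p.2)) 0 p.1) :
    ∀ᶠ p in 𝓝 ((0 : ℝ), h₀), g p = g (0, p.2) := by
  obtain ⟨r, hr, hgr⟩ := Metric.eventually_nhds_iff_ball.1 hg
  filter_upwards [Metric.ball_mem_nhds ((0 : ℝ), h₀) hr] with p hp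
  rw [← ball_prod_same] at hp hgr
  have hd : ∀ t ∈ Metric.ball (0 : ℝ) r, HasDerivAt (fun t => g (t, p.2)) 0 t :=
    fun t ht => hgr (t, p.2) ⟨ht, hp.2⟩
  exact Metric.isOpen_ball.is_const_of_deriv_eq_zero (convex_ball (0 : ℝ) r).isPreconnected
    (fun t ht => (hd t ht).differentiableAt.differentiableWithinAt) (fun t ht => (hd t ht).deriv)
    hp.1 (Metric.mem_ball_self hr)

/-- Linear differential equations with parameters have solutions that are smooth in all
variables. -/
lemma exists_fundamental_solution {H V : Type*} [NormedAddCommGroup H] [NormedSpace ℝ H]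
    [FiniteDimensional ℝ H] [NormedAddCommGroup V] [NormedSpace ℝ V] [FiniteDimensional ℝ V]
    {C : ℝ × H → V →L[ℝ] V} {h₀ : H} (hC : SmoothNear C (0, h₀)) :
    ∃ B : ℝ × H → V →L[ℝ] V, SmoothNear B (0, h₀) ∧
      (∀ᶠ h in 𝓝 h₀, B (0, h) = ContinuousLinearMap.id ℝ V) ∧
      ∀ᶠ p in 𝓝 ((0 : ℝ), h₀), HasDerivAt (fun t => B (t, p.2)) (-(C p ∘L B p)) p.1 := by
  -- Time and parameter become extra coordinates, the first of speed one and the second at rest;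
  -- this makes the linear equation autonomous.
  let f : (ℝ × H) × (V →L[ℝ] V) → (ℝ × H) × (V →L[ℝ] V) := fun q => ((1, 0), -(C q.1 ∘L q.2))
  let i : H → (ℝ × H) × (V →L[ℝ] V) := fun h => ((0, h), ContinuousLinearMap.id ℝ V)
  have hi : ContDiff ℝ ∞ i := (contDiff_const.prodMk contDiff_id).prodMk contDiff_const
  have hf : SmoothNear f (i h₀) := by
    refine SmoothNear.prodMk (.const _) (SmoothNear.neg (SmoothNear.clm_comp ?_ ?_))
    · exact SmoothNear.comp_of_eq hC (.of_contDiff contDiff_fst) rfl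
    · exact .of_contDiff contDiff_snd
  obtain ⟨φ, h1, h2, h3⟩ := hf.exists_flow
  let j : ℝ × H → ℝ × ((ℝ × H) × (V →L[ℝ] V)) := fun p => (p.1, i p.2)
  have hj : ContDiff ℝ ∞ j := contDiff_fst.prodMk (hi.comp contDiff_snd)
  have hjc : ContinuousAt j (0, h₀) := hj.continuous.continuousAt
  have hder := hjc.eventually h3
  have hφ0 : ∀ᶠ h in 𝓝 h₀, φ (0, i h) = i h := hi.continuous.continuousAt.eventually h2
  have hfirst : ∀ᶠ p in 𝓝 ((0 : ℝ), h₀), (φ (j p)).1 = p := by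
    have h4 : ∀ᶠ p in 𝓝 ((0 : ℝ), h₀),
        HasDerivAt (fun t => (φ (j (t, p.2))).1 - (t, p.2)) 0 p.1 := by
      filter_upwards [hder] with p hp
      have h5 : HasDerivAt (fun t => (φ (j (t, p.2))).1) ((1 : ℝ), (0 : H)) p.1 :=
        (hasFDerivAt_fst.comp_hasDerivAt p.1 hp :)
      have := h5.sub ((hasDerivAt_id p.1).prodMk (hasDerivAt_const p.1 p.2))
      rw [sub_self] at this
      exact this
    filter_upwards [eventually_eq_of_hasDerivAt_zero
      (g := fun p => (φ (j p)).1 - p) h4,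
      (continuousAt_snd (p := ((0 : ℝ), h₀))).eventually hφ0] with p hp hp'
    have h6 : (φ (j (0, p.2))).1 = (0, p.2) := congrArg Prod.fst hp'
    rw [h6, sub_self, sub_eq_zero] at hp
    exact hp
  refine ⟨fun p => (φ (j p)).2, SmoothNear.snd (h1.comp_of_eq (.of_contDiff hj) rfl), ?_, ?_⟩
  · filter_upwards [hφ0] with h hh
    exact congrArg Prod.snd hh
  · filter_upwards [hder, hfirst] with p hp hp'
    have h5 : HasDerivAt (fun t => (φ (j (t, p.2))).2) (-(C (φ (j p)).1 ∘L (φ (j p)).2)) p.1 :=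
      (hasFDerivAt_snd.comp_hasDerivAt p.1 hp :)
    rwa [hp'] at h5

/-- Reduction of dimension: a family of vector fields in involution on `ℝ × H`, one of which is the
first coordinate field, is the pullback of a family on `H`. -/
lemma exists_pullsBack_snd {H V : Type*} [NormedAddCommGroup H] [NormedSpace ℝ H]
    [NormedAddCommGroup V] [NormedSpace ℝ V] [FiniteDimensional ℝ H] [FiniteDimensional ℝ V]
    {Y : ℝ × H → V →L[ℝ] ℝ × H} (hY : SmoothNear Y (0, 0)) (hinv : Involutive Y (0, 0)) (c₁ : V)
    (hc₁ : ∀ᶠ z in 𝓝 ((0 : ℝ), (0 : H)), Y z c₁ = (1, 0)) :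
    ∃ Z : H → V →L[ℝ] H, SmoothNear Z 0 ∧ Involutive Z 0 ∧ PullsBack Y (0, 0) Prod.snd Z := by
  obtain ⟨c, hc, hc'⟩ := hinv
  -- `C z b` are the coefficients of the bracket of the first coordinate field with `Y · b`, which
  -- is the derivative of `Y · b` in the first variable.
  let C : ℝ × H → V →L[ℝ] V := fun z => c z c₁
  have hC : SmoothNear C (0, 0) := hc.clm_apply (.const _)
  have hDY : ∀ᶠ z in 𝓝 ((0 : ℝ), (0 : H)), ∀ b, fderiv ℝ Y z (1, 0) b = Y z (C z b) := by
    filter_upwards [hc', hY, eventually_eventually_nhds.2 hc₁] with z h1 h2 h3 b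
    have h4 := h1 c₁ b
    rw [VectorField.lieBracket, Filter.EventuallyEq.fderiv_eq (f := fun _ => ((1 : ℝ), (0 : H))) h3,
      h3.self_of_nhds] at h4
    rw [← h4, fderiv_clm_apply (h2.differentiableAt (by simp)) (by fun_prop)]
    simp
  -- With `B' = -C B` the derivative of `Y B` in the first variable is `Y C B - Y C B = 0`. The
  -- frame `Y B` is thus independent of the variable to be removed.
  obtain ⟨B, hB, hB0, hB'⟩ := exists_fundamental_solution hC
  let M : ℝ × H → V →L[ℝ] H := fun z => ContinuousLinearMap.snd ℝ ℝ H ∘L Y z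
  have hM : SmoothNear M (0, 0) := SmoothNear.clm_comp (.const _) hY
  let i : H → ℝ × H := fun h => (0, h)
  have hi : ContDiff ℝ ∞ i := contDiff_const.prodMk contDiff_id
  have hic : ContinuousAt i 0 := hi.continuous.continuousAt
  have hinl : ∀ p : ℝ × H, HasDerivAt (fun t => ((t, p.2) : ℝ × H)) (1, 0) p.1 := fun p =>
    (hasDerivAt_id p.1).prodMk (hasDerivAt_const p.1 p.2)
  have hMB : ∀ᶠ p in 𝓝 ((0 : ℝ), (0 : H)), M p ∘L B p = M (0, p.2) := by
    have h4 : ∀ᶠ p in 𝓝 ((0 : ℝ), (0 : H)),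
        HasDerivAt (fun t => M (t, p.2) ∘L B (t, p.2)) 0 p.1 := by
      filter_upwards [hDY, hB', hY] with p h1 h2 h3
      have h5 : HasDerivAt (fun t => Y (t, p.2)) (fderiv ℝ Y p (1, 0)) p.1 :=
        HasFDerivAt.comp_hasDerivAt p.1 (h3.differentiableAt (by simp)).hasFDerivAt (hinl p)
      have h6 : HasDerivAt (fun t => M (t, p.2))
          (ContinuousLinearMap.snd ℝ ℝ H ∘L fderiv ℝ Y p (1, 0)) p.1 := by
        have := (hasDerivAt_const p.1 (ContinuousLinearMap.snd ℝ ℝ H)).clm_comp h5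
        simpa using this
      convert h6.clm_comp h2 using 1
      ext b
      simp [M, h1]
    filter_upwards [eventually_eq_of_hasDerivAt_zero (g := fun p => M p ∘L B p) h4,
      (continuousAt_snd (p := ((0 : ℝ), (0 : H)))).eventually hB0] with p hp hp'
    rw [hp, hp', ContinuousLinearMap.comp_id]
  have hBinv : (B (0, 0)).IsInvertible := by
    rw [hB0.self_of_nhds]; exact ⟨ContinuousLinearEquiv.refl ℝ V, rfl⟩
  have : CompleteSpace V := FiniteDimensional.complete ℝ V
  have hBinv' : ∀ᶠ z in 𝓝 ((0 : ℝ), (0 : H)), (B z).IsInvertible :=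
    hB.continuousAt.eventually hBinv.eventually
  let α : ℝ × H → V →L[ℝ] ℝ := fun z => ContinuousLinearMap.fst ℝ ℝ H ∘L Y z
  have hα : SmoothNear α (0, 0) := SmoothNear.clm_comp (.const _) hY
  have hfs : ∀ z : ℝ × H, fderiv ℝ Prod.snd z = ContinuousLinearMap.snd ℝ ℝ H := fun z =>
    hasFDerivAt_snd.fderiv
  refine ⟨fun h => M (i h), hM.comp_of_eq (.of_contDiff hi) rfl, ?_, ?_⟩
  -- The restricted fields are `Y · a - α(a) ∂ₜ` on the hypersurface. Modulo `∂ₜ` the bracket of two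
  -- of them is `Y · (c(a, b) - α(a) C b + α(b) C a)`.
  · let q : ℝ × H → V →L[ℝ] V →L[ℝ] V := fun z => (α z).smulRight (C z)
    refine ⟨fun h => c (i h) - q (i h) + (q (i h)).flip, ?_, ?_⟩
    · refine SmoothNear.of_apply fun a => SmoothNear.of_apply fun b => ?_
      have hci : SmoothNear (fun h => c (i h)) 0 := hc.comp_of_eq (.of_contDiff hi) rfl
      have hαi : SmoothNear (fun h => α (i h)) 0 := hα.comp_of_eq (.of_contDiff hi) rfl
      have hCi : SmoothNear (fun h => C (i h)) 0 := hC.comp_of_eq (.of_contDiff hi) rfl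
      refine (((hci.clm_apply (.const a)).clm_apply (.const b)).sub ?_).add ?_
      · exact (hαi.clm_apply (.const a)).smul (hCi.clm_apply (.const b))
      · exact (hαi.clm_apply (.const b)).smul (hCi.clm_apply (.const a))
    · filter_upwards [hic.eventually hc', hic.eventually hDY, hic.eventually hY]
        with h h1 h2 h3 a b
      have hYd : ∀ b, HasFDerivAt (fun z => Y z b) (fderiv ℝ (fun z => Y z b) (i h)) (i h) :=
        fun b => ((h3.clm_apply contDiffAt_const).differentiableAt (by simp)).hasFDerivAt
      have hY1 : ∀ b, fderiv ℝ (fun z => Y z b) (i h) (1, 0) = Y (i h) (C (i h) b) := by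
        intro b
        rw [← h2 b, fderiv_clm_apply (h3.differentiableAt (by simp)) (by fun_prop)]
        simp
      have hid : HasFDerivAt i (ContinuousLinearMap.inr ℝ ℝ H) h :=
        (ContinuousLinearMap.inr ℝ ℝ H).hasFDerivAt
      have hd : ∀ b w, fderiv ℝ (fun h => M (i h) b) h w =
          (fderiv ℝ (fun z => Y z b) (i h) (0, w)).2 := by
        intro b w
        have h5 : HasFDerivAt (fun h => M (i h) b) (ContinuousLinearMap.snd ℝ ℝ H ∘L
          (fderiv ℝ (fun z => Y z b) (i h) ∘L ContinuousLinearMap.inr ℝ ℝ H)) h :=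
          (ContinuousLinearMap.snd ℝ ℝ H).hasFDerivAt.comp h ((hYd b).comp h hid)
        rw [h5.fderiv]
        rfl
      have hsplit : ∀ a, ((0 : ℝ), M (i h) a) = Y (i h) a - α (i h) a • (1, 0) := by
        intro a
        ext <;> simp [M, α]
      rw [VectorField.lieBracket, hd, hd, hsplit, hsplit, map_sub, map_sub, map_smul, map_smul,
        hY1, hY1]
      have h6 := congrArg Prod.snd (h1 a b)
      simp only [VectorField.lieBracket, Prod.snd_sub] at h6
      simp only [Prod.snd_sub, Prod.smul_snd, M, q, add_apply,
        sub_apply, ContinuousLinearMap.flip_apply,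
        ContinuousLinearMap.smulRight_apply, smul_apply,
        ContinuousLinearMap.comp_apply, ContinuousLinearMap.coe_snd', map_add, map_sub, map_smul]
      simp only [← h6]
      abel
  -- Pushing forward uses `B⁻¹`. In the lift, `B g` takes care of the component in `H`, and a
  -- multiple of `c₁`, whose field is `∂ₜ`, corrects the component in `ℝ`.
  · refine ⟨.of_contDiff contDiff_snd, Eventually.of_forall fun z => ?_, ⟨fun z => (B z).inverse,
      hB.inverse hBinv, ?_⟩, ⟨fun z =>
        B z ∘L ContinuousLinearMap.snd ℝ (ℝ × H) V +
          (ContinuousLinearMap.fst ℝ ℝ H ∘L ContinuousLinearMap.fst ℝ (ℝ × H) V -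
            α z ∘L B z ∘L ContinuousLinearMap.snd ℝ (ℝ × H) V).smulRight c₁, ?_, ?_⟩⟩
    · rw [hfs]; exact Prod.snd_surjective
    · filter_upwards [hMB, hBinv'] with z h1 h2 v
      rw [hfs, ← show M (0, z.2) = M (i z.2) from rfl, ← h1, ContinuousLinearMap.comp_apply,
        h2.self_apply_inverse]
      rfl
    · refine SmoothNear.of_apply fun v => ?_
      exact (hB.clm_apply (.const _)).add
        (((SmoothNear.const _).sub (hα.clm_apply (hB.clm_apply (.const _)))).smul (.const _))
    · filter_upwards [hMB, hc₁] with z h1 h2 v g hvg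
      rw [hfs] at hvg
      have h3 : v.2 = (Y z (B z g)).2 := by
        have h4 : M (0, z.2) g = (Y z (B z g)).2 := by rw [← h1]; rfl
        rw [← h4]; exact hvg
      simp only [add_apply, ContinuousLinearMap.smulRight_apply,
        sub_apply, ContinuousLinearMap.comp_apply,
        ContinuousLinearMap.coe_fst', ContinuousLinearMap.coe_snd', map_add, map_smul, h2, α]
      ext
      · simp
      · simp [h3]

lemma ContinuousLinearMap.isInvertible_of_bijective {E F : Type*} [NormedAddCommGroup E]
    [NormedSpace ℝ E] [FiniteDimensional ℝ E] [NormedAddCommGroup F] [NormedSpace ℝ F]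
    {L : E →L[ℝ] F} (h : Function.Bijective L) : L.IsInvertible := by
  have : FiniteDimensional ℝ F := Module.Finite.of_surjective L.toLinearMap h.2
  refine ⟨(LinearEquiv.ofBijective L.toLinearMap h).toContinuousLinearEquiv, ?_⟩
  ext v
  rfl

/-- Flow box theorem. -/
lemma SmoothNear.exists_flowBox {E : Type*} [NormedAddCommGroup E] [NormedSpace ℝ E]
    [FiniteDimensional ℝ E] {X : E → E} {x₀ : E} (hX : SmoothNear X x₀) {H : Submodule ℝ E}
    (hH : IsCompl (Submodule.span ℝ {X x₀}) H) (h0 : X x₀ ≠ 0) :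
    ∃ e : OpenPartialHomeomorph (ℝ × H) E, e.IsSmooth ∧ (0, 0) ∈ e.source ∧ e (0, 0) = x₀ ∧
      ∀ᶠ w in 𝓝 ((0 : ℝ), (0 : H)), _root_.fderiv ℝ e w (1, 0) = X (e w) := by
  obtain ⟨φ, h1, h2, h3⟩ := hX.exists_flow
  -- The box is swept out by the flow of `X` started on the affine hyperplane `x₀ + H`, which is
  -- transverse to `X x₀`.
  let j : ℝ × H → ℝ × E := fun p => (p.1, x₀ + p.2)
  have hj : ContDiff ℝ ∞ j :=
    contDiff_fst.prodMk (contDiff_const.add (H.subtypeL.contDiff.comp contDiff_snd))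
  have hj0 : j (0, 0) = (0, x₀) := by simp [j]
  have hjc : Tendsto j (𝓝 (0, 0)) (𝓝 (0, x₀)) := by
    rw [← hj0]; exact hj.continuous.continuousAt
  let Θ : ℝ × H → E := fun p => φ (j p)
  have hΘ : SmoothNear Θ (0, 0) := h1.comp_of_eq (.of_contDiff hj) hj0
  have hΘ0 : Θ (0, 0) = x₀ := by simp only [Θ, hj0]; exact h2.self_of_nhds
  have hΘt : ∀ᶠ w in 𝓝 ((0 : ℝ), (0 : H)), _root_.fderiv ℝ Θ w (1, 0) = X (Θ w) := by
    filter_upwards [hΘ, hjc.eventually h3] with w hw hw'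
    have h5 : HasDerivAt (fun t => Θ (t, w.2)) (_root_.fderiv ℝ Θ w (1, 0)) w.1 :=
      HasFDerivAt.comp_hasDerivAt (l := Θ) (f := fun t : ℝ => (t, w.2)) w.1
        (hw.differentiableAt (by simp)).hasFDerivAt
        ((hasDerivAt_id w.1).prodMk (hasDerivAt_const w.1 w.2))
    exact h5.unique hw'
  have hΘh : ∀ h : H, _root_.fderiv ℝ Θ (0, 0) (0, h) = h := by
    intro h
    have h5 : HasFDerivAt (fun h : H => Θ (0, h))
        (_root_.fderiv ℝ Θ (0, 0) ∘L ContinuousLinearMap.inr ℝ ℝ H) 0 :=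
      HasFDerivAt.comp (0 : H) (f := fun h : H => ((0 : ℝ), h)) hΘ.differentiableAt.hasFDerivAt
        (ContinuousLinearMap.inr ℝ ℝ H).hasFDerivAt
    have h6 : HasFDerivAt (fun h : H => x₀ + (h : E)) H.subtypeL 0 :=
      H.subtypeL.hasFDerivAt.const_add x₀
    have h7 : (fun h : H => Θ (0, h)) =ᶠ[𝓝 0] fun h : H => x₀ + (h : E) := by
      have : Tendsto (fun h : H => x₀ + (h : E)) (𝓝 0) (𝓝 x₀) := by
        have : Continuous (fun h : H => x₀ + (h : E)) := by fun_prop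
        simpa using this.tendsto 0
      exact this.eventually h2
    exact congrArg (fun L : H →L[ℝ] E => L h) ((h5.congr_of_eventuallyEq h7.symm).unique h6)
  have hform : ∀ p : ℝ × H, _root_.fderiv ℝ Θ (0, 0) p = p.1 • X x₀ + p.2 := by
    intro p
    have h5 : p = p.1 • (1, 0) + (0, p.2) := by ext <;> simp
    conv_lhs => rw [h5]
    rw [map_add, map_smul, hΘt.self_of_nhds, hΘ0, hΘh]
  have hbij : Function.Bijective (_root_.fderiv ℝ Θ (0, 0)) := by
    constructor
    · rw [injective_iff_map_eq_zero]
      intro p hp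
      rw [hform] at hp
      have h5 : (p.2 : E) ∈ Submodule.span ℝ {X x₀} := by
        rw [← neg_eq_of_add_eq_zero_right hp]
        exact Submodule.neg_mem _ (Submodule.smul_mem _ _ (Submodule.mem_span_singleton_self _))
      have h6 : (p.2 : E) = 0 := (Submodule.disjoint_def.1 hH.disjoint) _ h5 p.2.2
      rw [h6, add_zero, smul_eq_zero] at hp
      exact Prod.ext (hp.resolve_right h0) (Subtype.ext h6)
    · intro v
      have h5 : v ∈ Submodule.span ℝ {X x₀} ⊔ H := by rw [hH.sup_eq_top]; trivial
      obtain ⟨y, hy, h, hh, rfl⟩ := Submodule.mem_sup.1 h5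
      obtain ⟨t, rfl⟩ := Submodule.mem_span_singleton.1 hy
      exact ⟨(t, ⟨h, hh⟩), hform _⟩
  have : CompleteSpace (ℝ × H) := FiniteDimensional.complete ℝ _
  obtain ⟨e, h01, h02, h03⟩ := hΘ.exists_openPartialHomeomorph
    (ContinuousLinearMap.isInvertible_of_bijective hbij)
  exact ⟨e, h03, h01, by rw [h02, hΘ0], by rw [h02]; exact hΘt⟩

/-- Splitting theorem: a finitely generated involutive module of vector fields is locally the
pullback, under a submersion onto some `ℝᵏ`, of a module of vector fields vanishing at the
origin. -/
theorem exists_pullsBack_of_involutive {V : Type*} [NormedAddCommGroup V] [NormedSpace ℝ V]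
    [FiniteDimensional ℝ V] {E : Type*} [NormedAddCommGroup E] [NormedSpace ℝ E]
    [FiniteDimensional ℝ E] {Y : E → V →L[ℝ] E} {x : E} (hY : SmoothNear Y x)
    (hinv : Involutive Y x) :
    ∃ (k : ℕ) (f : E → EuclideanSpace ℝ (Fin k))
      (Z : EuclideanSpace ℝ (Fin k) → V →L[ℝ] EuclideanSpace ℝ (Fin k)),
      f x = 0 ∧ Z 0 = 0 ∧ SmoothNear Z 0 ∧ PullsBack Y x f Z := by
  induction hn : Module.finrank ℝ E generalizing E with
  | zero =>
    have hsub : Subsingleton E := Module.finrank_zero_iff.1 hn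
    refine ⟨0, 0, 0, rfl, rfl, .const _, .const _, Eventually.of_forall fun z v =>
      ⟨0, Subsingleton.elim _ _⟩, ⟨0, .const _, ?_⟩, ⟨0, .const _, ?_⟩⟩
    · exact Eventually.of_forall fun z v => Subsingleton.elim _ _
    · exact Eventually.of_forall fun z v g _ => Subsingleton.elim _ _
  | succ n ih =>
    by_cases h0 : ∃ c₁, Y x c₁ ≠ 0
    · obtain ⟨c₁, hc₁⟩ := h0
      have hX : SmoothNear (fun z => Y z c₁) x := hY.clm_apply (.const _)
      obtain ⟨H, hH⟩ := Submodule.exists_isCompl (Submodule.span ℝ {Y x c₁})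
      obtain ⟨e, he, he0, hex, hflow⟩ := hX.exists_flowBox hH hc₁
      have : CompleteSpace E := FiniteDimensional.complete ℝ _
      have : CompleteSpace (ℝ × H) := FiniteDimensional.complete ℝ _
      subst hex
      have h1 : PullsBack Y (e (0, 0)) e.symm _ := PullsBack.of_chart he he0 Y
      have hflow' : ∀ᶠ z in 𝓝 ((0 : ℝ), (0 : H)),
          ((fderiv ℝ e z).inverse ∘L Y (e z)) c₁ = (1, 0) := by
        filter_upwards [hflow, e.open_source.mem_nhds he0] with z hz hz'
        rw [ContinuousLinearMap.comp_apply, ← hz, (he.isInvertible_fderiv hz').inverse_apply_self]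
      obtain ⟨Z, hZ, hZinv, hZp⟩ := exists_pullsBack_snd (SmoothNear.of_chart he he0 hY)
        (hinv.of_chart he he0 hY) c₁ hflow'
      have hfin : Module.finrank ℝ H = n := by
        have h2 := Submodule.finrank_add_eq_of_isCompl hH
        rw [finrank_span_singleton hc₁, hn] at h2
        omega
      obtain ⟨k, f, Z', hf0, hZ0, hZ's, hfp⟩ := ih hZ hZinv hfin
      have h3 := (h1.comp (e.left_inv he0) hZp).comp
        (y := 0) (by rw [e.left_inv he0]) hfp
      exact ⟨k, _, Z', by rw [e.left_inv he0]; exact hf0, hZ0, hZ's, h3⟩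
    · push Not at h0
      let L : E ≃L[ℝ] EuclideanSpace ℝ (Fin (Module.finrank ℝ E)) :=
        ContinuousLinearEquiv.ofFinrankEq (by simp)
      let f : E → EuclideanSpace ℝ (Fin (Module.finrank ℝ E)) := fun z => L (z - x)
      have hf : ContDiff ℝ ∞ f := L.contDiff.comp (contDiff_id.sub contDiff_const)
      have hd : ∀ z, fderiv ℝ f z = L := fun z =>
        (L.toContinuousLinearMap.hasFDerivAt.comp z ((hasFDerivAt_id z).sub_const x)).fderiv
      let i : EuclideanSpace ℝ (Fin (Module.finrank ℝ E)) → E := fun w => L.symm w + x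
      have hi : ContDiff ℝ ∞ i := L.symm.contDiff.add contDiff_const
      have hif : ∀ z, i (f z) = z := fun z => by simp [i, f]
      refine ⟨Module.finrank ℝ E, f, fun w => L.toContinuousLinearMap ∘L Y (i w), by simp [f], ?_,
        ?_, ⟨.of_contDiff hf, Eventually.of_forall fun z => ?_,
          ⟨fun _ => ContinuousLinearMap.id ℝ V, .const _, Eventually.of_forall fun z v => ?_⟩,
          ⟨fun _ => ContinuousLinearMap.snd ℝ E V, .const _,
            Eventually.of_forall fun z v g h => ?_⟩⟩⟩
      · ext1 v
        simp [i, h0]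
      · exact (SmoothNear.const _).clm_comp (hY.comp_of_eq (.of_contDiff hi) (by simp [i]))
      · rw [hd]; exact L.surjective
      · rw [hd, hif]; rfl
      · rw [hd, hif] at h
        exact (L.injective h).symm

end Splitting

/-! ### Comparison of two transverse models with the same pullback -/

section Submersions

variable {E K : Type*} [NormedAddCommGroup E] [NormedSpace ℝ E] [FiniteDimensional ℝ E]
  [NormedAddCommGroup K] [NormedSpace ℝ K]

lemma ContinuousLinearMap.exists_comp_eq_id_of_surjective [FiniteDimensional ℝ K] {A : E →L[ℝ] K}
    (hA : Function.Surjective A) : ∃ R : K →L[ℝ] E, ∀ s, A (R s) = s := by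
  obtain ⟨R, hR⟩ := A.toLinearMap.exists_rightInverse_of_surjective (LinearMap.range_eq_top.2 hA)
  exact ⟨LinearMap.toContinuousLinearMap R, fun s => congrArg (fun L : K →ₗ[ℝ] K => L s) hR⟩

/-- A submersion becomes linear in suitable coordinates. -/
lemma SmoothNear.exists_straightening [FiniteDimensional ℝ K] {f : E → K} {x : E}
    (hf : SmoothNear f x) (hs : Function.Surjective (_root_.fderiv ℝ f x)) :
    ∃ (Ψ : OpenPartialHomeomorph E E) (A : E →L[ℝ] K), Ψ.IsSmooth ∧ x ∈ Ψ.source ∧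
      Function.Surjective A ∧ ∀ z, A (Ψ z) = f z := by
  obtain ⟨R, hR⟩ := ContinuousLinearMap.exists_comp_eq_id_of_surjective hs
  set A := _root_.fderiv ℝ f x
  -- Replacing the component `R (A z)` by `R (f z)` forces `A ∘ ψ = f` and leaves the derivative at
  -- `x` equal to the identity.
  let ψ : E → E := fun z => z - R (A z) + R (f z)
  have hψ : SmoothNear ψ x := (SmoothNear.id.sub (.of_clm (R ∘L A))).add
    (SmoothNear.comp (.of_clm R) hf)
  have hd : _root_.fderiv ℝ ψ x = ContinuousLinearMap.id ℝ E := by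
    have h1 : HasFDerivAt ψ (ContinuousLinearMap.id ℝ E - R ∘L A + R ∘L A) x :=
      ((hasFDerivAt_id x).sub (R ∘L A).hasFDerivAt).add
        (R.hasFDerivAt.comp x hf.differentiableAt.hasFDerivAt)
    rw [h1.fderiv, sub_add_cancel]
  have : CompleteSpace E := FiniteDimensional.complete ℝ E
  obtain ⟨e, h1, h2, h3⟩ := hψ.exists_openPartialHomeomorph
    (by rw [hd]; exact ⟨ContinuousLinearEquiv.refl ℝ E, rfl⟩)
  refine ⟨e, A, h3, h1, hs, fun z => ?_⟩
  rw [h2]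
  simp [ψ, hR]

lemma SmoothNear.exists_section [FiniteDimensional ℝ K] {f : E → K} {x : E}
    (hf : SmoothNear f x) (hs : Function.Surjective (_root_.fderiv ℝ f x)) :
    ∃ σ : K → E, SmoothNear σ (f x) ∧ σ (f x) = x ∧ ∀ᶠ s in 𝓝 (f x), f (σ s) = s := by
  obtain ⟨Ψ, A, hΨ, hx, hA, hAf⟩ := hf.exists_straightening hs
  obtain ⟨R, hR⟩ := ContinuousLinearMap.exists_comp_eq_id_of_surjective hA
  let i : K → E := fun s => Ψ x + R (s - f x)
  have hi : ContDiff ℝ ∞ i := contDiff_const.add (R.contDiff.comp (contDiff_id.sub contDiff_const))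
  have hix : i (f x) = Ψ x := by simp [i]
  have hmem : ∀ᶠ s in 𝓝 (f x), i s ∈ Ψ.target := by
    refine hi.continuous.continuousAt.eventually (Ψ.open_target.mem_nhds ?_)
    rw [hix]; exact Ψ.map_source hx
  refine ⟨fun s => Ψ.symm (i s), (hΨ.symm.smoothNear (Ψ.map_source hx)).comp_of_eq
    (.of_contDiff hi) hix, by simp only [hix, Ψ.left_inv hx], ?_⟩
  filter_upwards [hmem] with s hs
  rw [← hAf, Ψ.right_inv hs]
  simp [i, hR, hAf]

/-- A differentiable curve whose speed is bounded by its norm and that passes through zero is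
zero. -/
lemma eq_zero_of_norm_deriv_le {c c' : ℝ → K} {C r : ℝ} (hc : ∀ t ∈ Set.Ioo (-r) r, HasDerivAt c (c' t) t)
    (hC : ∀ t ∈ Set.Ioo (-r) r, ‖c' t‖ ≤ C * ‖c t‖) (h0 : c 0 = 0) :
    ∀ t ∈ Set.Ioo (-r) r, c t = 0 := by
  have key : ∀ (c c' : ℝ → K), (∀ t ∈ Set.Ioo (-r) r, HasDerivAt c (c' t) t) →
      (∀ t ∈ Set.Ioo (-r) r, ‖c' t‖ ≤ C * ‖c t‖) → c 0 = 0 →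
      ∀ t ∈ Set.Ioo (-r) r, 0 ≤ t → c t = 0 := by
    intro c c' hc hC h0 t ht ht0
    have hsub : ∀ s ∈ Set.Icc 0 t, s ∈ Set.Ioo (-r) r := fun s hs =>
      ⟨by linarith [ht.1, ht.2, hs.1], hs.2.trans_lt ht.2⟩
    refine eq_zero_of_abs_deriv_le_mul_abs_self_of_eq_zero_right (f := c) (f' := c') (K := C)
      (a := 0) (b := t) (fun s hs => (hc s (hsub s hs)).continuousAt.continuousWithinAt)
      (fun s hs => (hc s (hsub s ⟨hs.1, hs.2.le⟩)).hasDerivWithinAt) h0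
      (fun s hs => hC s (hsub s ⟨hs.1, hs.2.le⟩)) t ⟨ht0, le_rfl⟩
  intro t ht
  rcases le_total 0 t with h | h
  · exact key c c' hc hC h0 t ht h
  · have hneg : ∀ s ∈ Set.Ioo (-r) r, -s ∈ Set.Ioo (-r) r := fun s hs =>
      ⟨by linarith [hs.2], by linarith [hs.1]⟩
    have := key (fun s => c (-s)) (fun s => -c' (-s))
      (fun s hs => by
        have := (hc (-s) (hneg s hs)).scomp s (hasDerivAt_neg s)
        rw [neg_one_smul] at this
        exact this)
      (fun s hs => by simpa using hC (-s) (hneg s hs)) (by simpa using h0) (-t) (hneg t ht)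
      (by linarith)
    simpa using this

variable {K' W W' : Type*} [NormedAddCommGroup K'] [NormedSpace ℝ K'] [NormedAddCommGroup W']
  [NormedSpace ℝ W'] [NormedAddCommGroup W] [NormedSpace ℝ W]

/-- Near `x`, every vector field in the pullback of the module `Z` under `f` belongs to the pullback
of `Z'` under `f'`. -/
def PullbackGermLE (x : E) (f : E → K) (Z : K → W →L[ℝ] K) (f' : E → K')
    (Z' : K' → W' →L[ℝ] K') : Prop :=
  ∀ (v : E → E) (g : E → W), SmoothNear v x → SmoothNear g x →
    (∀ᶠ z in 𝓝 x, fderiv ℝ f z (v z) = Z (f z) (g z)) →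
    ∃ b : E → W', SmoothNear b x ∧ ∀ᶠ z in 𝓝 x, fderiv ℝ f' z (v z) = Z' (f' z) (b z)

/-- If each vector `v` of a finite-dimensional space has smooth coefficients, these can be chosen
linear in `v`. -/
lemma exists_linear_coefficients {G : Type*} [NormedAddCommGroup G] [NormedSpace ℝ G]
    [FiniteDimensional ℝ G] {x : E} {L : E → G →L[ℝ] K} {Z : E → W →L[ℝ] K}
    (h : ∀ u : G, ∃ g : E → W, SmoothNear g x ∧ ∀ᶠ z in 𝓝 x, L z u = Z z (g z)) :
    ∃ a : E → G →L[ℝ] W, SmoothNear a x ∧ ∀ᶠ z in 𝓝 x, ∀ u, L z u = Z z (a z u) := by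
  choose g hg hg' using h
  let b := Module.finBasis ℝ G
  refine ⟨fun z => ∑ j, (LinearMap.toContinuousLinearMap (b.coord j)).smulRight (g (b j) z), ?_, ?_⟩
  · refine SmoothNear.of_apply fun u => ?_
    simp only [sum_apply, ContinuousLinearMap.smulRight_apply]
    exact SmoothNear.sum fun j _ => (SmoothNear.const _).smul (hg _)
  · filter_upwards [Filter.eventually_all.2 fun j => hg' (b j)] with z hz u
    conv_lhs => rw [← b.sum_repr u, map_sum]
    simp [sum_apply, map_sum, hz]

variable [FiniteDimensional ℝ K]

/-- Vertical vectors extend to vertical fields, hence their images under `f'` lie in the span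
of `Z'`. -/
lemma PullbackGermLE.exists_vertical {x : E} {f : E → K} {Z : K → W →L[ℝ] K} {f' : E → K'}
    {Z' : K' → W' →L[ℝ] K'} (h : PullbackGermLE x f Z f' Z')
    {Ψ : OpenPartialHomeomorph E E} {A : E →L[ℝ] K}
    (hΨ : Ψ.IsSmooth) (hx : x ∈ Ψ.source) (hAf : ∀ z, A (Ψ z) = f z) :
    ∃ a : E → A.toLinearMap.ker →L[ℝ] W', SmoothNear a x ∧ ∀ᶠ z in 𝓝 x, ∀ u : A.toLinearMap.ker,
      fderiv ℝ f' z ((fderiv ℝ Ψ z).inverse u) = Z' (f' z) (a z u) := by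
  have : CompleteSpace E := FiniteDimensional.complete ℝ E
  have hdf : ∀ z ∈ Ψ.source, fderiv ℝ f z = A ∘L fderiv ℝ Ψ z := fun z hz => by
    have h1 := A.hasFDerivAt.comp z ((hΨ.contDiffAt z hz).differentiableAt (by simp)).hasFDerivAt
    have h2 : A ∘ Ψ = f := funext hAf
    rw [h2] at h1
    exact h1.fderiv
  refine exists_linear_coefficients (x := x)
    (L := fun z => fderiv ℝ f' z ∘L (fderiv ℝ Ψ z).inverse ∘L A.toLinearMap.ker.subtypeL)
    (Z := fun z => Z' (f' z)) fun u => ?_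
  refine h (fun z => (fderiv ℝ Ψ z).inverse u) (fun _ => 0) ?_ (.const _) ?_
  · exact ((hΨ.smoothNear hx).fderiv.inverse (hΨ.isInvertible_fderiv hx)).clm_apply (.const _)
  · filter_upwards [Ψ.open_source.mem_nhds hx] with z hz
    rw [hdf z hz, ContinuousLinearMap.comp_apply, (hΨ.isInvertible_fderiv hz).self_apply_inverse,
      map_zero]
    exact u.2

/-- A smooth family of linear maps vanishing at `0` is bounded by a multiple of the norm. -/
lemma SmoothNear.exists_norm_le {Z : K → W →L[ℝ] K} (hZ : SmoothNear Z 0) (hZ0 : Z 0 = 0) :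
    ∃ C : ℝ, 0 ≤ C ∧ ∀ᶠ s in 𝓝 (0 : K), ‖Z s‖ ≤ C * ‖s‖ := by
  have h1 := hZ.differentiableAt.hasFDerivAt.isBigO_sub
  obtain ⟨C, hC, hCb⟩ := h1.exists_nonneg
  refine ⟨C, hC, ?_⟩
  filter_upwards [hCb.bound] with s hs
  simpa [hZ0] using hs

variable [FiniteDimensional ℝ K']

/-- In straightened coordinates the zero fibre of `f` is an affine subspace, and its points are
joined to `x` by segments. Along a segment `f'` satisfies `c' = Z' c · a` with `a` bounded and `‖Z'
c‖ ≤ C ‖c‖`, since `Z'` vanishes at `0`; as `c` starts at `0`, it stays there. -/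
lemma PullbackGermLE.eventually_eq_zero {x : E} {f : E → K} {Z : K → W →L[ℝ] K} {f' : E → K'}
    {Z' : K' → W' →L[ℝ] K'} (h : PullbackGermLE x f Z f' Z') (hf : SmoothNear f x)
    (hs : Function.Surjective (fderiv ℝ f x)) (hf0 : f x = 0) (hf' : SmoothNear f' x)
    (hf'0 : f' x = 0) (hZ' : SmoothNear Z' 0) (hZ'0 : Z' 0 = 0) :
    ∀ᶠ z in 𝓝 x, f z = 0 → f' z = 0 := by
  have : CompleteSpace E := FiniteDimensional.complete ℝ E
  obtain ⟨Ψ, A, hΨ, hx, hA, hAf⟩ := hf.exists_straightening hs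
  obtain ⟨a, ha, ha'⟩ := h.exists_vertical hΨ hx hAf
  obtain ⟨C, hC0, hC⟩ := hZ'.exists_norm_le hZ'0
  have hf'c : Tendsto f' (𝓝 x) (𝓝 0) := by rw [← hf'0]; exact hf'.continuousAt
  have hac : ContinuousAt (fun z => ‖a z‖) x :=
    ContinuousAt.comp (g := fun L : A.toLinearMap.ker →L[ℝ] W' => ‖L‖)
      (continuous_norm (E := A.toLinearMap.ker →L[ℝ] W')).continuousAt ha.continuousAt
  have hab : ∀ᶠ z in 𝓝 x, ‖a z‖ < ‖a x‖ + 1 := hac.eventually (Iio_mem_nhds (lt_add_one ‖a x‖))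
  have hgood : ∀ᶠ z in 𝓝 x, z ∈ Ψ.source ∧ ContDiffAt ℝ ∞ f' z ∧
      (∀ u : A.toLinearMap.ker, fderiv ℝ f' z ((fderiv ℝ Ψ z).inverse u) = Z' (f' z) (a z u)) ∧
      ‖a z‖ < ‖a x‖ + 1 ∧ ‖Z' (f' z)‖ ≤ C * ‖f' z‖ := by
    filter_upwards [Ψ.open_source.mem_nhds hx, hf', ha', hab, hf'c.eventually hC]
      with z h1 h2 h3 h4 h5 using ⟨h1, h2, h3, h4, h5⟩
  have hsymm : Tendsto Ψ.symm (𝓝 (Ψ x)) (𝓝 x) := by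
    have := Ψ.continuousAt_symm (Ψ.map_source hx)
    rwa [ContinuousAt, Ψ.left_inv hx] at this
  obtain ⟨r, hr, hball⟩ := Metric.eventually_nhds_iff_ball.1
    ((hsymm.eventually hgood).and (Ψ.open_target.mem_nhds (Ψ.map_source hx)))
  have hΨc : Tendsto Ψ (𝓝 x) (𝓝 (Ψ x)) := Ψ.continuousAt hx
  filter_upwards [hΨc.eventually (Metric.ball_mem_nhds (Ψ x) (half_pos hr)),
    Ψ.open_source.mem_nhds hx] with z hz hzs hfz
  let u : E := Ψ z - Ψ x
  have hu : u ∈ A.toLinearMap.ker := by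
    change A (Ψ z - Ψ x) = 0
    rw [map_sub, hAf, hAf, hfz, hf0, sub_zero]
  have hun : ‖u‖ < r / 2 := mem_ball_iff_norm.1 hz
  let q : ℝ → E := fun t => Ψ x + t • u
  -- The bound `r / 2` on `u` leaves room for an open time interval around `[0, 1]`.
  have hq : ∀ t ∈ Set.Ioo (-2 : ℝ) 2, q t ∈ Metric.ball (Ψ x) r := by
    intro t ht
    simp only [q, mem_ball_iff_norm, add_sub_cancel_left, norm_smul]
    have h1 : ‖t‖ ≤ 2 := abs_le.2 ⟨ht.1.le, ht.2.le⟩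
    nlinarith [norm_nonneg u, norm_nonneg t]
  have hqd : ∀ t, HasDerivAt q u t := fun t => by
    have := ((hasDerivAt_id t).smul_const u).const_add (Ψ x)
    rw [one_smul] at this
    exact this
  have hzero := eq_zero_of_norm_deriv_le (c := fun t => f' (Ψ.symm (q t)))
    (c' := fun t => Z' (f' (Ψ.symm (q t))) (a (Ψ.symm (q t)) ⟨u, hu⟩))
    (r := 2) (C := C * ((‖a x‖ + 1) * ‖(⟨u, hu⟩ : A.toLinearMap.ker)‖)) ?_ ?_ ?_ 1 (by norm_num)
  · have h1 : q 1 = Ψ z := by simp [q, u]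
    simpa [h1, Ψ.left_inv hzs] using hzero
  · intro t ht
    obtain ⟨⟨h1, h2, h3, -, -⟩, h6⟩ := hball _ (hq t ht)
    have h7 := ((hΨ.contDiffAt_symm _ h6).differentiableAt (by simp)).hasFDerivAt.comp_hasDerivAt t
      (hqd t)
    have h8 := (h2.differentiableAt (by simp)).hasFDerivAt.comp_hasDerivAt t h7
    have h9 := hΨ.fderiv_symm_eq h1
    rw [Ψ.right_inv h6] at h9
    rw [h9] at h8
    rw [← h3]
    exact h8
  · intro t ht
    obtain ⟨⟨-, -, -, h4, h5⟩, -⟩ := hball _ (hq t ht)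
    calc ‖Z' (f' (Ψ.symm (q t))) (a (Ψ.symm (q t)) ⟨u, hu⟩)‖
        ≤ ‖Z' (f' (Ψ.symm (q t)))‖ * (‖a (Ψ.symm (q t))‖ * ‖(⟨u, hu⟩ : A.toLinearMap.ker)‖) :=
          (ContinuousLinearMap.le_opNorm _ _).trans
            (mul_le_mul_of_nonneg_left (ContinuousLinearMap.le_opNorm _ _) (norm_nonneg _))
      _ ≤ (C * ‖f' (Ψ.symm (q t))‖) * ((‖a x‖ + 1) * ‖(⟨u, hu⟩ : A.toLinearMap.ker)‖) := by
          gcongr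
      _ = _ := by ring
  · simp [q, Ψ.left_inv hx, hf'0]

/-- The section `σ` transports `Z · c` to its own image. Extended to a field near `x` that `f`
projects to `Z · c`, it is sent by `f'` into the span of `Z'`; restricting the coefficients to the
image of `σ` gives `a`. -/
lemma PullbackGermLE.exists_push_section [FiniteDimensional ℝ W]
    {x : E} {f : E → K} {Z : K → W →L[ℝ] K} {f' : E → K'}
    {Z' : K' → W' →L[ℝ] K'} (h : PullbackGermLE x f Z f' Z') (hf : SmoothNear f x)
    (hf0 : f x = 0) (hf' : SmoothNear f' x)
    (hZ : SmoothNear Z 0) {σ : K → E} (hσ : SmoothNear σ 0) (hσ0 : σ 0 = x)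
    (hfσ : ∀ᶠ s in 𝓝 (0 : K), f (σ s) = s) :
    ∃ a : K → W →L[ℝ] W', SmoothNear a 0 ∧ ∀ᶠ s in 𝓝 (0 : K), ∀ c,
      fderiv ℝ (fun s => f' (σ s)) s (Z s c) = Z' (f' (σ s)) (a s c) := by
  have hfc : Tendsto f (𝓝 x) (𝓝 0) := by rw [← hf0]; exact hf.continuousAt
  have hσc : Tendsto σ (𝓝 0) (𝓝 x) := by rw [← hσ0]; exact hσ.continuousAt
  have hdfσ : ∀ᶠ s in 𝓝 (0 : K), ∀ w, fderiv ℝ f (σ s) (fderiv ℝ σ s w) = w := by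
    filter_upwards [eventually_eventually_nhds.2 hfσ, hσc.eventually hf, hσ] with s h1 h2 h3 w
    have h4 := (h2.differentiableAt (by simp)).hasFDerivAt.comp s
      (h3.differentiableAt (by simp)).hasFDerivAt
    have h5 : HasFDerivAt (f ∘ σ) (ContinuousLinearMap.id ℝ K) s :=
      (hasFDerivAt_id s).congr_of_eventuallyEq h1
    exact congrArg (fun L : K →L[ℝ] K => L w) (h4.unique h5)
  have hsurj : Function.Surjective (fderiv ℝ f x) := fun w =>
    ⟨fderiv ℝ σ 0 w, by have := hdfσ.self_of_nhds w; rwa [hσ0] at this⟩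
  obtain ⟨Ψ, A, hΨ, hx, hA, hAf⟩ := hf.exists_straightening hsurj
  have : CompleteSpace E := FiniteDimensional.complete ℝ E
  have hdf : ∀ z ∈ Ψ.source, fderiv ℝ f z = A ∘L fderiv ℝ Ψ z := fun z hz => by
    have h1 := A.hasFDerivAt.comp z ((hΨ.contDiffAt z hz).differentiableAt (by simp)).hasFDerivAt
    have h2 : A ∘ Ψ = f := funext hAf
    rw [h2] at h1
    exact h1.fderiv
  have hsrc : ∀ᶠ z in 𝓝 x, z ∈ Ψ.source := Ψ.open_source.mem_nhds hx
  -- The vector `dσ (Z · c)` at `σ (f z)` is moved to `z` with constant components in the chart `Ψ`,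
  -- where `f` is linear. The projection to `Z · c` is thereby kept, and on the image of `σ` nothing
  -- changes.
  let v : W → E → E := fun c z => (fderiv ℝ Ψ z).inverse
    (fderiv ℝ Ψ (σ (f z)) (fderiv ℝ σ (f z) (Z (f z) c)))
  have hσf : SmoothNear (fun z => σ (f z)) x := hσ.comp_of_eq hf hf0
  have hv : ∀ c, ∃ g' : E → W', SmoothNear g' x ∧
      ∀ᶠ z in 𝓝 x, fderiv ℝ f' z (v c z) = Z' (f' z) (g' z) := by
    intro c
    refine h (v c) (fun _ => c) ?_ (.const _) ?_
    · refine ((hΨ.smoothNear hx).fderiv.inverse (hΨ.isInvertible_fderiv hx)).clm_apply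
        (SmoothNear.clm_apply ?_ (SmoothNear.clm_apply ?_ ?_))
      · exact (hΨ.smoothNear hx).fderiv.comp_of_eq hσf (by rw [hf0, hσ0])
      · exact hσ.fderiv.comp_of_eq hf hf0
      · exact (hZ.comp_of_eq hf hf0).clm_apply (.const _)
    · filter_upwards [hsrc, (hσc.comp hfc).eventually hsrc, hfc.eventually hdfσ] with z h1 h2 h3
      rw [hdf z h1, ContinuousLinearMap.comp_apply, (hΨ.isInvertible_fderiv h1).self_apply_inverse,
        ← ContinuousLinearMap.comp_apply, ← hdf (σ (f z)) h2]
      exact h3 _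
  refine exists_linear_coefficients (E := K) (x := (0 : K))
    (L := fun s => fderiv ℝ (fun s => f' (σ s)) s ∘L Z s) (Z := fun s => Z' (f' (σ s)))
    fun c => ?_
  obtain ⟨g', hg', hg''⟩ := hv c
  refine ⟨fun s => g' (σ s), hg'.comp_of_eq hσ hσ0, ?_⟩
  filter_upwards [hσc.eventually hg'', hfσ, hσc.eventually hsrc, hσ, hσc.eventually hf']
    with s h1 h2 h3 h4 h5
  rw [← h1]
  have h6 : v c (σ s) = fderiv ℝ σ s (Z s c) := by
    simp only [v, h2]
    exact (hΨ.isInvertible_fderiv h3).inverse_apply_self _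
  have h7 : HasFDerivAt (fun s => f' (σ s)) (fderiv ℝ f' (σ s) ∘L fderiv ℝ σ s) s :=
    (h5.differentiableAt (by simp)).hasFDerivAt.comp s (h4.differentiableAt (by simp)).hasFDerivAt
  rw [h6, ContinuousLinearMap.comp_apply, h7.fderiv]
  rfl

/-- Vertical vectors at `x` are annihilated by `f'`. -/
lemma PullbackGermLE.fderiv_eq_zero {x : E} {f : E → K} {Z : K → W →L[ℝ] K} {f' : E → K'}
    {Z' : K' → W' →L[ℝ] K'} (h : PullbackGermLE x f Z f' Z') (hf : SmoothNear f x)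
    (hs : Function.Surjective (fderiv ℝ f x)) (hf'0 : f' x = 0) (hZ'0 : Z' 0 = 0)
    {u : E} (hu : fderiv ℝ f x u = 0) : fderiv ℝ f' x u = 0 := by
  obtain ⟨Ψ, A, hΨ, hx, hA, hAf⟩ := hf.exists_straightening hs
  obtain ⟨a, ha, ha'⟩ := h.exists_vertical hΨ hx hAf
  have h1 := A.hasFDerivAt.comp x ((hΨ.contDiffAt x hx).differentiableAt (by simp)).hasFDerivAt
  have h2 : A ∘ Ψ = f := funext hAf
  rw [h2] at h1
  have h3 : fderiv ℝ Ψ x u ∈ A.toLinearMap.ker := by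
    rw [h1.fderiv] at hu; exact hu
  have h4 := ha'.self_of_nhds ⟨_, h3⟩
  rw [hf'0, hZ'0] at h4
  simpa [(hΨ.isInvertible_fderiv hx).inverse_apply_self] using h4

/-- Transverse models are unique up to diffeomorphism. -/
theorem PullbackGermLE.exists_pullsBack [FiniteDimensional ℝ W] [FiniteDimensional ℝ W']
    {x : E} {f : E → K} {Z : K → W →L[ℝ] K} {f' : E → K'} {Z' : K' → W' →L[ℝ] K'}
    (h : PullbackGermLE x f Z f' Z') (h' : PullbackGermLE x f' Z' f Z)
    (hf : SmoothNear f x) (hs : Function.Surjective (fderiv ℝ f x)) (hf0 : f x = 0)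
    (hf' : SmoothNear f' x) (hs' : Function.Surjective (fderiv ℝ f' x)) (hf'0 : f' x = 0)
    (hZ : SmoothNear Z 0) (hZ0 : Z 0 = 0) (hZ' : SmoothNear Z' 0) (hZ'0 : Z' 0 = 0) :
    ∃ θ : K → K', θ 0 = 0 ∧ PullsBack Z 0 θ Z' := by
  obtain ⟨σ, hσ, hσ0, hfσ⟩ := hf.exists_section hs
  rw [hf0] at hσ hσ0 hfσ
  let θ : K → K' := fun s => f' (σ s)
  have hθ : SmoothNear θ 0 := hf'.comp_of_eq hσ hσ0
  have hθ0 : θ 0 = 0 := by simp only [θ, hσ0, hf'0]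
  have hfσd : ∀ w, fderiv ℝ f x (fderiv ℝ σ 0 w) = w := by
    intro w
    have h4 := HasFDerivAt.comp (0 : K) (f := σ) (g := f) (by rw [hσ0]; exact hf.differentiableAt.hasFDerivAt)
      hσ.differentiableAt.hasFDerivAt
    exact congrArg (fun L : K →L[ℝ] K => L w)
      (h4.unique ((hasFDerivAt_id (0 : K)).congr_of_eventuallyEq hfσ))
  have hθd : fderiv ℝ θ 0 = fderiv ℝ f' x ∘L fderiv ℝ σ 0 :=
    (HasFDerivAt.comp (0 : K) (f := σ) (g := f')
      (by rw [hσ0]; exact hf'.differentiableAt.hasFDerivAt)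
      hσ.differentiableAt.hasFDerivAt).fderiv
  -- `d f` and `d f'` have the same kernel at `x` and are onto, so both identify the same quotient
  -- of `E` with `K` and with `K'`; `dθ` is the comparison.
  have hbij : Function.Bijective (fderiv ℝ θ 0) := by
    rw [hθd]
    constructor
    · rw [injective_iff_map_eq_zero]
      intro w hw
      have := h'.fderiv_eq_zero hf' hs' hf0 hZ0 hw
      exact (hfσd w).symm.trans this
    · intro w
      obtain ⟨u, rfl⟩ := hs' w
      refine ⟨fderiv ℝ f x u, ?_⟩
      have h1 : fderiv ℝ f x (fderiv ℝ σ 0 (fderiv ℝ f x u) - u) = 0 := by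
        rw [map_sub, hfσd, sub_self]
      have h2 := h.fderiv_eq_zero hf hs hf'0 hZ'0 h1
      rwa [map_sub, sub_eq_zero] at h2
  have : CompleteSpace K := FiniteDimensional.complete ℝ K
  obtain ⟨e, he0, heθ, he⟩ := hθ.exists_openPartialHomeomorph
    (ContinuousLinearMap.isInvertible_of_bijective hbij)
  have he00 : e 0 = 0 := by rw [heθ, hθ0]
  have he0' : (0 : K') ∈ e.target := by rw [← he00]; exact e.map_source he0
  have hes0 : e.symm 0 = 0 := by rw [← he00, e.left_inv he0]
  have hes : SmoothNear e.symm 0 := he.symm.smoothNear he0'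
  have hesc : Tendsto e.symm (𝓝 0) (𝓝 0) := by
    have := hes.continuousAt
    rwa [ContinuousAt, hes0] at this
  obtain ⟨a, ha, ha'⟩ := h.exists_push_section hf hf0 hf' hZ hσ hσ0 hfσ
  -- `σ ∘ θ⁻¹` is a section of `f'`, so the roles can be exchanged: `θ⁻¹` carries `Z'` into the span
  -- of `Z`, which yields the lift.
  obtain ⟨b, hb, hb'⟩ := h'.exists_push_section hf' hf'0 hf hZ' (σ := fun t => σ (e.symm t))
    (hσ.comp_of_eq hes hes0) (by rw [hes0, hσ0]) (by
      filter_upwards [e.open_target.mem_nhds he0'] with t ht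
      have := e.right_inv ht
      rwa [heθ] at this)
  have hfe : ∀ᶠ t in 𝓝 (0 : K'), ∀ᶠ t' in 𝓝 t, f (σ (e.symm t')) = e.symm t' :=
    eventually_eventually_nhds.2 (hesc.eventually hfσ)
  have hθc : Tendsto θ (𝓝 0) (𝓝 0) := by
    have := hθ.continuousAt
    rwa [ContinuousAt, hθ0] at this
  refine ⟨θ, hθ0, hθ, ?_, ⟨a, ha, ha'⟩, ⟨fun s => b (θ s) ∘L ContinuousLinearMap.snd ℝ K W',
    (hb.comp_of_eq hθ hθ0).clm_comp (.const _), ?_⟩⟩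
  · filter_upwards [e.open_source.mem_nhds he0] with s hs
    rw [← heθ]
    exact (he.isInvertible_fderiv hs).surjective
  · filter_upwards [e.open_source.mem_nhds he0, hθc.eventually hb', hθc.eventually hfe]
      with s h1 h2 h3 v g hvg
    have h4 := h2 g
    rw [Filter.EventuallyEq.fderiv_eq h3, h3.self_of_nhds] at h4
    have h5 : e.symm (θ s) = s := by rw [← heθ, e.left_inv h1]
    have h6 : fderiv ℝ e.symm (θ s) (fderiv ℝ θ s v) = v := by
      have := congrArg (fun L : K →L[ℝ] K => L v) (he.fderiv_symm_comp_fderiv h1)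
      rw [heθ] at this
      exact this
    rw [h5, ← hvg, h6] at h4
    exact h4.symm

end Submersions

noncomputable section

/-! ### Germs of smooth maps between manifolds -/

section SmoothGerms

variable {E : Type*} [NormedAddCommGroup E] [NormedSpace ℝ E]
  {M : Type*} [TopologicalSpace M] [ChartedSpace E M]
  {E' : Type*} [NormedAddCommGroup E'] [NormedSpace ℝ E']
  {M' : Type*} [TopologicalSpace M'] [ChartedSpace E' M']
  {E'' : Type*} [NormedAddCommGroup E''] [NormedSpace ℝ E'']
  {M'' : Type*} [TopologicalSpace M''] [ChartedSpace E'' M'']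

variable (E E') in
/-- The map `f` between manifolds is smooth in a neighbourhood of `x`. -/
def MSmoothNear (f : M → M') (x : M) : Prop :=
  ∀ᶠ z in 𝓝 x, ContMDiffAt 𝓘(ℝ, E) 𝓘(ℝ, E') ∞ f z

namespace MSmoothNear

lemma contMDiffAt {f : M → M'} {x : M} (h : MSmoothNear E E' f x) :
    ContMDiffAt 𝓘(ℝ, E) 𝓘(ℝ, E') ∞ f x := h.self_of_nhds

lemma mdifferentiableAt {f : M → M'} {x : M} (h : MSmoothNear E E' f x) :
    MDifferentiableAt 𝓘(ℝ, E) 𝓘(ℝ, E') f x := h.contMDiffAt.mdifferentiableAt (by simp)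

lemma continuousAt {f : M → M'} {x : M} (h : MSmoothNear E E' f x) : ContinuousAt f x :=
  h.contMDiffAt.continuousAt

lemma eventually {f : M → M'} {x : M} (h : MSmoothNear E E' f x) :
    ∀ᶠ z in 𝓝 x, MSmoothNear E E' f z := eventually_eventually_nhds.2 h

lemma of_contMDiff {f : M → M'} {x : M} (h : ContMDiff 𝓘(ℝ, E) 𝓘(ℝ, E') ∞ f) :
    MSmoothNear E E' f x := Eventually.of_forall fun z => h z

lemma const {c : M'} {x : M} : MSmoothNear E E' (fun _ : M => c) x := of_contMDiff contMDiff_const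

lemma comp {g : M' → M''} {f : M → M'} {x : M} (hg : MSmoothNear E' E'' g (f x))
    (hf : MSmoothNear E E' f x) : MSmoothNear E E'' (fun z => g (f z)) x := by
  filter_upwards [hf.continuousAt.eventually hg, hf] with z h1 h2
  exact h1.comp z h2

lemma congr {f g : M → M'} {x : M} (hf : MSmoothNear E E' f x) (h : f =ᶠ[𝓝 x] g) :
    MSmoothNear E E' g x := by
  filter_upwards [hf, h.eventuallyEq_nhds] with z h1 h2
  exact h1.congr_of_eventuallyEq h2.symm

end MSmoothNear

lemma SmoothNear.mSmoothNear {f : E → E'} {x : E} (hf : SmoothNear f x) : MSmoothNear E E' f x :=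
  hf.mono fun _ h => h.contMDiffAt

lemma MSmoothNear.smoothNear {f : E → E'} {x : E} (hf : MSmoothNear E E' f x) : SmoothNear f x :=
  hf.mono fun _ h => contMDiffAt_iff_contDiffAt.1 h

lemma SmoothNear.mcomp {g : E' → E''} {f : M → E'} {x : M} (hg : SmoothNear g (f x))
    (hf : MSmoothNear E E' f x) : MSmoothNear E E'' (fun z => g (f z)) x :=
  MSmoothNear.comp hg.mSmoothNear hf

lemma MSmoothNear.prodMk {f : M → E'} {g : M → E''} {x : M} (hf : MSmoothNear E E' f x)
    (hg : MSmoothNear E E'' g x) : MSmoothNear E (E' × E'') (fun z => (f z, g z)) x := by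
  filter_upwards [hf, hg] with z h1 h2
  exact h1.prodMk_space h2

variable [IsManifold 𝓘(ℝ, E) ∞ M]

lemma mSmoothNear_extChartAt {c x : M} (hx : x ∈ (chartAt E c).source) :
    MSmoothNear E E (extChartAt 𝓘(ℝ, E) c) x := by
  filter_upwards [(chartAt E c).open_source.mem_nhds hx] with z hz
  exact contMDiffAt_extChartAt' hz

lemma mSmoothNear_extChartAt_symm {c x : M} (hx : x ∈ (chartAt E c).source) :
    MSmoothNear E E (extChartAt 𝓘(ℝ, E) c).symm (extChartAt 𝓘(ℝ, E) c x) := by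
  have ht : (extChartAt 𝓘(ℝ, E) c).target ∈ 𝓝 (extChartAt 𝓘(ℝ, E) c x) :=
    (isOpen_extChartAt_target c).mem_nhds ((extChartAt 𝓘(ℝ, E) c).map_source (by simpa using hx))
  filter_upwards [eventually_eventually_nhds.2 ht] with z hz
  exact (contMDiffOn_extChartAt_symm c).contMDiffAt hz

lemma extChartAt_symm_apply_self {c x : M} (hx : x ∈ (chartAt E c).source) :
    (extChartAt 𝓘(ℝ, E) c).symm (extChartAt 𝓘(ℝ, E) c x) = x :=
  (extChartAt 𝓘(ℝ, E) c).left_inv (by simpa using hx)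

lemma eventually_mem_source {c x : M} (hx : x ∈ (chartAt E c).source) :
    ∀ᶠ z in 𝓝 x, z ∈ (chartAt E c).source := (chartAt E c).open_source.mem_nhds hx

lemma eventually_mem_target {c x : M} (hx : x ∈ (chartAt E c).source) :
    ∀ᶠ w in 𝓝 (extChartAt 𝓘(ℝ, E) c x), w ∈ (extChartAt 𝓘(ℝ, E) c).target :=
  (isOpen_extChartAt_target c).mem_nhds ((extChartAt 𝓘(ℝ, E) c).map_source (by simpa using hx))

/-- A property holds near `x` iff it holds near `φ x` when read in the chart `φ`. -/
lemma eventually_extChartAt {c x : M} (hx : x ∈ (chartAt E c).source) {p : M → Prop} :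
    (∀ᶠ w in 𝓝 (extChartAt 𝓘(ℝ, E) c x), p ((extChartAt 𝓘(ℝ, E) c).symm w)) ↔ ∀ᶠ z in 𝓝 x, p z := by
  constructor
  · intro h
    filter_upwards [(mSmoothNear_extChartAt hx).continuousAt.eventually h,
      eventually_mem_source hx] with z h1 h2
    rwa [extChartAt_symm_apply_self h2] at h1
  · intro h
    have hc := (mSmoothNear_extChartAt_symm hx).continuousAt
    rw [ContinuousAt, extChartAt_symm_apply_self hx] at hc
    exact hc.eventually h

lemma MSmoothNear.comp_extChartAt_symm {f : M → M'} {c x : M} (hx : x ∈ (chartAt E c).source)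
    (hf : MSmoothNear E E' f x) :
    MSmoothNear E E' (fun w => f ((extChartAt 𝓘(ℝ, E) c).symm w)) (extChartAt 𝓘(ℝ, E) c x) := by
  refine MSmoothNear.comp ?_ (mSmoothNear_extChartAt_symm hx)
  rwa [extChartAt_symm_apply_self hx]

lemma MSmoothNear.of_comp_extChartAt_symm {f : M → M'} {c x : M} (hx : x ∈ (chartAt E c).source)
    (hf : MSmoothNear E E' (fun w => f ((extChartAt 𝓘(ℝ, E) c).symm w)) (extChartAt 𝓘(ℝ, E) c x)) :
    MSmoothNear E E' f x := by
  refine (MSmoothNear.comp hf (mSmoothNear_extChartAt hx)).congr ?_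
  filter_upwards [eventually_mem_source hx] with z hz
  rw [extChartAt_symm_apply_self hz]

end SmoothGerms

/-! ### Coordinate expressions of vector fields -/

section Coordinates

variable {E : Type*} [NormedAddCommGroup E] [NormedSpace ℝ E]
  {M : Type*} [TopologicalSpace M] [ChartedSpace E M] [IsManifold 𝓘(ℝ, E) ∞ M]
  {E' : Type*} [NormedAddCommGroup E'] [NormedSpace ℝ E']
  {M' : Type*} [TopologicalSpace M'] [ChartedSpace E' M'] [IsManifold 𝓘(ℝ, E') ∞ M']

lemma isInvertible_mfderiv_extChartAt_symm_of_mem {c : M} {w : E}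
    (hw : w ∈ (extChartAt 𝓘(ℝ, E) c).target) :
    (mfderiv 𝓘(ℝ, E) 𝓘(ℝ, E) (extChartAt 𝓘(ℝ, E) c).symm w).IsInvertible := by
  have : IsManifold 𝓘(ℝ, E) 1 M := IsManifold.of_le (n := ∞) (by simp)
  have h := isInvertible_mfderivWithin_extChartAt_symm (I := 𝓘(ℝ, E)) hw
  rw [ModelWithCorners.range_eq_univ, mfderivWithin_univ] at h
  exact h

/-- The coordinate expression of a vector field in the chart based at `c`. -/
def SmoothVF.coord (c : M) (X : SmoothVF E M) : E → E :=
  VectorField.mpullback 𝓘(ℝ, E) 𝓘(ℝ, E) (extChartAt 𝓘(ℝ, E) c).symm X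

lemma SmoothVF.mfderiv_coord {c : M} (X : SmoothVF E M) {w : E}
    (hw : w ∈ (extChartAt 𝓘(ℝ, E) c).target) :
    mfderiv 𝓘(ℝ, E) 𝓘(ℝ, E) (extChartAt 𝓘(ℝ, E) c).symm w (SmoothVF.coord (E := E) c X w)
      = X ((extChartAt 𝓘(ℝ, E) c).symm w) := by
  obtain ⟨e, he⟩ := isInvertible_mfderiv_extChartAt_symm_of_mem hw
  simp only [SmoothVF.coord, VectorField.mpullback_apply]
  rw [← he, ContinuousLinearMap.inverse_equiv]
  exact e.apply_symm_apply _

/-- The bridge from derivatives on the manifold to computations in a chart; it is the chain rule,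
because the inverse chart maps the coordinate expression back to `X`. -/
lemma mfderiv_eq_fderiv_coord {c x : M} (hx : x ∈ (chartAt E c).source) {f : M → E'}
    (hf : MDifferentiableAt 𝓘(ℝ, E) 𝓘(ℝ, E') f x) (X : SmoothVF E M) :
    mfderiv 𝓘(ℝ, E) 𝓘(ℝ, E') f x (X x) =
      fderiv ℝ (fun w => f ((extChartAt 𝓘(ℝ, E) c).symm w)) (extChartAt 𝓘(ℝ, E) c x)
        (X.coord c (extChartAt 𝓘(ℝ, E) c x)) := by
  have hw := (eventually_mem_target hx).self_of_nhds
  have hφ := (mSmoothNear_extChartAt_symm hx).mdifferentiableAt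
  have hs := extChartAt_symm_apply_self hx
  have hf' : MDifferentiableAt 𝓘(ℝ, E) 𝓘(ℝ, E') f
      ((extChartAt 𝓘(ℝ, E) c).symm (extChartAt 𝓘(ℝ, E) c x)) := by rwa [hs]
  have h1 := mfderiv_comp (I'' := 𝓘(ℝ, E')) (extChartAt 𝓘(ℝ, E) c x) hf' hφ
  rw [mfderiv_eq_fderiv] at h1
  have h2 := X.mfderiv_coord hw
  change _ = fderiv ℝ (f ∘ (extChartAt 𝓘(ℝ, E) c).symm) (extChartAt 𝓘(ℝ, E) c x) _
  rw [h1]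
  change _ = mfderiv 𝓘(ℝ, E) 𝓘(ℝ, E') f _ (mfderiv 𝓘(ℝ, E) 𝓘(ℝ, E) _ _ _)
  rw [h2, hs]

variable [FiniteDimensional ℝ E]

lemma SmoothVF.smoothNear_coord {c x : M} (hx : x ∈ (chartAt E c).source) (X : SmoothVF E M) :
    SmoothNear (X.coord c) (extChartAt 𝓘(ℝ, E) c x) := by
  have : CompleteSpace E := FiniteDimensional.complete ℝ E
  filter_upwards [mSmoothNear_extChartAt_symm hx, eventually_mem_target hx] with w h1 h2
  have := ContMDiffAt.mpullback_vectorField_preimage (n := ∞) (m := ∞) (V := X)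
    (X.contMDiff _) h1 (isInvertible_mfderiv_extChartAt_symm_of_mem h2) (by simp)
  have h3 := (Bundle.contMDiffAt_totalSpace.1 this).2
  rw [← contMDiffAt_iff_contDiffAt]
  simpa [SmoothVF.coord] using h3

lemma SmoothVF.lieBracket_coord {c x : M} (hx : x ∈ (chartAt E c).source) (X Y : SmoothVF E M) :
    VectorField.lieBracket ℝ (X.coord c) (Y.coord c) (extChartAt 𝓘(ℝ, E) c x) =
      (⁅X, Y⁆ : SmoothVF E M).coord c (extChartAt 𝓘(ℝ, E) c x) := by
  have : CompleteSpace E := FiniteDimensional.complete ℝ E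
  have : IsManifold 𝓘(ℝ, E) (minSmoothness ℝ 3) M :=
      IsManifold.of_le (n := ∞) (by simpa using SmoothVF.three_le_infty)
  have h := VectorField.mpullback_mlieBracket (I := 𝓘(ℝ, E)) (I' := 𝓘(ℝ, E)) (n := ∞) (V := X)
    (W := Y) (X.mdifferentiableAt _) (Y.mdifferentiableAt _)
    (mSmoothNear_extChartAt_symm hx).contMDiffAt (by simpa using SmoothVF.two_le_infty)
  rw [← VectorField.mlieBracketWithin_univ (I := 𝓘(ℝ, E)) (M := E),
    VectorField.mlieBracketWithin_eq_lieBracketWithin] at h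
  rw [← VectorField.lieBracketWithin_univ]
  exact h.symm

end Coordinates

end

noncomputable section

/-! ### Bump functions and extension of germs -/

section Cutoff

lemma ContinuousLinearMap.inverse_inverse_apply_of_comp_eq_id {G : Type*} [NormedAddCommGroup G]
    [NormedSpace ℝ G] {A B : G →L[ℝ] G} (hA : A.IsInvertible) (hB : B.IsInvertible)
    (h : B ∘L A = ContinuousLinearMap.id ℝ G) (u : G) : A.inverse (B.inverse u) = u := by
  obtain ⟨e, rfl⟩ := hA
  obtain ⟨e', rfl⟩ := hB
  rw [ContinuousLinearMap.inverse_equiv, ContinuousLinearMap.inverse_equiv]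
  have h1 : e' (e u) = u := congrArg (fun L : G →L[ℝ] G => L u) h
  change e.symm (e'.symm u) = u
  rw [ContinuousLinearEquiv.symm_apply_eq, ContinuousLinearEquiv.symm_apply_eq, h1]

variable {E : Type*} [NormedAddCommGroup E] [NormedSpace ℝ E] [FiniteDimensional ℝ E]
  {M : Type*} [TopologicalSpace M] [ChartedSpace E M] [IsManifold 𝓘(ℝ, E) ∞ M]
  {E' : Type*} [NormedAddCommGroup E'] [NormedSpace ℝ E']

lemma MSmoothNear.mfderiv_apply {f : M → E'} {x : M} (hf : MSmoothNear E E' f x)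
    (X : SmoothVF E M) :
    MSmoothNear E E' (fun z => (mfderiv 𝓘(ℝ, E) 𝓘(ℝ, E') f z (X z) : E')) x := by
  have hx := mem_chart_source E x
  have h1 := (hf.comp_extChartAt_symm hx).smoothNear
  have h2 := h1.fderiv.clm_apply (X.smoothNear_coord hx)
  refine (h2.mcomp (mSmoothNear_extChartAt hx)).congr ?_
  filter_upwards [eventually_mem_source hx, hf.eventually] with z hz h3
  exact (mfderiv_eq_fderiv_coord hz h3.mdifferentiableAt X).symm

lemma SmoothVF.supp_subset_of_eq_smul {X : SmoothVF E M} {χ : M → ℝ}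
    {Y : (z : M) → TangentSpace 𝓘(ℝ, E) z} (h : ∀ z, X z = χ z • Y z) : X.supp ⊆ tsupport χ := by
  refine closure_mono fun z hz => ?_
  intro h0
  exact hz (by rw [h, h0, zero_smul])

lemma exists_smoothVF_eq_smul {χ : SmoothFun E M} {U : Set M} (hU : IsOpen U)
    (hχ : tsupport χ ⊆ U) {Y : (z : M) → TangentSpace 𝓘(ℝ, E) z}
    (hY : ContMDiffOn 𝓘(ℝ, E) 𝓘(ℝ, E).tangent ∞ (fun z => (Y z : TangentBundle 𝓘(ℝ, E) M)) U) :
    ∃ X : SmoothVF E M, ∀ z, X z = χ z • Y z :=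
  ⟨⟨fun z => χ z • Y z,
    ContMDiffOn.smul_section_of_tsupport χ.contMDiff.contMDiffOn hU hχ hY⟩, fun _ => rfl⟩

variable [T2Space M]

lemma exists_bump {x : M} {U : Set M} (hU : U ∈ 𝓝 x) :
    ∃ χ : SmoothFun E M, HasCompactSupport χ ∧ tsupport χ ⊆ U ∧ ∀ᶠ z in 𝓝 x, χ z = 1 := by
  obtain ⟨f, -, hf⟩ := (SmoothBumpFunction.nhds_basis_tsupport (I := 𝓘(ℝ, E)) (c := x)).mem_iff.1 hU
  exact ⟨⟨f, f.contMDiff⟩, f.hasCompactSupport, hf, f.eventuallyEq_one⟩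

lemma MSmoothNear.exists_smoothFun {g : M → ℝ} {x : M} (hg : MSmoothNear E ℝ g x) {U : Set M}
    (hU : U ∈ 𝓝 x) : ∃ g' : SmoothFun E M, HasCompactSupport g' ∧ tsupport g' ⊆ U ∧
      ∀ᶠ z in 𝓝 x, g' z = g z := by
  obtain ⟨χ, hχ, hχU, hχ1⟩ := exists_bump (E := E) (inter_mem hU hg)
  have hts : tsupport (fun z => χ z • g z) ⊆ tsupport χ := tsupport_smul_subset_left χ g
  refine ⟨⟨fun z => χ z • g z, contMDiff_of_tsupport fun z hz => ?_⟩, hχ.smul_right, ?_, ?_⟩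
  · exact (χ.contMDiff z).smul (hχU (hts hz)).2
  · exact fun z hz => (hχU (hts hz)).1
  · filter_upwards [hχ1] with z hz
    change χ z • g z = g z
    rw [hz, one_smul]

lemma exists_smoothVF_eventuallyEq {x : M} {Y : (z : M) → TangentSpace 𝓘(ℝ, E) z}
    (hY : ∀ᶠ z in 𝓝 x, ContMDiffAt 𝓘(ℝ, E) 𝓘(ℝ, E).tangent ∞
      (fun z => (Y z : TangentBundle 𝓘(ℝ, E) M)) z) {U : Set M} (hU : U ∈ 𝓝 x) :
    ∃ X : SmoothVF E M, IsCompact X.supp ∧ X.supp ⊆ U ∧ ∀ᶠ z in 𝓝 x, X z = Y z := by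
  obtain ⟨O, hO, hOo, hxO⟩ := eventually_nhds_iff.1 hY
  obtain ⟨χ, hχ, hχU, hχ1⟩ := exists_bump (E := E) (inter_mem hU (hOo.mem_nhds hxO))
  obtain ⟨X, hX⟩ := exists_smoothVF_eq_smul hOo (fun z hz => (hχU hz).2)
    (fun z hz => (hO z hz).contMDiffWithinAt)
  have hs := SmoothVF.supp_subset_of_eq_smul hX
  refine ⟨X, hχ.of_isClosed_subset isClosed_closure hs, fun z hz => (hχU (hs hz)).1, ?_⟩
  filter_upwards [hχ1] with z hz
  rw [hX, hz, one_smul]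

/-- Germs of vector fields in a chart become global fields by a cutoff, so that a statement about
global fields can be tested on arbitrary germs. -/
lemma exists_smoothVF_coord {c x : M} (hx : x ∈ (chartAt E c).source) {v : E → E}
    (hv : SmoothNear v (extChartAt 𝓘(ℝ, E) c x)) {U : Set M} (hU : U ∈ 𝓝 x) :
    ∃ X : SmoothVF E M, IsCompact X.supp ∧ X.supp ⊆ U ∧
      ∀ᶠ w in 𝓝 (extChartAt 𝓘(ℝ, E) c x), X.coord c w = v w := by
  have : CompleteSpace E := FiniteDimensional.complete ℝ E
  have : IsManifold 𝓘(ℝ, E) 1 M := IsManifold.of_le (n := ∞) (by simp)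
  let φ := extChartAt 𝓘(ℝ, E) c
  let Y : (z : M) → TangentSpace 𝓘(ℝ, E) z := VectorField.mpullback 𝓘(ℝ, E) 𝓘(ℝ, E) φ v
  have hY : ∀ᶠ z in 𝓝 x, ContMDiffAt 𝓘(ℝ, E) 𝓘(ℝ, E).tangent ∞
      (fun z => (Y z : TangentBundle 𝓘(ℝ, E) M)) z := by
    filter_upwards [(mSmoothNear_extChartAt hx).continuousAt.eventually hv,
      mSmoothNear_extChartAt hx, eventually_mem_source hx] with z h1 h2 h3
    refine ContMDiffAt.mpullback_vectorField_preimage (n := ∞) (m := ∞) ?_ h2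
      (isInvertible_mfderiv_extChartAt (by simpa using h3)) (by simp)
    refine Bundle.contMDiffAt_totalSpace.2 ⟨contMDiffAt_id, ?_⟩
    have h4 := h1.contMDiffAt
    simpa [φ] using h4
  obtain ⟨X, hX, hXU, hXY⟩ := exists_smoothVF_eventuallyEq hY hU
  refine ⟨X, hX, hXU, ?_⟩
  filter_upwards [(eventually_extChartAt hx).2 hXY, eventually_mem_target hx] with w h1 h2
  have hA := isInvertible_mfderiv_extChartAt_symm_of_mem h2
  have hB := isInvertible_mfderiv_extChartAt (I := 𝓘(ℝ, E)) (φ.map_target h2)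
  have h := mfderiv_extChartAt_comp_mfderivWithin_extChartAt_symm (I := 𝓘(ℝ, E)) h2
  rw [ModelWithCorners.range_eq_univ, mfderivWithin_univ] at h
  have h3 : X (φ.symm w) = (mfderiv 𝓘(ℝ, E) 𝓘(ℝ, E) φ (φ.symm w)).inverse (v w) := by
    have h4 : φ (φ.symm w) = w := φ.right_inv h2
    rw [h1]
    change (mfderiv 𝓘(ℝ, E) 𝓘(ℝ, E) φ (φ.symm w)).inverse (v (φ (φ.symm w))) = _
    rw [h4]
  change (mfderiv 𝓘(ℝ, E) 𝓘(ℝ, E) φ.symm w).inverse (X (φ.symm w)) = _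
  rw [h3]
  exact ContinuousLinearMap.inverse_inverse_apply_of_comp_eq_id (G := E)
    (A := mfderiv 𝓘(ℝ, E) 𝓘(ℝ, E) φ.symm w)
    (B := mfderiv 𝓘(ℝ, E) 𝓘(ℝ, E) φ (φ.symm w)) hA hB h (v w)

end Cutoff

end

noncomputable section

/-! ### Membership in a pullback foliation is local -/

section PullbackGerms

variable {E : Type*} [NormedAddCommGroup E] [NormedSpace ℝ E]
  {M : Type*} [TopologicalSpace M] [ChartedSpace E M] [IsManifold 𝓘(ℝ, E) ∞ M]
  {E' : Type*} [NormedAddCommGroup E'] [NormedSpace ℝ E'] [FiniteDimensional ℝ E']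
  {P : Type*} [TopologicalSpace P] [ChartedSpace E' P] [IsManifold 𝓘(ℝ, E') ∞ P]

lemma smul_mem_pullbackSections {π : P → M} {F : Submodule ℝ (SmoothVF E M)}
    {ξ : (p : P) → TangentSpace 𝓘(ℝ, E) (π p)} (hξ : ξ ∈ pullbackSections E' π F)
    (f : SmoothFun E' P) : (fun p => f p • ξ p) ∈ pullbackSections E' π F := by
  induction hξ using Submodule.span_induction with
  | mem ξ hξ =>
    obtain ⟨g, hg, X, hX, rfl⟩ := hξ
    exact Submodule.subset_span ⟨f * g, hg.mul_left, X, hX, funext fun p => smul_smul _ _ _⟩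
  | zero => simp only [Pi.zero_apply, smul_zero]; exact Submodule.zero_mem _
  | add ξ η _ _ h₁ h₂ => simp only [Pi.add_apply, smul_add]; exact Submodule.add_mem _ h₁ h₂
  | smul c ξ _ h =>
    simp only [Pi.smul_apply, smul_comm _ c]
    exact Submodule.smul_mem _ c h

variable (E') in
/-- The section `ξ` of `π^* TM` agrees near `q` with an element of the `C^∞_c(P)`-span of
`{X ∘ π | X ∈ F}`. -/
def PullbackGerm (π : P → M) (F : Submodule ℝ (SmoothVF E M))
    (ξ : (p : P) → TangentSpace 𝓘(ℝ, E) (π p)) (q : P) : Prop :=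
  ∃ ξ' ∈ pullbackSections E' π F, ∀ᶠ z in 𝓝 q, ξ z = ξ' z

variable [T2Space P]

/-- Compactness replaces a partition of unity. Call a set good if some `χ`, equal to `1` on it,
brings `χ ξ` into the span. Each point of `s` has a good neighbourhood, and good sets are stable
under subsets and finite unions. -/
lemma mem_pullbackSections_of_pullbackGerm {π : P → M} {F : Submodule ℝ (SmoothVF E M)}
    {ξ : (p : P) → TangentSpace 𝓘(ℝ, E) (π p)} {s : Set P} (hs : IsCompact s)
    (hξs : ∀ q ∉ s, ξ q = 0) (hξ : ∀ q ∈ s, PullbackGerm E' π F ξ q) :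
    ξ ∈ pullbackSections E' π F := by
  have key : ∃ χ : SmoothFun E' P, (∀ z ∈ s, χ z = 1) ∧
      (fun p => χ p • ξ p) ∈ pullbackSections E' π F := by
    refine hs.induction_on (p := fun s => ∃ χ : SmoothFun E' P, (∀ z ∈ s, χ z = 1) ∧
      (fun p => χ p • ξ p) ∈ pullbackSections E' π F) ?_ ?_ ?_ ?_
    · refine ⟨0, by simp, ?_⟩
      convert Submodule.zero_mem (pullbackSections E' π F) using 1
      exact funext fun p => zero_smul _ _
    · rintro s t hst ⟨χ, h1, h2⟩
      exact ⟨χ, fun z hz => h1 z (hst hz), h2⟩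
    · rintro s t ⟨χ₁, h1, h1'⟩ ⟨χ₂, h2, h2'⟩
      -- This function is `1 - (1 - χ₁)(1 - χ₂)`, equal to `1` wherever one of the two is.
      refine ⟨χ₁ + χ₂ - χ₁ * χ₂, ?_, ?_⟩
      · rintro z (hz | hz)
        · change χ₁ z + χ₂ z - χ₁ z * χ₂ z = 1
          rw [h1 z hz]; ring
        · change χ₁ z + χ₂ z - χ₁ z * χ₂ z = 1
          rw [h2 z hz]; ring
      · convert Submodule.sub_mem _ (Submodule.add_mem _ h1' h2')
          (smul_mem_pullbackSections h2' χ₁) using 1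
        funext p
        change (χ₁ p + χ₂ p - χ₁ p * χ₂ p) • ξ p = χ₁ p • ξ p + χ₂ p • ξ p - χ₁ p • χ₂ p • ξ p
        rw [sub_smul, add_smul, smul_smul]
    · intro q hq
      obtain ⟨ξ', hξ', heq⟩ := hξ q hq
      obtain ⟨χ, -, hχ, hχ1⟩ := exists_bump (E := E') heq
      refine ⟨{z | χ z = 1}, mem_nhdsWithin_of_mem_nhds hχ1, χ, fun z hz => hz, ?_⟩
      convert smul_mem_pullbackSections hξ' χ using 1
      funext p
      by_cases hp : p ∈ tsupport χ
      · rw [hχ hp]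
      · rw [image_eq_zero_of_notMem_tsupport hp, zero_smul, zero_smul]
  obtain ⟨χ, h1, h2⟩ := key
  convert h2 using 1
  funext p
  by_cases hp : p ∈ s
  · rw [h1 p hp, one_smul]
  · rw [hξs p hp, smul_zero]

lemma SmoothVF.eq_zero_of_notMem_supp {X : SmoothVF E M} {x : M} (hx : x ∉ X.supp) : X x = 0 := by
  by_contra h
  exact hx (subset_closure h)

/-- Membership in the pullback of a foliation is a local condition. -/
lemma mem_pullbackFoliation_iff {π : P → M} {F : Submodule ℝ (SmoothVF E M)} {Y : SmoothVF E' P} :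
    Y ∈ pullbackFoliation π F ↔ IsCompact Y.supp ∧
      ∀ q, PullbackGerm E' π F (fun p => mfderiv 𝓘(ℝ, E') 𝓘(ℝ, E) π p (Y p)) q := by
  constructor
  · rintro ⟨h1, h2⟩
    exact ⟨h1, fun q => ⟨_, h2, Eventually.of_forall fun _ => rfl⟩⟩
  · rintro ⟨h1, h2⟩
    refine ⟨h1, mem_pullbackSections_of_pullbackGerm h1 (fun q hq => ?_) fun q _ => h2 q⟩
    rw [SmoothVF.eq_zero_of_notMem_supp hq]
    exact map_zero _

/-- Multiplying `Y` by a bump function supported where the germ condition holds turns it into a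
genuine element of the pullback. -/
lemma PullbackGerm.exists_mem_pullbackFoliation {π : P → M} {F : Submodule ℝ (SmoothVF E M)}
    {Y : SmoothVF E' P} {q : P}
    (h : PullbackGerm E' π F (fun p => mfderiv 𝓘(ℝ, E') 𝓘(ℝ, E) π p (Y p)) q) :
    ∃ Y' ∈ pullbackFoliation π F, ∀ᶠ z in 𝓝 q, Y' z = Y z := by
  obtain ⟨ξ', hξ', heq⟩ := h
  obtain ⟨χ, hχc, hχ, hχ1⟩ := exists_bump (E := E') heq
  have hs : (SmoothVF.fsmul χ Y).supp ⊆ tsupport χ :=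
    SmoothVF.supp_subset_of_eq_smul (Y := Y) fun z => rfl
  refine ⟨SmoothVF.fsmul χ Y, ⟨hχc.of_isClosed_subset isClosed_closure hs, ?_⟩, ?_⟩
  · convert smul_mem_pullbackSections hξ' χ using 1
    funext p
    change mfderiv 𝓘(ℝ, E') 𝓘(ℝ, E) π p (χ p • Y p) = _
    rw [map_smul]
    by_cases hp : p ∈ tsupport χ
    · rw [← hχ hp]
    · rw [image_eq_zero_of_notMem_tsupport hp, zero_smul, zero_smul]
  · filter_upwards [hχ1] with z hz
    change χ z • Y z = Y z
    rw [hz, one_smul]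

lemma PullbackGerm.of_sum {π : P → M} {F : Submodule ℝ (SmoothVF E M)}
    {ξ : (p : P) → TangentSpace 𝓘(ℝ, E) (π p)} {q : P} {m : ℕ}
    {X : Fin m → SmoothVF E M}
    (hX : ∀ i, X i ∈ F) {g : Fin m → P → ℝ} (hg : ∀ i, MSmoothNear E' ℝ (g i) q)
    (h : ∀ᶠ z in 𝓝 q, ξ z = ∑ i, g i z • X i (π z)) : PullbackGerm E' π F ξ q := by
  choose g' hg' _ hgg' using fun i => (hg i).exists_smoothFun univ_mem
  refine ⟨fun z => ∑ i, g' i z • X i (π z), ?_, ?_⟩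
  · have : (fun z => ∑ i, g' i z • X i (π z)) =
        ∑ i, (fun z => (g' i z • X i (π z) : TangentSpace 𝓘(ℝ, E) (π z))) := by
      ext z; simp only [Finset.sum_apply]
    rw [this]
    exact Submodule.sum_mem _ fun i _ => Submodule.subset_span ⟨g' i, hg' i, X i, hX i, rfl⟩
  · filter_upwards [h, eventually_all.2 hgg'] with z h1 h2
    simp only [h1, h2]

end PullbackGerms

/-! ### Membership in a singular foliation is local -/

section Local

variable {E : Type*} [NormedAddCommGroup E] [NormedSpace ℝ E] [FiniteDimensional ℝ E]
  {M : Type*} [TopologicalSpace M] [ChartedSpace E M] [IsManifold 𝓘(ℝ, E) ∞ M] [T2Space M]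

namespace SingularFoliation

lemma exists_mem_of_mem_pullbackSections_id (F : SingularFoliation E M)
    {ξ : (z : M) → TangentSpace 𝓘(ℝ, E) (id z)}
    (hξ : ξ ∈ pullbackSections E (id : M → M) F.toSubmodule) :
    ∃ X' ∈ F.toSubmodule, ∀ z, X' z = ξ z := by
  induction hξ using Submodule.span_induction with
  | mem ξ hξ =>
    obtain ⟨g, hg, X, hX, rfl⟩ := hξ
    exact ⟨_, F.fsmul_mem g hg X hX, fun z => rfl⟩
  | zero => exact ⟨0, Submodule.zero_mem _, fun z => rfl⟩
  | add ξ η _ _ h₁ h₂ =>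
    obtain ⟨X₁, hX₁, h₁⟩ := h₁
    obtain ⟨X₂, hX₂, h₂⟩ := h₂
    refine ⟨_, Submodule.add_mem _ hX₁ hX₂, fun z => ?_⟩
    change X₁ z + X₂ z = ξ z + η z
    rw [h₁, h₂]
  | smul c ξ _ h =>
    obtain ⟨X₁, hX₁, h₁⟩ := h
    refine ⟨_, Submodule.smul_mem _ c hX₁, fun z => ?_⟩
    change c • X₁ z = c • ξ z
    rw [h₁]

/-- The patching of sections is applied to the identity map, for which the span of sections is the
foliation itself. -/
lemma mem_of_forall_eventuallyEq (F : SingularFoliation E M) {X : SmoothVF E M}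
    (hX : IsCompact X.supp)
    (h : ∀ x, ∃ X' ∈ F.toSubmodule, ∀ᶠ z in 𝓝 x, X z = X' z) : X ∈ F.toSubmodule := by
  have h1 : (fun z => X (id z)) ∈ pullbackSections E (id : M → M) F.toSubmodule := by
    refine mem_pullbackSections_of_pullbackGerm hX
      (fun q hq => SmoothVF.eq_zero_of_notMem_supp hq) fun x _ => ?_
    obtain ⟨X', hX', h'⟩ := h x
    refine PullbackGerm.of_sum (m := 1) (X := fun _ => X') (g := fun _ _ => 1) (fun _ => hX')
      (fun _ => .const) ?_
    simpa using h'
  obtain ⟨X', hX', h3⟩ := F.exists_mem_of_mem_pullbackSections_id h1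
  have : X = X' := by ext z; exact (h3 z).symm
  rwa [this]

end SingularFoliation

end Local

end

noncomputable section

/-! ### Local transverse models and the criterion for membership in a pullback -/

section Models

lemma PullsBack.eventually {E V W K : Type*} [NormedAddCommGroup E] [NormedSpace ℝ E]
    [NormedAddCommGroup V] [NormedSpace ℝ V] [NormedAddCommGroup W] [NormedSpace ℝ W]
    [NormedAddCommGroup K] [NormedSpace ℝ K] {Y : E → V →L[ℝ] E} {x : E} {f : E → K}
    {Z : K → W →L[ℝ] K} (h : PullsBack Y x f Z) : ∀ᶠ z in 𝓝 x, PullsBack Y z f Z := by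
  obtain ⟨a, ha, ha'⟩ := h.push
  obtain ⟨C, hC, hC'⟩ := h.lift
  filter_upwards [h.smooth.eventually, eventually_eventually_nhds.2 h.surj, ha.eventually,
    eventually_eventually_nhds.2 ha', hC.eventually, eventually_eventually_nhds.2 hC']
    with z h1 h2 h3 h4 h5 h6
  exact ⟨h1, h2, ⟨a, h3, h4⟩, ⟨C, h5, h6⟩⟩

variable {E : Type*} [NormedAddCommGroup E] [NormedSpace ℝ E] [FiniteDimensional ℝ E]
  {M : Type*} [TopologicalSpace M] [ChartedSpace E M] [IsManifold 𝓘(ℝ, E) ∞ M]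
  {K : Type*} [NormedAddCommGroup K] [NormedSpace ℝ K]
  {W : Type*} [NormedAddCommGroup W] [NormedSpace ℝ W]

namespace SmoothVF

lemma coord_eq_sum {ι : Type*} {s : Finset ι} {c : M} {w : E} {X : SmoothVF E M} {g : ι → ℝ}
    {X' : ι → SmoothVF E M}
    (h : X ((extChartAt 𝓘(ℝ, E) c).symm w) = ∑ i ∈ s, g i • X' i ((extChartAt 𝓘(ℝ, E) c).symm w)) :
    X.coord c w = ∑ i ∈ s, g i • (X' i).coord c w := by
  change (mfderiv 𝓘(ℝ, E) 𝓘(ℝ, E) (extChartAt 𝓘(ℝ, E) c).symm w).inverse (X _) = _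
  rw [h, map_sum]
  simp only [map_smul]
  rfl

lemma sum_smul_apply {ι : Type*} {s : Finset ι} (a : ι → ℝ) (X : ι → SmoothVF E M) (x : M) :
    (∑ i ∈ s, a i • X i) x = ∑ i ∈ s, a i • X i x := by
  have := map_sum (SmoothVF.eval x) (fun i => a i • X i) s
  exact this

/-- The coordinate expressions of finitely many vector fields, as a linear function of the
coefficients of a combination of them. -/
def coordFamily (c : M) {m : ℕ} (X : Fin m → SmoothVF E M) : E → (Fin m → ℝ) →L[ℝ] E :=
  fun w => ∑ i, (ContinuousLinearMap.proj i).smulRight ((X i).coord c w)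

lemma coordFamily_apply (c : M) {m : ℕ} (X : Fin m → SmoothVF E M) (w : E) (a : Fin m → ℝ) :
    coordFamily c X w a = ∑ i, a i • (X i).coord c w := by
  simp [coordFamily, sum_apply]

lemma coordFamily_eq_coord (c : M) {m : ℕ} (X : Fin m → SmoothVF E M) (w : E) (a : Fin m → ℝ) :
    coordFamily c X w a = (∑ i, a i • X i : SmoothVF E M).coord c w := by
  rw [coordFamily_apply, coord_eq_sum (sum_smul_apply a X _)]

lemma smoothNear_coordFamily {c x : M} (hx : x ∈ (chartAt E c).source) {m : ℕ}
    (X : Fin m → SmoothVF E M) : SmoothNear (coordFamily c X) (extChartAt 𝓘(ℝ, E) c x) := by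
  refine SmoothNear.of_apply fun a => ?_
  simp only [coordFamily_eq_coord]
  exact smoothNear_coord hx _

end SmoothVF

/-- The vector fields `X i` generate `F` at all points near `x`. -/
def SingularFoliation.GeneratedNear (F : SingularFoliation E M) (x : M) {m : ℕ}
    (X : Fin m → SmoothVF E M) : Prop :=
  ∀ᶠ q in 𝓝 x, ∀ X' ∈ F.toSubmodule, ∃ g : Fin m → M → ℝ, (∀ i, MSmoothNear E ℝ (g i) q) ∧
    ∀ᶠ z in 𝓝 q, X' z = ∑ i, g i z • X i z

/-- Near `x` the foliation `F` consists of the vector fields that `pr` projects to combinations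
of the vector fields `Z · a`. -/
structure LocalModel (F : SingularFoliation E M) (x : M) (pr : M → K) (Z : K → W →L[ℝ] K) :
    Prop where
  exists_chart : ∃ (c : M) (m : ℕ) (X : Fin m → SmoothVF E M), x ∈ (chartAt E c).source ∧
    (∀ i, X i ∈ F.toSubmodule) ∧ F.GeneratedNear x X ∧
    PullsBack (SmoothVF.coordFamily c X) (extChartAt 𝓘(ℝ, E) c x)
      (fun w => pr ((extChartAt 𝓘(ℝ, E) c).symm w)) Z
  smoothNear : SmoothNear Z (pr x)

namespace LocalModel

variable {F : SingularFoliation E M} {x : M} {pr : M → K} {Z : K → W →L[ℝ] K}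

lemma mSmoothNear (h : LocalModel F x pr Z) : MSmoothNear E K pr x := by
  obtain ⟨c, m, X, hx, -, -, hp⟩ := h.exists_chart
  exact MSmoothNear.of_comp_extChartAt_symm hx hp.smooth.mSmoothNear

lemma eventually (h : LocalModel F x pr Z) : ∀ᶠ x' in 𝓝 x, LocalModel F x' pr Z := by
  obtain ⟨c, m, X, hx, hX, hg, hp⟩ := h.exists_chart
  filter_upwards [eventually_mem_source hx, eventually_eventually_nhds.2 hg,
    (mSmoothNear_extChartAt hx).continuousAt.eventually hp.eventually,
    h.mSmoothNear.continuousAt.eventually h.smoothNear.eventually] with x' h1 h2 h3 h4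
  exact ⟨⟨c, m, X, h1, hX, h2, h3⟩, h4⟩

/-- One model is exchanged for another in this way: chart and generators stay, and only the
projection is followed by `θ`. -/
lemma comp {K' W' : Type*} [NormedAddCommGroup K'] [NormedSpace ℝ K']
    [NormedAddCommGroup W'] [NormedSpace ℝ W'] (h : LocalModel F x pr Z) {θ : K → K'}
    {Z' : K' → W' →L[ℝ] K'} (hθ : PullsBack Z (pr x) θ Z') (hZ' : SmoothNear Z' (θ (pr x))) :
    LocalModel F x (fun z => θ (pr z)) Z' := by
  obtain ⟨c, m, X, hx, hX, hg, hp⟩ := h.exists_chart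
  refine ⟨⟨c, m, X, hx, hX, hg, hp.comp ?_ hθ⟩, hZ'⟩
  rw [extChartAt_symm_apply_self hx]

end LocalModel

lemma mfderiv_comp_apply_eq {E' : Type*} [NormedAddCommGroup E'] [NormedSpace ℝ E']
    {Q : Type*} [TopologicalSpace Q] [ChartedSpace E' Q]
    {E'' : Type*} [NormedAddCommGroup E''] [NormedSpace ℝ E'']
    {R : Type*} [TopologicalSpace R] [ChartedSpace E'' R]
    {g : M → R} {π : Q → M} {q : Q}
    (hg : MDifferentiableAt 𝓘(ℝ, E) 𝓘(ℝ, E'') g (π q))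
    (hπ : MDifferentiableAt 𝓘(ℝ, E') 𝓘(ℝ, E) π q) (v : TangentSpace 𝓘(ℝ, E') q) :
    mfderiv 𝓘(ℝ, E') 𝓘(ℝ, E'') (fun z => g (π z)) q v =
      mfderiv 𝓘(ℝ, E) 𝓘(ℝ, E'') g (π q) (mfderiv 𝓘(ℝ, E') 𝓘(ℝ, E) π q v) := by
  have := mfderiv_comp q hg hπ
  change mfderiv 𝓘(ℝ, E') 𝓘(ℝ, E'') (g ∘ π) q v = _
  rw [this]; rfl

section PullbackCriterion

variable {E' : Type*} [NormedAddCommGroup E'] [NormedSpace ℝ E'] [FiniteDimensional ℝ E']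
  {Q : Type*} [TopologicalSpace Q] [ChartedSpace E' Q] [IsManifold 𝓘(ℝ, E') ∞ Q]
  {F : SingularFoliation E M} {π : Q → M} {q : Q}

/-- The elements of `F` that occur in `ξ` vary, but near `π q` each is a smooth combination of the
fixed generators, and the coefficients can be composed with `π`. -/
lemma PullbackGerm.exists_coefficients {m : ℕ} {X : Fin m → SmoothVF E M}
    (hX : F.GeneratedNear (π q) X) (hπ : MSmoothNear E' E π q)
    {ξ : (p : Q) → TangentSpace 𝓘(ℝ, E) (π p)} (h : PullbackGerm E' π F.toSubmodule ξ q) :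
    ∃ g : Fin m → Q → ℝ, (∀ i, MSmoothNear E' ℝ (g i) q) ∧
      ∀ᶠ z in 𝓝 q, ξ z = ∑ i, g i z • X i (π z) := by
  obtain ⟨ξ', hξ', heq⟩ := h
  suffices hs : ∃ g : Fin m → Q → ℝ, (∀ i, MSmoothNear E' ℝ (g i) q) ∧
      ∀ᶠ z in 𝓝 q, ξ' z = ∑ i, g i z • X i (π z) by
    obtain ⟨g, hg, hg'⟩ := hs
    refine ⟨g, hg, ?_⟩
    filter_upwards [heq, hg'] with z h1 h2
    rw [h1, h2]
  clear heq
  induction hξ' using Submodule.span_induction with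
  | mem ξ hξ =>
    obtain ⟨g, -, X', hX', rfl⟩ := hξ
    obtain ⟨a, ha, ha'⟩ := hX.self_of_nhds X' hX'
    refine ⟨fun i z => g z * a i (π z), fun i => ?_, ?_⟩
    · have h1 := MSmoothNear.prodMk (MSmoothNear.of_contMDiff (x := q) g.contMDiff)
        (MSmoothNear.comp (ha i) hπ)
      exact SmoothNear.mcomp (g := fun p : ℝ × ℝ => p.1 * p.2)
        (.of_contDiff (contDiff_fst.mul contDiff_snd)) h1
    · filter_upwards [hπ.continuousAt.eventually ha'] with z hz
      simp only [hz, Finset.smul_sum, smul_smul]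
  | zero => exact ⟨fun _ _ => 0, fun _ => .const, Eventually.of_forall fun z => by simp⟩
  | add ξ η _ _ h₁ h₂ =>
    obtain ⟨a, ha, ha'⟩ := h₁
    obtain ⟨b, hb, hb'⟩ := h₂
    refine ⟨fun i z => a i z + b i z, fun i => ?_, ?_⟩
    · exact SmoothNear.mcomp (g := fun p : ℝ × ℝ => p.1 + p.2)
        (.of_contDiff (contDiff_fst.add contDiff_snd)) ((ha i).prodMk (hb i))
    · filter_upwards [ha', hb'] with z h1 h2
      simp only [Pi.add_apply, h1, h2, add_smul, Finset.sum_add_distrib]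
  | smul c ξ _ h =>
    obtain ⟨a, ha, ha'⟩ := h
    refine ⟨fun i z => c * a i z, fun i => ?_, ?_⟩
    · exact SmoothNear.mcomp (g := fun p : ℝ => c * p)
        (.of_contDiff (contDiff_const.mul contDiff_id)) (ha i)
    · filter_upwards [ha'] with z h1
      simp only [Pi.smul_apply, h1, Finset.smul_sum, smul_smul]

lemma MSmoothNear.pi {m : ℕ} {g : Fin m → Q → ℝ} (hg : ∀ i, MSmoothNear E' ℝ (g i) q) :
    MSmoothNear E' (Fin m → ℝ) (fun z i => g i z) q := by
  filter_upwards [eventually_all.2 hg] with z hz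
  exact contMDiffAt_pi_space.2 hz

lemma MSmoothNear.clm_apply {G G' : Type*} [NormedAddCommGroup G] [NormedSpace ℝ G]
    [NormedAddCommGroup G'] [NormedSpace ℝ G'] {A : Q → G →L[ℝ] G'} {g : Q → G}
    (hA : MSmoothNear E' (G →L[ℝ] G') A q) (hg : MSmoothNear E' G g q) :
    MSmoothNear E' G' (fun z => A z (g z)) q := by
  filter_upwards [hA, hg] with z h1 h2
  exact h1.clm_apply h2

variable [T2Space Q]

/-- The pullback of `F` under `π` consists of the vector fields that `pr ∘ π` projects to
combinations of the vector fields of a local model. -/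
theorem LocalModel.pullbackGerm_iff {pr : M → K} {Z : K → W →L[ℝ] K}
    (h : LocalModel F (π q) pr Z) (hπ : MSmoothNear E' E π q) (Y : SmoothVF E' Q) :
    PullbackGerm E' π F.toSubmodule (fun p => mfderiv 𝓘(ℝ, E') 𝓘(ℝ, E) π p (Y p)) q ↔
      ∃ g : Q → W, MSmoothNear E' W g q ∧ ∀ᶠ z in 𝓝 q,
        (mfderiv 𝓘(ℝ, E') 𝓘(ℝ, K) (fun z => pr (π z)) z (Y z) : K) = Z (pr (π z)) (g z) := by
  have hpr := h.mSmoothNear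
  obtain ⟨c, m, X, hx, hX, hg, hp⟩ := h.exists_chart
  have hφ : MSmoothNear E' E (fun z => extChartAt 𝓘(ℝ, E) c (π z)) q :=
    MSmoothNear.comp (mSmoothNear_extChartAt hx) hπ
  have hsrc := hπ.continuousAt.eventually (eventually_mem_source hx)
  have hprπ := hπ.continuousAt.eventually hpr.eventually
  constructor
  · intro hY
    obtain ⟨g, hgs, hg'⟩ := hY.exists_coefficients hg hπ
    obtain ⟨a, ha, ha'⟩ := hp.push
    refine ⟨fun z => a (extChartAt 𝓘(ℝ, E) c (π z)) (fun i => g i z),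
      (SmoothNear.mcomp (f := fun z => extChartAt 𝓘(ℝ, E) c (π z)) ha hφ).clm_apply (MSmoothNear.pi hgs), ?_⟩
    filter_upwards [hg', hφ.continuousAt.eventually ha', hsrc, hprπ, hπ.eventually]
      with z h1 h2 h3 h4 h5
    rw [mfderiv_comp_apply_eq h4.mdifferentiableAt h5.mdifferentiableAt]
    have h6 := h2 fun i => g i z
    rw [SmoothVF.coordFamily_apply, extChartAt_symm_apply_self h3] at h6
    rw [h1, map_sum, ← h6, map_sum]
    refine Finset.sum_congr rfl fun i _ => ?_
    rw [map_smul, map_smul, mfderiv_eq_fderiv_coord h3 h4.mdifferentiableAt (X i)]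
    rfl
  · rintro ⟨g, hgs, hg'⟩
    obtain ⟨C, hC, hC'⟩ := hp.lift
    have hv := hφ.mfderiv_apply Y
    -- The coefficients come from the lift `C`, evaluated on the coordinate expression of `dπ Y` and
    -- on the given `g`.
    have hcoef : MSmoothNear E' (Fin m → ℝ) (fun z => C (extChartAt 𝓘(ℝ, E) c (π z))
        ((mfderiv 𝓘(ℝ, E') 𝓘(ℝ, E) (fun z => extChartAt 𝓘(ℝ, E) c (π z)) z (Y z) : E), g z)) q :=
      (SmoothNear.mcomp (f := fun z => extChartAt 𝓘(ℝ, E) c (π z)) hC hφ).clm_apply (hv.prodMk hgs)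
    refine PullbackGerm.of_sum hX (fun i => SmoothNear.mcomp (g := fun a : Fin m → ℝ => a i)
      (.of_contDiff (contDiff_apply ℝ ℝ i)) hcoef) ?_
    have hback : ∀ᶠ z in 𝓝 q, (fun z => (extChartAt 𝓘(ℝ, E) c).symm
        (extChartAt 𝓘(ℝ, E) c (π z))) =ᶠ[𝓝 z] π := by
      filter_upwards [eventually_eventually_nhds.2 hsrc] with z hz
      filter_upwards [hz] with z' hz'
      exact extChartAt_symm_apply_self hz'
    filter_upwards [hg', hφ.continuousAt.eventually hC', hsrc, hprπ, hπ.eventually, hφ.eventually,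
      hback] with z h1 h2 h3 h4 h5 h6 h7
    have hw : extChartAt 𝓘(ℝ, E) c (π z) ∈ (extChartAt 𝓘(ℝ, E) c).target :=
      (extChartAt 𝓘(ℝ, E) c).map_source (by simpa using h3)
    have hsymm := (mSmoothNear_extChartAt_symm (E := E) h3).mdifferentiableAt
    -- `dφ.symm` recovers `dπ Y` from its coordinates
    have h8 : mfderiv 𝓘(ℝ, E) 𝓘(ℝ, E) (extChartAt 𝓘(ℝ, E) c).symm (extChartAt 𝓘(ℝ, E) c (π z))
        (mfderiv 𝓘(ℝ, E') 𝓘(ℝ, E) (fun z => extChartAt 𝓘(ℝ, E) c (π z)) z (Y z)) =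
        mfderiv 𝓘(ℝ, E') 𝓘(ℝ, E) π z (Y z) := by
      have h9 := mfderiv_comp_apply_eq (M := E) (π := fun z => extChartAt 𝓘(ℝ, E) c (π z)) (q := z) hsymm
        h6.mdifferentiableAt (Y z)
      rw [h7.mfderiv_eq] at h9
      exact h9.symm
    have h10 : (mfderiv 𝓘(ℝ, E') 𝓘(ℝ, K) (fun z => pr (π z)) z (Y z) : K) =
        fderiv ℝ (fun w => pr ((extChartAt 𝓘(ℝ, E) c).symm w)) (extChartAt 𝓘(ℝ, E) c (π z))
        (mfderiv 𝓘(ℝ, E') 𝓘(ℝ, E) (fun z => extChartAt 𝓘(ℝ, E) c (π z)) z (Y z)) := by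
      have h11 : (fun z => pr (π z)) =ᶠ[𝓝 z] fun z => (fun w => pr ((extChartAt 𝓘(ℝ, E) c).symm w))
          (extChartAt 𝓘(ℝ, E) c (π z)) := h7.symm.fun_comp pr
      have h12 := (h4.comp_extChartAt_symm h3).mdifferentiableAt
      have h12' := mfderiv_comp_apply_eq (M := E)
        (π := fun z => extChartAt 𝓘(ℝ, E) c (π z)) (q := z) h12 h6.mdifferentiableAt (Y z)
      rw [mfderiv_eq_fderiv] at h12'
      exact (congrArg (fun L : E' →L[ℝ] K => L (Y z)) h11.mfderiv_eq).trans h12'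
    have h13 := h2 (mfderiv 𝓘(ℝ, E') 𝓘(ℝ, E) (fun z => extChartAt 𝓘(ℝ, E) c (π z)) z (Y z) : E)
      (g z) (by rw [← h10, h1, extChartAt_symm_apply_self h3])
    rw [SmoothVF.coordFamily_apply] at h13
    rw [← h8, ← h13]
    have h14 : ∀ i, (mfderiv 𝓘(ℝ, E) 𝓘(ℝ, E) (extChartAt 𝓘(ℝ, E) c).symm
        (extChartAt 𝓘(ℝ, E) c (π z)) (SmoothVF.coord (E := E) c (X i) (extChartAt 𝓘(ℝ, E) c (π z)))
        : E) = X i (π z) := fun i => by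
      rw [(X i).mfderiv_coord hw]
      exact congrArg (fun y => (X i y : E)) (extChartAt_symm_apply_self h3)
    erw [map_sum]
    refine Finset.sum_congr rfl fun i _ => ?_
    erw [map_smul, h14 i]
    rw [h13]
    rfl

end PullbackCriterion

end Models

end

noncomputable section

/-! ### Existence of local models -/

section ModelExistence

lemma PullsBack.congr {E V W K : Type*} [NormedAddCommGroup E] [NormedSpace ℝ E]
    [NormedAddCommGroup V] [NormedSpace ℝ V] [NormedAddCommGroup W] [NormedSpace ℝ W]
    [NormedAddCommGroup K] [NormedSpace ℝ K] {Y : E → V →L[ℝ] E} {x : E} {f g : E → K}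
    {Z : K → W →L[ℝ] K} (h : PullsBack Y x f Z) (hfg : g =ᶠ[𝓝 x] f) : PullsBack Y x g Z := by
  obtain ⟨a, ha, ha'⟩ := h.push
  obtain ⟨C, hC, hC'⟩ := h.lift
  have hd : ∀ᶠ z in 𝓝 x, fderiv ℝ g z = fderiv ℝ f z := by
    filter_upwards [hfg.eventuallyEq_nhds] with z hz
    exact hz.fderiv_eq
  refine ⟨h.smooth.congr hfg, ?_, ⟨a, ha, ?_⟩, ⟨C, hC, ?_⟩⟩
  · filter_upwards [h.surj, hd] with z h1 h2
    rwa [h2]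
  · filter_upwards [ha', hd, hfg] with z h1 h2 h3
    rwa [h2, h3]
  · filter_upwards [hC', hd, hfg] with z h1 h2 h3
    rwa [h2, h3]

variable {E : Type*} [NormedAddCommGroup E] [NormedSpace ℝ E] [FiniteDimensional ℝ E]
  {M : Type*} [TopologicalSpace M] [ChartedSpace E M] [IsManifold 𝓘(ℝ, E) ∞ M] [T2Space M]

/-- The local generators are multiplied by a bump function to become elements of `F`; where the bump
function equals `1` they still generate. -/
lemma SingularFoliation.exists_generatedNear (F : SingularFoliation E M) (x : M) :
    ∃ (m : ℕ) (X : Fin m → SmoothVF E M), (∀ i, X i ∈ F.toSubmodule) ∧ F.GeneratedNear x X := by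
  obtain ⟨U, hU, hxU, n, Y, hY, hF⟩ := F.locallyFinitelyGenerated x
  obtain ⟨χ, hχc, hχU, hχ1⟩ := exists_bump (E := E) (hU.mem_nhds hxU)
  choose X hX using fun i => exists_smoothVF_eq_smul hU hχU (hY i)
  refine ⟨n, X, fun i => ((hF (X i)).2 ⟨fun j => if j = i then χ else 0, fun j => ?_, fun z => ?_⟩).1, ?_⟩
  · dsimp only
    split_ifs
    · exact ⟨hχc, hχU⟩
    · refine ⟨HasCompactSupport.zero, ?_⟩
      have : tsupport ((0 : SmoothFun E M) : M → ℝ) = ∅ := tsupport_eq_empty_iff.2 rfl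
      rw [this]
      exact Set.empty_subset _
  · rw [Finset.sum_eq_single i]
    · dsimp only; rw [if_pos rfl]; exact hX i z
    · intro j _ hj
      dsimp only; rw [if_neg hj]; exact zero_smul _ _
    · simp
  · filter_upwards [eventually_eventually_nhds.2 hχ1, hU.mem_nhds hxU] with q hq hqU X' hX'
    -- An arbitrary element of `F` need not be supported in `U`, so a second bump function localizes
    -- it near `q` first.
    obtain ⟨χ', hχc', hχU', hχ1'⟩ := exists_bump (E := E) (hU.mem_nhds hqU)
    have hs : (SmoothVF.fsmul χ' X').supp ⊆ tsupport χ' :=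
      SmoothVF.supp_subset_of_eq_smul (Y := X') fun z => rfl
    obtain ⟨f, -, hf⟩ := (hF (SmoothVF.fsmul χ' X')).1 ⟨F.fsmul_mem χ' hχc' X' hX', hs.trans hχU'⟩
    refine ⟨fun i => f i, fun i => .of_contMDiff (f i).contMDiff, ?_⟩
    filter_upwards [hq, hχ1'] with z h1 h2
    have h3 := hf z
    change χ' z • X' z = _ at h3
    rw [h2, one_smul] at h3
    rw [h3]
    refine Finset.sum_congr rfl fun i _ => ?_
    rw [hX, h1, one_smul]

/-- Brackets of the generators lie in `F`, hence are combinations of the generators; their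
coefficients, extended bilinearly, are the structure functions. -/
lemma SingularFoliation.involutive_coordFamily (F : SingularFoliation E M) {x : M} {m : ℕ}
    {X : Fin m → SmoothVF E M} (hX : ∀ i, X i ∈ F.toSubmodule) (hg : F.GeneratedNear x X) :
    Involutive (SmoothVF.coordFamily x X) (extChartAt 𝓘(ℝ, E) x x) := by
  have hx := mem_chart_source E x
  choose g hgs hg' using fun i j => hg.self_of_nhds _ (F.lie_mem _ (hX i) _ (hX j))
  let c : E → (Fin m → ℝ) →L[ℝ] (Fin m → ℝ) →L[ℝ] (Fin m → ℝ) := fun w =>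
    ∑ i, (ContinuousLinearMap.proj i).smulRight (∑ j, (ContinuousLinearMap.proj j).smulRight
      (fun k => g i j k ((extChartAt 𝓘(ℝ, E) x).symm w)))
  have hc : ∀ w a b, c w a b = fun k => ∑ i, ∑ j, a i * b j *
      g i j k ((extChartAt 𝓘(ℝ, E) x).symm w) := by
    intro w a b
    ext k
    simp [c, sum_apply, Finset.sum_apply, Finset.mul_sum, mul_assoc]
  refine ⟨c, SmoothNear.of_apply fun a => SmoothNear.of_apply fun b => ?_, ?_⟩
  · simp only [hc]
    refine SmoothNear.pi fun k => SmoothNear.sum fun i _ => SmoothNear.sum fun j _ => ?_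
    exact (SmoothNear.const (a i * b j)).smul ((hgs i j k).comp_extChartAt_symm hx).smoothNear
  · have h1 := (eventually_extChartAt hx).2 (eventually_all.2 fun i => eventually_all.2 fun j => hg' i j)
    filter_upwards [h1, eventually_mem_target hx] with w h2 h3 a b
    have h4 : (extChartAt 𝓘(ℝ, E) x).symm w ∈ (chartAt E x).source := by
      simpa using (extChartAt 𝓘(ℝ, E) x).map_target h3
    have h5 := SmoothVF.lieBracket_coord h4 (∑ i, a i • X i) (∑ j, b j • X j)
    rw [(extChartAt 𝓘(ℝ, E) x).right_inv h3] at h5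
    simp only [SmoothVF.coordFamily_eq_coord] at h5 ⊢
    change VectorField.lieBracket ℝ (SmoothVF.coord x (∑ i, a i • X i))
      (SmoothVF.coord x (∑ i, b i • X i)) w = _
    rw [h5]
    have h6 : ⁅∑ i, a i • X i, ∑ j, b j • X j⁆ = ∑ i, ∑ j, (a i * b j) • ⁅X i, X j⁆ := by
      rw [sum_lie_sum]
      refine Finset.sum_congr rfl fun i _ => Finset.sum_congr rfl fun j _ => ?_
      rw [smul_lie, lie_smul, smul_smul]
    have h7 : ⁅∑ i, a i • X i, ∑ j, b j • X j⁆ ((extChartAt 𝓘(ℝ, E) x).symm w) =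
        (∑ k, c w a b k • X k) ((extChartAt 𝓘(ℝ, E) x).symm w) := by
      have h8 := map_sum (SmoothVF.eval ((extChartAt 𝓘(ℝ, E) x).symm w))
        (fun i => ∑ j, (a i * b j) • ⁅X i, X j⁆) Finset.univ
      rw [h6, SmoothVF.sum_smul_apply]
      refine h8.trans ?_
      have h9 : ∀ i, SmoothVF.eval ((extChartAt 𝓘(ℝ, E) x).symm w) (∑ j, (a i * b j) • ⁅X i, X j⁆) =
          ∑ j, (a i * b j) • ∑ k, g i j k ((extChartAt 𝓘(ℝ, E) x).symm w) •
            X k ((extChartAt 𝓘(ℝ, E) x).symm w) := fun i => by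
        refine (SmoothVF.sum_smul_apply _ _ _).trans (Finset.sum_congr rfl fun j _ => ?_)
        rw [h2 i j]
      simp only [h9, hc, Finset.smul_sum, smul_smul, Finset.sum_smul]
      calc _ = ∑ i, ∑ k, ∑ j, (a i * b j * g i j k ((extChartAt 𝓘(ℝ, E) x).symm w)) •
            X k ((extChartAt 𝓘(ℝ, E) x).symm w) :=
            Finset.sum_congr rfl fun i _ => Finset.sum_comm
        _ = _ := Finset.sum_comm
    simp only [SmoothVF.coord, VectorField.mpullback_apply, h7]
    rfl

/-- The splitting theorem, applied to the coordinate expressions of local generators. -/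
theorem SingularFoliation.exists_localModel (F : SingularFoliation E M) (x : M) :
    ∃ (k n : ℕ) (pr : M → EuclideanSpace ℝ (Fin k))
      (Z : EuclideanSpace ℝ (Fin k) → (Fin n → ℝ) →L[ℝ] EuclideanSpace ℝ (Fin k)),
      LocalModel F x pr Z ∧ pr x = 0 ∧ Z 0 = 0 := by
  obtain ⟨m, X, hX, hg⟩ := F.exists_generatedNear x
  have hx := mem_chart_source E x
  obtain ⟨k, f, Z, hf0, hZ0, hZ, hp⟩ := exists_pullsBack_of_involutive
    (SmoothVF.smoothNear_coordFamily hx X) (F.involutive_coordFamily hX hg)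
  have hfφ : (fun w => f (extChartAt 𝓘(ℝ, E) x ((extChartAt 𝓘(ℝ, E) x).symm w))) =ᶠ[𝓝 (extChartAt 𝓘(ℝ, E) x x)] f := by
    filter_upwards [eventually_mem_target hx] with w hw
    rw [(extChartAt 𝓘(ℝ, E) x).right_inv hw]
  refine ⟨k, m, fun z => f (extChartAt 𝓘(ℝ, E) x z), Z, ⟨⟨x, m, X, hx, hX, hg, hp.congr hfφ⟩, ?_⟩,
    hf0, hZ0⟩
  rwa [hf0]

end ModelExistence

/-! ### Models of two foliations with a common pullback -/

section Comparison

variable {E₁ : Type*} [NormedAddCommGroup E₁] [NormedSpace ℝ E₁] [FiniteDimensional ℝ E₁]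
  {M₁ : Type*} [TopologicalSpace M₁] [ChartedSpace E₁ M₁] [IsManifold 𝓘(ℝ, E₁) ∞ M₁]
  {E₂ : Type*} [NormedAddCommGroup E₂] [NormedSpace ℝ E₂] [FiniteDimensional ℝ E₂]
  {M₂ : Type*} [TopologicalSpace M₂] [ChartedSpace E₂ M₂] [IsManifold 𝓘(ℝ, E₂) ∞ M₂]
  {E : Type*} [NormedAddCommGroup E] [NormedSpace ℝ E] [FiniteDimensional ℝ E]
  {Q : Type*} [TopologicalSpace Q] [ChartedSpace E Q] [IsManifold 𝓘(ℝ, E) ∞ Q] [T2Space Q]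
  {K₁ : Type*} [NormedAddCommGroup K₁] [NormedSpace ℝ K₁]
  {W₁ : Type*} [NormedAddCommGroup W₁] [NormedSpace ℝ W₁]
  {K₂ : Type*} [NormedAddCommGroup K₂] [NormedSpace ℝ K₂]
  {W₂ : Type*} [NormedAddCommGroup W₂] [NormedSpace ℝ W₂]
  {F₁ : SingularFoliation E₁ M₁} {F₂ : SingularFoliation E₂ M₂} {π₁ : Q → M₁} {π₂ : Q → M₂} {q : Q}

variable (E) in
/-- Each vector field on `Q` that belongs to the pullback of `F₁` near `q` belongs to the
pullback of `F₂` near `q`. -/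
def PullbackLE (F₁ : SingularFoliation E₁ M₁) (F₂ : SingularFoliation E₂ M₂) (π₁ : Q → M₁)
    (π₂ : Q → M₂) (q : Q) : Prop :=
  ∀ Y : SmoothVF E Q,
    PullbackGerm E π₁ F₁.toSubmodule (fun p => mfderiv 𝓘(ℝ, E) 𝓘(ℝ, E₁) π₁ p (Y p)) q →
    PullbackGerm E π₂ F₂.toSubmodule (fun p => mfderiv 𝓘(ℝ, E) 𝓘(ℝ, E₂) π₂ p (Y p)) q

/-- An equality of global modules is turned into a statement on germs: a field in the first pullback
near `q` agrees near `q` with a global element of that pullback. -/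
lemma PullbackLE.of_le (h : pullbackFoliation (E' := E) π₁ F₁.toSubmodule ≤
    pullbackFoliation (E' := E) π₂ F₂.toSubmodule) (q : Q) : PullbackLE E F₁ F₂ π₁ π₂ q := by
  intro Y hY
  obtain ⟨Y', hY', heq⟩ := hY.exists_mem_pullbackFoliation
  obtain ⟨ξ, hξ, hξ'⟩ := (mem_pullbackFoliation_iff.1 (h hY')).2 q
  refine ⟨ξ, hξ, ?_⟩
  filter_upwards [hξ', heq] with z h1 h2
  rw [← h1, h2]

/-- A germ of a field in the chart is realized on `Q`, and the membership criterion is used in both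
directions. The comparison results for normed spaces then apply to the projections read in a chart
at `q`. -/
lemma PullbackLE.pullbackGermLE {pr₁ : M₁ → K₁} {Z₁ : K₁ → W₁ →L[ℝ] K₁}
    {pr₂ : M₂ → K₂} {Z₂ : K₂ → W₂ →L[ℝ] K₂} (h : PullbackLE E F₁ F₂ π₁ π₂ q)
    (h₁ : LocalModel F₁ (π₁ q) pr₁ Z₁) (h₂ : LocalModel F₂ (π₂ q) pr₂ Z₂)
    (hπ₁ : MSmoothNear E E₁ π₁ q) (hπ₂ : MSmoothNear E E₂ π₂ q) :
    PullbackGermLE (extChartAt 𝓘(ℝ, E) q q)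
      (fun w => pr₁ (π₁ ((extChartAt 𝓘(ℝ, E) q).symm w))) Z₁
      (fun w => pr₂ (π₂ ((extChartAt 𝓘(ℝ, E) q).symm w))) Z₂ := by
  intro v g hv hg hvg
  have hq := mem_chart_source E q
  obtain ⟨Y, -, -, hY⟩ := exists_smoothVF_coord hq hv univ_mem
  have hf₁ : MSmoothNear E K₁ (fun z => pr₁ (π₁ z)) q := h₁.mSmoothNear.comp hπ₁
  have hf₂ : MSmoothNear E K₂ (fun z => pr₂ (π₂ z)) q := h₂.mSmoothNear.comp hπ₂
  have h3 := (h₁.pullbackGerm_iff hπ₁ Y).2 ⟨fun z => g (extChartAt 𝓘(ℝ, E) q z),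
    hg.mcomp (mSmoothNear_extChartAt hq), by
      have h4 := (mSmoothNear_extChartAt hq).continuousAt.eventually (hvg.and hY)
      filter_upwards [h4, eventually_mem_source hq, hf₁.eventually] with z h5 h6 h7
      have h8 := h5.1
      rw [← h5.2, extChartAt_symm_apply_self h6] at h8
      rw [← h8]
      exact mfderiv_eq_fderiv_coord h6 h7.mdifferentiableAt Y⟩
  obtain ⟨g', hg', hg''⟩ := (h₂.pullbackGerm_iff hπ₂ Y).1 (h Y h3)
  refine ⟨fun w => g' ((extChartAt 𝓘(ℝ, E) q).symm w), (hg'.comp_extChartAt_symm hq).smoothNear, ?_⟩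
  filter_upwards [hY, eventually_mem_target hq, (eventually_extChartAt hq).2 hg'',
    (eventually_extChartAt hq).2 hf₂.eventually] with w h5 h6 h7 h8
  have h9 : (extChartAt 𝓘(ℝ, E) q).symm w ∈ (chartAt E q).source := by
    simpa using (extChartAt 𝓘(ℝ, E) q).map_target h6
  rw [← h7, ← h5]
  have h10 := mfderiv_eq_fderiv_coord h9 h8.mdifferentiableAt Y
  rw [(extChartAt 𝓘(ℝ, E) q).right_inv h6] at h10
  exact h10.symm

lemma surjective_fderiv_extChartAt_symm_iff {c x : M₁} (hx : x ∈ (chartAt E₁ c).source)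
    {f : M₁ → K₁} (hf : MDifferentiableAt 𝓘(ℝ, E₁) 𝓘(ℝ, K₁) f x) :
    Function.Surjective (fderiv ℝ (fun w => f ((extChartAt 𝓘(ℝ, E₁) c).symm w))
      (extChartAt 𝓘(ℝ, E₁) c x)) ↔ Function.Surjective (mfderiv 𝓘(ℝ, E₁) 𝓘(ℝ, K₁) f x) := by
  have hs := extChartAt_symm_apply_self hx
  have hf' : MDifferentiableAt 𝓘(ℝ, E₁) 𝓘(ℝ, K₁) f
      ((extChartAt 𝓘(ℝ, E₁) c).symm (extChartAt 𝓘(ℝ, E₁) c x)) := by rwa [hs]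
  have h1 := mfderiv_comp (I'' := 𝓘(ℝ, K₁)) (extChartAt 𝓘(ℝ, E₁) c x) hf'
    (mSmoothNear_extChartAt_symm hx).mdifferentiableAt
  rw [mfderiv_eq_fderiv] at h1
  obtain ⟨e, he⟩ := isInvertible_mfderiv_extChartAt_symm_of_mem (eventually_mem_target hx).self_of_nhds
  have key : ∀ y, y = x → (Function.Surjective (mfderiv 𝓘(ℝ, E₁) 𝓘(ℝ, K₁) f y) ↔
      Function.Surjective (mfderiv 𝓘(ℝ, E₁) 𝓘(ℝ, K₁) f x)) := by rintro y rfl; rfl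
  change Function.Surjective (fderiv ℝ (f ∘ (extChartAt 𝓘(ℝ, E₁) c).symm) _) ↔ _
  rw [h1, ← key _ hs, ← he]
  exact e.surjective.of_comp_iff _

lemma LocalModel.surjective_mfderiv {x : M₁} {pr : M₁ → K₁} {Z : K₁ → W₁ →L[ℝ] K₁}
    (h : LocalModel F₁ x pr Z) : Function.Surjective (mfderiv 𝓘(ℝ, E₁) 𝓘(ℝ, K₁) pr x) := by
  have hpr := h.mSmoothNear
  obtain ⟨c, m, X, hx, hX, hg, hp⟩ := h.exists_chart
  exact (surjective_fderiv_extChartAt_symm_iff hx hpr.mdifferentiableAt).1 hp.surj.self_of_nhds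

lemma LocalModel.surjective_fderiv_comp {pr : M₁ → K₁} {Z : K₁ → W₁ →L[ℝ] K₁}
    (h : LocalModel F₁ (π₁ q) pr Z) (hπ : MSmoothNear E E₁ π₁ q)
    (hs : Function.Surjective (mfderiv 𝓘(ℝ, E) 𝓘(ℝ, E₁) π₁ q)) :
    Function.Surjective (fderiv ℝ (fun w => pr (π₁ ((extChartAt 𝓘(ℝ, E) q).symm w)))
      (extChartAt 𝓘(ℝ, E) q q)) := by
  have hq := mem_chart_source E q
  have hf : MSmoothNear E K₁ (fun z => pr (π₁ z)) q := h.mSmoothNear.comp hπ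
  refine (surjective_fderiv_extChartAt_symm_iff hq hf.mdifferentiableAt).2 ?_
  intro k
  obtain ⟨u, hu⟩ := h.surjective_mfderiv k
  obtain ⟨v, hv⟩ := hs u
  refine ⟨v, ?_⟩
  rw [mfderiv_comp_apply_eq h.mSmoothNear.mdifferentiableAt hπ.mdifferentiableAt, hv, hu]

variable [FiniteDimensional ℝ K₁] [FiniteDimensional ℝ K₂]
  {pr₁ : M₁ → K₁} {Z₁ : K₁ → W₁ →L[ℝ] K₁} {pr₂ : M₂ → K₂} {Z₂ : K₂ → W₂ →L[ℝ] K₂}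

/-- The fibre of the projection of a local model of `F₁` is contained in that of `F₂`. -/
lemma PullbackLE.eventually_eq_zero (h : PullbackLE E F₁ F₂ π₁ π₂ q)
    (h₁ : LocalModel F₁ (π₁ q) pr₁ Z₁) (h₂ : LocalModel F₂ (π₂ q) pr₂ Z₂)
    (hπ₁ : MSmoothNear E E₁ π₁ q) (hπ₂ : MSmoothNear E E₂ π₂ q)
    (hs : Function.Surjective (mfderiv 𝓘(ℝ, E) 𝓘(ℝ, E₁) π₁ q))
    (h₁0 : pr₁ (π₁ q) = 0) (h₂0 : pr₂ (π₂ q) = 0) (hZ₂ : Z₂ 0 = 0) :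
    ∀ᶠ z in 𝓝 q, pr₁ (π₁ z) = 0 → pr₂ (π₂ z) = 0 := by
  have hq := mem_chart_source E q
  have hsm₁ : MSmoothNear E K₁ (fun z => pr₁ (π₁ z)) q := h₁.mSmoothNear.comp hπ₁
  have hsm₂ : MSmoothNear E K₂ (fun z => pr₂ (π₂ z)) q := h₂.mSmoothNear.comp hπ₂
  have hZs := h₂.smoothNear
  rw [h₂0] at hZs
  exact (eventually_extChartAt hq).1 <| (h.pullbackGermLE h₁ h₂ hπ₁ hπ₂).eventually_eq_zero
    (hsm₁.comp_extChartAt_symm hq).smoothNear (h₁.surjective_fderiv_comp hπ₁ hs)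
    (by rw [extChartAt_symm_apply_self hq, h₁0]) (hsm₂.comp_extChartAt_symm hq).smoothNear
    (by rw [extChartAt_symm_apply_self hq, h₂0]) hZs hZ₂

/-- Local models of foliations with the same pullback are related by a local diffeomorphism. -/
lemma PullbackLE.exists_pullsBack [FiniteDimensional ℝ W₁] [FiniteDimensional ℝ W₂]
    (h : PullbackLE E F₁ F₂ π₁ π₂ q) (h' : PullbackLE E F₂ F₁ π₂ π₁ q)
    (h₁ : LocalModel F₁ (π₁ q) pr₁ Z₁) (h₂ : LocalModel F₂ (π₂ q) pr₂ Z₂)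
    (hπ₁ : MSmoothNear E E₁ π₁ q) (hπ₂ : MSmoothNear E E₂ π₂ q)
    (hs₁ : Function.Surjective (mfderiv 𝓘(ℝ, E) 𝓘(ℝ, E₁) π₁ q))
    (hs₂ : Function.Surjective (mfderiv 𝓘(ℝ, E) 𝓘(ℝ, E₂) π₂ q))
    (h₁0 : pr₁ (π₁ q) = 0) (h₂0 : pr₂ (π₂ q) = 0) (hZ₁ : Z₁ 0 = 0) (hZ₂ : Z₂ 0 = 0) :
    ∃ θ : K₁ → K₂, θ 0 = 0 ∧ PullsBack Z₁ 0 θ Z₂ := by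
  have hq := mem_chart_source E q
  have hsm₁ : MSmoothNear E K₁ (fun z => pr₁ (π₁ z)) q := h₁.mSmoothNear.comp hπ₁
  have hsm₂ : MSmoothNear E K₂ (fun z => pr₂ (π₂ z)) q := h₂.mSmoothNear.comp hπ₂
  have hZs₁ := h₁.smoothNear
  have hZs₂ := h₂.smoothNear
  rw [h₁0] at hZs₁
  rw [h₂0] at hZs₂
  exact (h.pullbackGermLE h₁ h₂ hπ₁ hπ₂).exists_pullsBack (h'.pullbackGermLE h₂ h₁ hπ₂ hπ₁)
    (hsm₁.comp_extChartAt_symm hq).smoothNear (h₁.surjective_fderiv_comp hπ₁ hs₁)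
    (by rw [extChartAt_symm_apply_self hq, h₁0]) (hsm₂.comp_extChartAt_symm hq).smoothNear
    (h₂.surjective_fderiv_comp hπ₂ hs₂)
    (by rw [extChartAt_symm_apply_self hq, h₂0]) hZs₁ hZ₁ hZs₂ hZ₂

/-- `F` has the model `Z` at `x`, with `x` projected to the origin, where `Z` vanishes. -/
def SingularFoliation.HasModel (F : SingularFoliation E₁ M₁) (x : M₁) (Z : K₁ → W₁ →L[ℝ] K₁) :
    Prop :=
  Z 0 = 0 ∧ ∃ pr : M₁ → K₁, pr x = 0 ∧ LocalModel F x pr Z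

lemma PullbackLE.hasModel [FiniteDimensional ℝ W₁] [FiniteDimensional ℝ W₂]
    (h : PullbackLE E F₁ F₂ π₁ π₂ q) (h' : PullbackLE E F₂ F₁ π₂ π₁ q)
    (hπ₁ : MSmoothNear E E₁ π₁ q) (hπ₂ : MSmoothNear E E₂ π₂ q)
    (hs₁ : Function.Surjective (mfderiv 𝓘(ℝ, E) 𝓘(ℝ, E₁) π₁ q))
    (hs₂ : Function.Surjective (mfderiv 𝓘(ℝ, E) 𝓘(ℝ, E₂) π₂ q))
    {Z₁ : K₁ → W₁ →L[ℝ] K₁} {Z₂ : K₂ → W₂ →L[ℝ] K₂}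
    (h₁ : F₁.HasModel (π₁ q) Z₁) (h₂ : F₂.HasModel (π₂ q) Z₂) : F₁.HasModel (π₁ q) Z₂ := by
  obtain ⟨hZ₁, pr₁, h₁0, h₁⟩ := h₁
  obtain ⟨hZ₂, pr₂, h₂0, h₂⟩ := h₂
  obtain ⟨θ, hθ, hp⟩ := h.exists_pullsBack h' h₁ h₂ hπ₁ hπ₂ hs₁ hs₂ h₁0 h₂0 hZ₁ hZ₂
  have hZs₂ := h₂.smoothNear
  rw [h₂0] at hZs₂
  refine ⟨hZ₂, fun z => θ (pr₁ z), by simp only [h₁0, hθ], h₁.comp (by rwa [h₁0]) ?_⟩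
  rwa [h₁0, hθ]

end Comparison

end

noncomputable section

/-! ### Charts in which a submersion is linear -/

section LinearizingCharts

variable {E : Type*} [NormedAddCommGroup E] [NormedSpace ℝ E] [FiniteDimensional ℝ E]
  {M : Type*} [TopologicalSpace M] [ChartedSpace E M] [IsManifold 𝓘(ℝ, E) ∞ M]
  {K : Type*} [NormedAddCommGroup K] [NormedSpace ℝ K] [FiniteDimensional ℝ K]

/-- A submersion to a vector space is linear in suitable charts. -/
lemma MSmoothNear.exists_linearizing_chart {f : M → K} {x : M} (hf : MSmoothNear E K f x)
    (hs : Function.Surjective (mfderiv 𝓘(ℝ, E) 𝓘(ℝ, K) f x)) :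
    ∃ e ∈ IsManifold.maximalAtlas 𝓘(ℝ, E) ∞ M, x ∈ e.source ∧ ∃ A : E →L[ℝ] K,
      Function.Surjective A ∧ ∀ z ∈ e.source, f z = A (e z) := by
  have hx := mem_chart_source E x
  obtain ⟨Ψ, A, hΨ, hxΨ, hA, hAf⟩ := (hf.comp_extChartAt_symm hx).smoothNear.exists_straightening
    ((surjective_fderiv_extChartAt_symm_iff hx hf.mdifferentiableAt).2 hs)
  refine ⟨(chartAt E x).trans Ψ, ?_, ?_, A, hA, ?_⟩
  · refine OpenPartialHomeomorph.mem_maximalAtlas_of_contMDiffOn _ ?_ ?_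
    · intro z hz
      rw [OpenPartialHomeomorph.trans_source] at hz
      have h1 : ContMDiffAt 𝓘(ℝ, E) 𝓘(ℝ, E) ∞ (chartAt E x) z :=
        contMDiffAt_of_mem_maximalAtlas (IsManifold.chart_mem_maximalAtlas x) hz.1
      have h2 : ContMDiffAt 𝓘(ℝ, E) 𝓘(ℝ, E) ∞ Ψ (chartAt E x z) := (hΨ.contDiffAt _ hz.2).contMDiffAt
      exact (h2.comp z h1).contMDiffWithinAt
    · intro w hw
      rw [OpenPartialHomeomorph.trans_target] at hw
      have h1 : ContMDiffAt 𝓘(ℝ, E) 𝓘(ℝ, E) ∞ (chartAt E x).symm (Ψ.symm w) :=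
        contMDiffAt_symm_of_mem_maximalAtlas (IsManifold.chart_mem_maximalAtlas x) hw.2
      have h2 : ContMDiffAt 𝓘(ℝ, E) 𝓘(ℝ, E) ∞ Ψ.symm w :=
        (hΨ.contDiffAt_symm _ hw.1).contMDiffAt
      exact (h1.comp w h2).contMDiffWithinAt
  · rw [OpenPartialHomeomorph.trans_source]
    exact ⟨hx, hxΨ⟩
  · intro z hz
    rw [OpenPartialHomeomorph.trans_source] at hz
    have h1 := hAf (chartAt E x z)
    have h2 : (extChartAt 𝓘(ℝ, E) x).symm (chartAt E x z) = z := extChartAt_symm_apply_self hz.1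
    rw [h2] at h1
    exact h1.symm

lemma mdifferentiable_of_mem_maximalAtlas {e : OpenPartialHomeomorph M E}
    (he : e ∈ IsManifold.maximalAtlas 𝓘(ℝ, E) ∞ M) : e.MDifferentiable 𝓘(ℝ, E) 𝓘(ℝ, E) :=
  ⟨(contMDiffOn_of_mem_maximalAtlas he).mdifferentiableOn (by simp),
    (contMDiffOn_symm_of_mem_maximalAtlas he).mdifferentiableOn (by simp)⟩

end LinearizingCharts

/-! ### Plaques lie in leaves -/

section Plaques

variable {E : Type*} [NormedAddCommGroup E] [NormedSpace ℝ E] [FiniteDimensional ℝ E]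
  {M : Type*} [TopologicalSpace M] [ChartedSpace E M] [IsManifold 𝓘(ℝ, E) ∞ M] [T2Space M]
  {K : Type*} [NormedAddCommGroup K] [NormedSpace ℝ K]
  {W : Type*} [NormedAddCommGroup W] [NormedSpace ℝ W]
  {F : SingularFoliation E M} {x : M} {pr : M → K} {Z : K → W →L[ℝ] K}

lemma pullbackGerm_id_iff {Y : SmoothVF E M} :
    PullbackGerm E id F.toSubmodule (fun p => mfderiv 𝓘(ℝ, E) 𝓘(ℝ, E) id p (Y p)) x ↔
      ∃ X ∈ F.toSubmodule, ∀ᶠ z in 𝓝 x, Y z = X z := by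
  constructor
  · rintro ⟨ξ, hξ, h⟩
    obtain ⟨X, hX, h'⟩ := F.exists_mem_of_mem_pullbackSections_id hξ
    refine ⟨X, hX, ?_⟩
    filter_upwards [h] with z hz
    rw [h', ← hz, mfderiv_id]
    rfl
  · rintro ⟨X, hX, h⟩
    refine PullbackGerm.of_sum (m := 1) (X := fun _ => X) (g := fun _ _ => 1) (fun _ => hX)
      (fun _ => .const) ?_
    filter_upwards [h] with z hz
    rw [mfderiv_id]
    simpa using hz

lemma LocalModel.eventuallyEq_mem_iff (h : LocalModel F x pr Z) (Y : SmoothVF E M) :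
    (∃ X ∈ F.toSubmodule, ∀ᶠ z in 𝓝 x, Y z = X z) ↔
      ∃ g : M → W, MSmoothNear E W g x ∧ ∀ᶠ z in 𝓝 x,
        (mfderiv 𝓘(ℝ, E) 𝓘(ℝ, K) pr z (Y z) : K) = Z (pr z) (g z) := by
  rw [← pullbackGerm_id_iff]
  exact h.pullbackGerm_iff (π := id) (MSmoothNear.of_contMDiff contMDiff_id) Y

/-- `tanh` solves `c' = 1 - c²` on all of `ℝ` without leaving `(-1, 1)`. It parametrizes complete
integral curves inside a plaque, so that no completeness theorem for flows is needed. -/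
lemma hasDerivAt_tanh (t : ℝ) : HasDerivAt Real.tanh (1 - Real.tanh t ^ 2) t := by
  have h := (Real.hasDerivAt_sinh t).div (Real.hasDerivAt_cosh t) (Real.cosh_pos t).ne'
  have h1 : Real.tanh = fun t => Real.sinh t / Real.cosh t := funext Real.tanh_eq_sinh_div_cosh
  have h2 : (Real.cosh t * Real.cosh t - Real.sinh t * Real.sinh t) / Real.cosh t ^ 2 =
      1 - Real.tanh t ^ 2 := by
    have := (Real.cosh_pos t).ne'
    rw [Real.tanh_eq_sinh_div_cosh]
    field_simp
  rw [← h2, h1]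
  exact h

variable [FiniteDimensional ℝ K]

/-- The points near `x` in the fibre of the projection of a local model lie in the leaf. -/
lemma LocalModel.eventually_leafSetoid (h : LocalModel F x pr Z) (hx0 : pr x = 0) :
    ∀ᶠ q in 𝓝 x, pr q = 0 → F.leafSetoid x q := by
  have : CompleteSpace E := FiniteDimensional.complete ℝ E
  obtain ⟨e, he, hxe, A, -, hAe⟩ := h.mSmoothNear.exists_linearizing_chart h.surjective_mfderiv
  have hed := mdifferentiable_of_mem_maximalAtlas he
  obtain ⟨D, hDs, hDo, hxD⟩ := eventually_nhds_iff.1 (h.eventually.and (e.open_source.mem_nhds hxe))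
  obtain ⟨χ, hχc, hχD, hχ1⟩ := exists_bump (E := E) (hDo.mem_nhds hxD)
  have hball : ∀ᶠ u in 𝓝 (e x), u ∈ e.target ∧ χ (e.symm u) = 1 :=
    Eventually.and (e.open_target.mem_nhds (e.map_source hxe))
      ((e.continuousAt_symm (e.map_source hxe)).eventually (by rwa [e.left_inv hxe]))
  obtain ⟨r, hr, hball⟩ := Metric.eventually_nhds_iff.1 hball
  -- The curve `e x + (tanh t / τ) d` in the chart starts at `e x` and reaches `e q` at time one.
  set τ := Real.tanh 1 with hτ
  have hτ0 : 0 < τ := by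
    rw [hτ, Real.tanh_eq_sinh_div_cosh]
    exact div_pos (Real.sinh_pos_iff.2 one_pos) (Real.cosh_pos 1)
  -- As `|tanh t| < 1`, the bound `‖d‖ < τ r` keeps the whole curve in the ball of radius `r`, where
  -- the cutoff is `1`.
  have hq : ∀ᶠ q in 𝓝 x, dist (e q) (e x) < τ * r :=
    (e.continuousAt hxe).eventually (Metric.ball_mem_nhds _ (mul_pos hτ0 hr))
  filter_upwards [hq, e.open_source.mem_nhds hxe] with q hq hqe hq0
  by_cases hd : e q - e x = 0
  · rw [e.injOn hqe hxe (sub_eq_zero.1 hd)]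
  set d := e q - e x with hd_def
  obtain ⟨ℓ, hℓ⟩ := SeparatingDual.exists_eq_one (R := ℝ) hd
  have hAd : A d = 0 := by rw [hd_def, map_sub, ← hAe q hqe, ← hAe x hxe, hq0, hx0, sub_zero]
  -- Since `ℓ d = 1`, the functional `ℓ` recovers `tanh t / τ` from the position, so the velocity
  -- `(1 - tanh² t) / τ` in the direction `d` is the value of an autonomous field.
  let V : E → E := fun u => ((1 - (τ * ℓ (u - e x)) ^ 2) / τ) • d
  have hV : ContDiff ℝ ∞ V := by
    have : ContDiff ℝ ∞ fun u : E => ℓ (u - e x) :=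
      ℓ.contDiff.comp (contDiff_id.sub contDiff_const)
    exact ((contDiff_const.sub ((contDiff_const.mul this).pow 2)).div_const τ).smul contDiff_const
  let Y : (z : M) → TangentSpace 𝓘(ℝ, E) z := VectorField.mpullback 𝓘(ℝ, E) 𝓘(ℝ, E) e V
  have hY : ContMDiffOn 𝓘(ℝ, E) 𝓘(ℝ, E).tangent ∞ (fun z => (Y z : TangentBundle 𝓘(ℝ, E) M)) D := by
    intro z hz
    refine (ContMDiffAt.mpullback_vectorField_preimage (n := ∞) (m := ∞) ?_
      (contMDiffAt_of_mem_maximalAtlas he (hDs z hz).2) ⟨hed.mfderiv (hDs z hz).2, rfl⟩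
      (by simp)).contMDiffWithinAt
    refine Bundle.contMDiffAt_totalSpace.2 ⟨contMDiffAt_id, ?_⟩
    have h4 : ContMDiffAt 𝓘(ℝ, E) 𝓘(ℝ, E) ∞ V (e z) := hV.contDiffAt.contMDiffAt
    simpa using h4
  obtain ⟨X, hX⟩ := exists_smoothVF_eq_smul hDo hχD hY
  have hed' : ∀ z ∈ e.source, mfderiv 𝓘(ℝ, E) 𝓘(ℝ, E) e z (Y z) = V (e z) := by
    intro z hz
    have h1 : ((hed.mfderiv hz : TangentSpace 𝓘(ℝ, E) z ≃L[ℝ] TangentSpace 𝓘(ℝ, E) (e z)) :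
      TangentSpace 𝓘(ℝ, E) z →L[ℝ] TangentSpace 𝓘(ℝ, E) (e z)) = mfderiv 𝓘(ℝ, E) 𝓘(ℝ, E) e z := rfl
    change mfderiv 𝓘(ℝ, E) 𝓘(ℝ, E) e z ((mfderiv 𝓘(ℝ, E) 𝓘(ℝ, E) e z).inverse (V (e z))) = _
    rw [← h1, ContinuousLinearMap.inverse_equiv]
    exact (hed.mfderiv hz).apply_symm_apply _
  -- The field is vertical because `A d = 0`. A vertical field belongs to `F` near each point of
  -- `D`, with zero coefficients in the model.
  have hXF : X ∈ F.toSubmodule := by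
    refine F.mem_of_forall_eventuallyEq (hχc.of_isClosed_subset isClosed_closure
      (SmoothVF.supp_subset_of_eq_smul hX)) fun z => ?_
    by_cases hz : z ∈ tsupport χ
    · refine ((hDs z (hχD hz)).1.eventuallyEq_mem_iff X).2 ⟨fun _ => 0, .const, ?_⟩
      filter_upwards [hDo.mem_nhds (hχD hz)] with z' hz'
      have hz'e := (hDs z' hz').2
      rw [map_zero]
      have h1 : pr =ᶠ[𝓝 z'] fun z => A (e z) := by
        filter_upwards [e.open_source.mem_nhds hz'e] with y hy using hAe y hy
      have h2 := mfderiv_comp_apply_eq (M := E) (E := E) (g := A) (π := e) (q := z')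
        (A.contDiff.contMDiff.contMDiffAt.mdifferentiableAt one_ne_zero)
        (hed.mdifferentiableAt hz'e) (X z')
      rw [mfderiv_eq_fderiv, A.fderiv] at h2
      have h3 : (mfderiv 𝓘(ℝ, E) 𝓘(ℝ, E) e z' (X z') : E) = χ z' • V (e z') := by
        rw [hX, map_smul, hed' z' hz'e]
        rfl
      have h4 : A (mfderiv 𝓘(ℝ, E) 𝓘(ℝ, E) e z' (X z') : E) = 0 := by
        rw [h3]; simp only [V, map_smul, hAd, smul_zero]
      exact ((congrArg (fun L : E →L[ℝ] K => L (X z')) h1.mfderiv_eq).trans h2).trans h4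
    · refine ⟨0, Submodule.zero_mem _, ?_⟩
      filter_upwards [(isClosed_tsupport χ).isOpen_compl.mem_nhds hz] with z' hz'
      rw [hX, image_eq_zero_of_notMem_tsupport hz', zero_smul]
      rfl
  refine Relation.EqvGen.rel _ _ ⟨X, hXF, fun t => e.symm (e x + (Real.tanh t / τ) • d), ?_, ?_, ?_⟩
  · intro t
    set u : ℝ → E := fun t => e x + (Real.tanh t / τ) • d with hu
    have hut := hball (y := u t) (by
      have h1 : |Real.tanh t| < 1 := abs_lt.2 ⟨Real.neg_one_lt_tanh t, Real.tanh_lt_one t⟩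
      rw [hu, dist_eq_norm, add_sub_cancel_left, norm_smul, Real.norm_eq_abs, abs_div, abs_of_pos hτ0]
      rw [dist_eq_norm] at hq
      have h2 : |Real.tanh t| / τ ≤ 1 / τ := by gcongr
      calc |Real.tanh t| / τ * ‖d‖ ≤ 1 / τ * ‖d‖ := by gcongr
        _ < 1 / τ * (τ * r) := by gcongr
        _ = r := by field_simp)
    have hud : HasDerivAt u (V (u t)) t := by
      have h1 := ((hasDerivAt_tanh t).div_const τ).smul_const d
      have h2 := h1.const_add (e x)
      convert h2 using 1
      simp only [V, hu, add_sub_cancel_left, map_smul, hℓ, smul_eq_mul, mul_one]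
      congr 2
      field_simp
    have hsymm := (hed.mdifferentiableAt_symm hut.1).hasMFDerivAt
    have hcomp := hsymm.comp t hud.hasFDerivAt.hasMFDerivAt
    have hmem := e.map_target hut.1
    have h5 : X (e.symm (u t)) = mfderiv 𝓘(ℝ, E) 𝓘(ℝ, E) e.symm (u t) (V (u t)) := by
      refine hed.mfderiv_injective hmem ?_
      rw [hX, hut.2, one_smul, hed' _ hmem, e.right_inv hut.1]
      exact (congrArg (fun L : E →L[ℝ] E => L (V (u t))) (hed.comp_symm_deriv hut.1)).symm
    refine hcomp.congr_mfderiv ?_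
    ext
    symm
    change (1 : ℝ) • X (e.symm (u t)) = mfderiv 𝓘(ℝ, E) 𝓘(ℝ, E) e.symm (u t) ((1 : ℝ) • V (u t))
    rw [one_smul, one_smul, h5]
  · simp [e.left_inv hxe]
  · have : Real.tanh 1 / τ = 1 := div_self hτ0.ne'
    simp [this, hd_def, e.left_inv hqe]

end Plaques

end

noncomputable section

/-! ### Sections of submersions and retractions of immersions -/

section SubmersionsImmersions

variable {E : Type*} [NormedAddCommGroup E] [NormedSpace ℝ E]
  {M : Type*} [TopologicalSpace M] [ChartedSpace E M] [IsManifold 𝓘(ℝ, E) ∞ M]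
  {E' : Type*} [NormedAddCommGroup E'] [NormedSpace ℝ E']
  {P : Type*} [TopologicalSpace P] [ChartedSpace E' P] [IsManifold 𝓘(ℝ, E') ∞ P]

lemma mSmoothNear_of_mem_maximalAtlas {e : OpenPartialHomeomorph M E}
    (he : e ∈ IsManifold.maximalAtlas 𝓘(ℝ, E) ∞ M) {x : M} (hx : x ∈ e.source) :
    MSmoothNear E E e x := by
  filter_upwards [e.open_source.mem_nhds hx] with z hz
  exact contMDiffAt_of_mem_maximalAtlas he hz

lemma mSmoothNear_symm_of_mem_maximalAtlas {e : OpenPartialHomeomorph M E}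
    (he : e ∈ IsManifold.maximalAtlas 𝓘(ℝ, E) ∞ M) {w : E} (hw : w ∈ e.target) :
    MSmoothNear E E e.symm w := by
  filter_upwards [e.open_target.mem_nhds hw] with z hz
  exact contMDiffAt_symm_of_mem_maximalAtlas he hz

lemma Manifold.IsSubmersionAt.exists_section {π : P → M} {p : P}
    (h : Manifold.IsSubmersionAt 𝓘(ℝ, E') 𝓘(ℝ, E) ∞ π p) :
    ∃ σ : M → P, MSmoothNear E E' σ (π p) ∧ σ (π p) = p ∧ ∀ᶠ y in 𝓝 (π p), π (σ y) = y := by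
  set e₁ := h.domChart
  set e₂ := h.codChart
  have hp₁ : p ∈ e₁.source := h.mem_domChart_source
  have hp₂ : π p ∈ e₂.source := h.mem_codChart_source
  have hw : ∀ w ∈ e₁.target, e₂ (π (e₁.symm w)) = (h.equiv w).1 := fun w hw =>
    h.writtenInCharts (by simpa using hw)
  -- In the charts the submersion is a projection; the section freezes the complementary component
  -- at its value at `p`.
  let j : E → E' := fun u => h.equiv.symm (u, (h.equiv (e₁ p)).2)
  have hj : ContDiff ℝ ∞ j := h.equiv.symm.contDiff.comp (contDiff_id.prodMk contDiff_const)
  have hj0 : j (e₂ (π p)) = e₁ p := by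
    have h1 := hw (e₁ p) (e₁.map_source hp₁)
    rw [e₁.left_inv hp₁] at h1
    simp only [j, h1, Prod.mk.eta, ContinuousLinearEquiv.symm_apply_apply]
  have he₂ := mSmoothNear_of_mem_maximalAtlas h.codChart_mem_maximalAtlas hp₂
  have hjs : MSmoothNear E E' (fun y => j (e₂ y)) (π p) :=
    SmoothNear.mcomp (SmoothNear.of_contDiff hj) he₂
  have ht : j (e₂ (π p)) ∈ e₁.target := by rw [hj0]; exact e₁.map_source hp₁
  refine ⟨fun y => e₁.symm (j (e₂ y)), ?_, ?_, ?_⟩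
  · exact MSmoothNear.comp
      (mSmoothNear_symm_of_mem_maximalAtlas h.domChart_mem_maximalAtlas ht) hjs
  · change e₁.symm (j (e₂ (π p))) = p
    rw [hj0, e₁.left_inv hp₁]
  · filter_upwards [e₂.open_source.mem_nhds hp₂,
      hjs.continuousAt.eventually (e₁.open_target.mem_nhds ht)] with y h1 h2
    refine e₂.injOn (h.source_subset_preimage_source (e₁.map_target h2)) h1 ?_
    rw [hw _ h2]
    simp only [j, ContinuousLinearEquiv.apply_symm_apply]

lemma Manifold.IsImmersionAt.exists_retraction {ι : P → M} {p : P}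
    (h : Manifold.IsImmersionAt 𝓘(ℝ, E') 𝓘(ℝ, E) ∞ ι p) :
    ∃ ρ : M → P, MSmoothNear E E' ρ (ι p) ∧ ∀ᶠ z in 𝓝 p, ρ (ι z) = z := by
  set e₁ := h.domChart
  set e₂ := h.codChart
  have hp₁ : p ∈ e₁.source := h.mem_domChart_source
  have hp₂ : ι p ∈ e₂.source := h.mem_codChart_source
  have hw : ∀ w ∈ e₁.target, e₂ (ι (e₁.symm w)) = h.equiv (w, 0) := fun w hw =>
    h.writtenInCharts (by simpa using hw)
  let j : E → E' := fun u => (h.equiv.symm u).1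
  have hj : ContDiff ℝ ∞ j := contDiff_fst.comp h.equiv.symm.contDiff
  have hj1 : ∀ z ∈ e₁.source, j (e₂ (ι z)) = e₁ z := fun z hz => by
    have h1 := hw (e₁ z) (e₁.map_source hz)
    rw [e₁.left_inv hz] at h1
    simp only [j, h1, ContinuousLinearEquiv.symm_apply_apply]
  have he₂ := mSmoothNear_of_mem_maximalAtlas h.codChart_mem_maximalAtlas hp₂
  have hjs : MSmoothNear E E' (fun y => j (e₂ y)) (ι p) :=
    SmoothNear.mcomp (SmoothNear.of_contDiff hj) he₂
  have ht : j (e₂ (ι p)) ∈ e₁.target := by rw [hj1 p hp₁]; exact e₁.map_source hp₁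
  refine ⟨fun y => e₁.symm (j (e₂ y)), ?_, ?_⟩
  · exact MSmoothNear.comp
      (mSmoothNear_symm_of_mem_maximalAtlas h.domChart_mem_maximalAtlas ht) hjs
  · filter_upwards [e₁.open_source.mem_nhds hp₁] with z hz
    rw [hj1 z hz, e₁.left_inv hz]

lemma Manifold.IsImmersionAt.mfderiv_injective {ι : P → M} {p : P}
    (h : Manifold.IsImmersionAt 𝓘(ℝ, E') 𝓘(ℝ, E) ∞ ι p) :
    Function.Injective (mfderiv 𝓘(ℝ, E') 𝓘(ℝ, E) ι p) := by
  obtain ⟨ρ, hρ, hρι⟩ := h.exists_retraction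
  have h1 := mfderiv_comp p hρ.mdifferentiableAt (h.contMDiffAt.mdifferentiableAt (by simp))
  have h2 : ρ ∘ ι =ᶠ[𝓝 p] id := hρι
  rw [h2.mfderiv_eq, mfderiv_id] at h1
  have hinj : Function.LeftInverse (mfderiv 𝓘(ℝ, E) 𝓘(ℝ, E') ρ (ι p))
      (mfderiv 𝓘(ℝ, E') 𝓘(ℝ, E) ι p) := fun v =>
    (congrArg (fun L : E' →L[ℝ] E' => L v) h1).symm
  exact hinj.injective

lemma Manifold.IsSubmersionAt.mfderiv_surjective {π : P → M} {p : P}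
    (h : Manifold.IsSubmersionAt 𝓘(ℝ, E') 𝓘(ℝ, E) ∞ π p) :
    Function.Surjective (mfderiv 𝓘(ℝ, E') 𝓘(ℝ, E) π p) := by
  obtain ⟨σ, hσ, hσp, hπσ⟩ := h.exists_section
  have hπ : MDifferentiableAt 𝓘(ℝ, E') 𝓘(ℝ, E) π (σ (π p)) := by
    rw [hσp]; exact h.contMDiffAt.mdifferentiableAt (by simp)
  have h1 := mfderiv_comp (π p) hπ hσ.mdifferentiableAt
  have h2 : π ∘ σ =ᶠ[𝓝 (π p)] id := hπσ
  rw [h2.mfderiv_eq, mfderiv_id] at h1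
  have key : ∀ q, q = p → Function.Surjective (mfderiv 𝓘(ℝ, E') 𝓘(ℝ, E) π q) →
      Function.Surjective (mfderiv 𝓘(ℝ, E') 𝓘(ℝ, E) π p) := by rintro q rfl; exact id
  refine key _ hσp fun v => ?_
  exact ⟨mfderiv 𝓘(ℝ, E) 𝓘(ℝ, E') σ (π p) v,
    (congrArg (fun L : E →L[ℝ] E => L v) h1).symm⟩

lemma Manifold.IsSubmersion.isOpenMap {π : P → M}
    (h : Manifold.IsSubmersion 𝓘(ℝ, E') 𝓘(ℝ, E) ∞ π) : IsOpenMap π := by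
  rw [isOpenMap_iff_nhds_le]
  intro p
  obtain ⟨σ, hσ, hσp, hπσ⟩ := (h.isSubmersionAt p).exists_section
  intro s hs
  have h1 : ∀ᶠ y in 𝓝 (π p), σ y ∈ π ⁻¹' s :=
    hσ.continuousAt.eventually (by rw [hσp]; exact hs)
  filter_upwards [h1, hπσ] with y h2 h3
  rwa [Set.mem_preimage, h3] at h2

end SubmersionsImmersions

/-! ### Constancy of models along leaves -/

section Leaves

variable {E : Type*} [NormedAddCommGroup E] [NormedSpace ℝ E] [FiniteDimensional ℝ E]
  {M : Type*} [TopologicalSpace M] [ChartedSpace E M] [IsManifold 𝓘(ℝ, E) ∞ M] [T2Space M]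
  {K : Type*} [NormedAddCommGroup K] [NormedSpace ℝ K]
  {W : Type*} [NormedAddCommGroup W] [NormedSpace ℝ W]
  {F : SingularFoliation E M}

/-- Integral curves of elements of `F` stay in the fibre of the projection of a local model. -/
lemma LocalModel.eventually_eq_zero_of_isMIntegralCurve [FiniteDimensional ℝ K]
    {pr : M → K} {Z : K → W →L[ℝ] K}
    {γ : ℝ → M} {t₀ : ℝ} (h : LocalModel F (γ t₀) pr Z) (hZ0 : Z 0 = 0) (h0 : pr (γ t₀) = 0)
    {X : SmoothVF E M} (hX : X ∈ F.toSubmodule) (hγ : IsMIntegralCurve (I := 𝓘(ℝ, E)) γ X) :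
    ∀ᶠ t in 𝓝 t₀, pr (γ t) = 0 := by
  obtain ⟨g, hg, hgX⟩ := (h.eventuallyEq_mem_iff X).1 ⟨X, hX, Eventually.of_forall fun _ => rfl⟩
  have hγc : ContinuousAt γ t₀ := hγ.continuous.continuousAt
  have hZs := h.smoothNear
  rw [h0] at hZs
  obtain ⟨C, hC0, hC⟩ := hZs.exists_norm_le hZ0
  have hprc : Tendsto (fun t => pr (γ t)) (𝓝 t₀) (𝓝 0) := by
    have := h.mSmoothNear.continuousAt.tendsto.comp hγc
    rwa [h0] at this
  have hgb : ∀ᶠ t in 𝓝 t₀, ‖g (γ t)‖ < ‖g (γ t₀)‖ + 1 :=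
    ((hg.continuousAt.norm.tendsto.comp hγc).eventually (gt_mem_nhds (lt_add_one _)))
  have hall := hgb.and ((hprc.eventually hC).and ((hγc.eventually hgX).and
    (hγc.eventually h.mSmoothNear.eventually)))
  obtain ⟨r, hr, hall⟩ := Metric.eventually_nhds_iff.1 hall
  have hmem : ∀ s ∈ Set.Ioo (-r) r, dist (t₀ + s) t₀ < r := fun s hs => by
    rw [Real.dist_eq, add_sub_cancel_left]; exact abs_lt.2 hs
  have key := eq_zero_of_norm_deriv_le (c := fun s => pr (γ (t₀ + s)))
    (c' := fun s => Z (pr (γ (t₀ + s))) (g (γ (t₀ + s)))) (C := C * (‖g (γ t₀)‖ + 1)) (r := r)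
    (fun s hs => ?_) (fun s hs => ?_) (by simpa using h0)
  · rw [Metric.eventually_nhds_iff]
    refine ⟨r, hr, fun t ht => ?_⟩
    have := key (t - t₀) (by rw [Real.dist_eq] at ht; exact abs_lt.1 ht)
    simpa using this
  · obtain ⟨-, -, h1, h2⟩ := hall (hmem s hs)
    have h3 := h2.mdifferentiableAt.hasMFDerivAt.comp (t₀ + s) (hγ (t₀ + s))
    have h4 : HasFDerivAt (fun t => pr (γ t)) ((1 : ℝ →L[ℝ] ℝ).smulRight
        (Z (pr (γ (t₀ + s))) (g (γ (t₀ + s))))) (t₀ + s) :=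
      hasMFDerivAt_iff_hasFDerivAt.1 (h3.congr_mfderiv (by
        ext
        change mfderiv 𝓘(ℝ, E) 𝓘(ℝ, K) pr (γ (t₀ + s)) ((1 : ℝ) • X (γ (t₀ + s))) =
          (1 : ℝ) • Z (pr (γ (t₀ + s))) (g (γ (t₀ + s)))
        rw [one_smul, one_smul, h1]))
    have h5 : HasDerivAt (fun t => pr (γ t)) (Z (pr (γ (t₀ + s))) (g (γ (t₀ + s)))) (t₀ + s) := by
      simpa using h4.hasDerivAt
    exact h5.comp_const_add t₀ s
  · obtain ⟨h1, h2, -⟩ := hall (hmem s hs)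
    calc ‖Z (pr (γ (t₀ + s))) (g (γ (t₀ + s)))‖
        ≤ ‖Z (pr (γ (t₀ + s)))‖ * ‖g (γ (t₀ + s))‖ := ContinuousLinearMap.le_opNorm _ _
      _ ≤ (C * ‖pr (γ (t₀ + s))‖) * (‖g (γ t₀)‖ + 1) := by gcongr
      _ = C * (‖g (γ t₀)‖ + 1) * ‖pr (γ (t₀ + s))‖ := by ring

lemma LocalModel.hasModel {x : M} {pr : M → K} {Z : K → W →L[ℝ] K} (h : LocalModel F x pr Z)
    (hZ0 : Z 0 = 0) (h0 : pr x = 0) : F.HasModel x Z := ⟨hZ0, pr, h0, h⟩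

/-- If two points have one model in common, then they have the same models. -/
lemma SingularFoliation.HasModel.trans {E' : Type*} [NormedAddCommGroup E'] [NormedSpace ℝ E']
    [FiniteDimensional ℝ E']
    {M' : Type*} [TopologicalSpace M'] [ChartedSpace E' M'] [IsManifold 𝓘(ℝ, E') ∞ M']
    {F' : SingularFoliation E' M'}
    {K' : Type*} [NormedAddCommGroup K'] [NormedSpace ℝ K'] [FiniteDimensional ℝ K]
    [FiniteDimensional ℝ K'] [FiniteDimensional ℝ W]
    {W' : Type*} [NormedAddCommGroup W'] [NormedSpace ℝ W'] [FiniteDimensional ℝ W']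
    {x : M} {y : M'} {Z : K → W →L[ℝ] K} {Z' : K' → W' →L[ℝ] K'}
    (hy : F'.HasModel y Z) (hx : F.HasModel x Z) (hx' : F.HasModel x Z') : F'.HasModel y Z' := by
  obtain ⟨hZ, pr, h0, h⟩ := hx
  obtain ⟨hZ', pr', h0', h'⟩ := hx'
  obtain ⟨-, pr₁, h₁0, h₁⟩ := hy
  have hid : Function.Surjective (mfderiv 𝓘(ℝ, E) 𝓘(ℝ, E) (id : M → M) x) := by
    rw [mfderiv_id]; exact Function.surjective_id
  -- The two models at `x` are compared through the identity of `M`; the resulting `θ` only concerns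
  -- the transverse spaces, so it can be applied at `y`.
  obtain ⟨θ, hθ0, hθ⟩ := PullbackLE.exists_pullsBack (F₁ := F) (F₂ := F) (π₁ := id) (π₂ := id)
    (q := x) (E := E) (fun _ h => h) (fun _ h => h) h h' (.of_contMDiff contMDiff_id)
    (.of_contMDiff contMDiff_id) hid hid h0 h0' hZ hZ'
  have hZs := h'.smoothNear
  rw [h0'] at hZs
  refine ⟨hZ', fun z => θ (pr₁ z), by simp only [h₁0, hθ0], h₁.comp (by rwa [h₁0]) ?_⟩
  rwa [h₁0, hθ0]

/-- All points of a leaf have the same models. -/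
lemma SingularFoliation.HasModel.of_leafSetoid [FiniteDimensional ℝ K] [FiniteDimensional ℝ W]
    {x y : M} {Z : K → W →L[ℝ] K} (hxy : F.leafSetoid x y) (hx : F.HasModel x Z) :
    F.HasModel y Z := by
  suffices h : F.HasModel x Z ↔ F.HasModel y Z from h.1 hx
  clear hx
  induction hxy with
  | rel x y h =>
    obtain ⟨X, hX, γ, hγ, rfl, rfl⟩ := h
    -- For `t` near `t₀` the point `γ t` lies in the zero fibre of a model at `γ t₀`, which is
    -- therefore a model at `γ t` too. One common model makes all models common.
    have hloc : IsLocallyConstant fun t => F.HasModel (γ t) Z := by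
      rw [IsLocallyConstant.iff_eventually_eq]
      intro t₀
      obtain ⟨k, n, pr, Z₀, hm, h0, hZ0⟩ := F.exists_localModel (γ t₀)
      have hc : ContinuousAt γ t₀ := hγ.continuous.continuousAt
      filter_upwards [hm.eventually_eq_zero_of_isMIntegralCurve hZ0 h0 hX hγ,
        hc.eventually hm.eventually] with t h1 h2
      exact propext ⟨fun h => (hm.hasModel hZ0 h0).trans (h2.hasModel hZ0 h1) h,
        fun h => (h2.hasModel hZ0 h1).trans (hm.hasModel hZ0 h0) h⟩
    exact iff_of_eq (hloc.apply_eq_of_preconnectedSpace 0 1)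
  | refl x => rfl
  | symm x y _ h => exact h.symm
  | trans x y z _ _ h₁ h₂ => exact h₁.trans h₂

end Leaves

end

noncomputable section

/-! ### The correspondence of leaves under a Morita equivalence -/

section LeafCorrespondence

variable {E₁ : Type*} [NormedAddCommGroup E₁] [NormedSpace ℝ E₁] [FiniteDimensional ℝ E₁]
  {M₁ : Type*} [TopologicalSpace M₁] [ChartedSpace E₁ M₁] [IsManifold 𝓘(ℝ, E₁) ∞ M₁] [T2Space M₁]
  {E₂ : Type*} [NormedAddCommGroup E₂] [NormedSpace ℝ E₂] [FiniteDimensional ℝ E₂]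
  {M₂ : Type*} [TopologicalSpace M₂] [ChartedSpace E₂ M₂] [IsManifold 𝓘(ℝ, E₂) ∞ M₂] [T2Space M₂]
  {E : Type*} [NormedAddCommGroup E] [NormedSpace ℝ E] [FiniteDimensional ℝ E]
  {P : Type*} [TopologicalSpace P] [ChartedSpace E P] [IsManifold 𝓘(ℝ, E) ∞ P] [T2Space P]
  {F₁ : SingularFoliation E₁ M₁} {F₂ : SingularFoliation E₂ M₂} {π₁ : P → M₁} {π₂ : P → M₂}

namespace IsHausdorffMoritaEquivalence

lemma symm (h : IsHausdorffMoritaEquivalence (E₂ := E) F₁ F₂ π₁ π₂) :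
    IsHausdorffMoritaEquivalence (E₂ := E) F₂ F₁ π₂ π₁ :=
  ⟨h.right, h.left, h.pullback_eq.symm⟩

lemma mSmoothNear_left (h : IsHausdorffMoritaEquivalence (E₂ := E) F₁ F₂ π₁ π₂) (p : P) :
    MSmoothNear E E₁ π₁ p := .of_contMDiff h.left.isSubmersion.contMDiff

lemma surjective_mfderiv_left (h : IsHausdorffMoritaEquivalence (E₂ := E) F₁ F₂ π₁ π₂) (p : P) :
    Function.Surjective (mfderiv 𝓘(ℝ, E) 𝓘(ℝ, E₁) π₁ p) :=
  (h.left.isSubmersion.isSubmersionAt p).mfderiv_surjective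

lemma pullbackLE (h : IsHausdorffMoritaEquivalence (E₂ := E) F₁ F₂ π₁ π₂) (p : P) :
    PullbackLE E F₁ F₂ π₁ π₂ p := .of_le h.pullback_eq.le p

/-- Near `p` the zero fibre of the first model, seen on `P`, is contained in that of a model at `π₂
p`, and points of the latter project into one leaf. -/
lemma eventually_leafSetoid {K W : Type*} [NormedAddCommGroup K] [NormedSpace ℝ K]
    [NormedAddCommGroup W] [NormedSpace ℝ W] [FiniteDimensional ℝ K]
    (h : IsHausdorffMoritaEquivalence (E₂ := E) F₁ F₂ π₁ π₂) {p : P} {pr : M₁ → K}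
    {Z : K → W →L[ℝ] K} (hm : LocalModel F₁ (π₁ p) pr Z) (h0 : pr (π₁ p) = 0) :
    ∀ᶠ q in 𝓝 p, pr (π₁ q) = 0 → F₂.leafSetoid (π₂ p) (π₂ q) := by
  obtain ⟨k, n, pr₂, Z₂, hm₂, h₂0, hZ₂⟩ := F₂.exists_localModel (π₂ p)
  filter_upwards [(h.pullbackLE p).eventually_eq_zero hm hm₂ (h.mSmoothNear_left p)
    (h.symm.mSmoothNear_left p) (h.surjective_mfderiv_left p) h0 h₂0 hZ₂,
    (h.symm.mSmoothNear_left p).continuousAt.eventually (hm₂.eventually_leafSetoid h₂0)]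
    with q h1 h2 h3
  exact h2 (h1 h3)

/-- Locally on a fibre of `π₁` the second projection stays in one leaf; connectedness of the fibre
makes this global. Connected fibres enter the proof only here. -/
lemma leafSetoid_of_eq (h : IsHausdorffMoritaEquivalence (E₂ := E) F₁ F₂ π₁ π₂) {p q : P}
    (hpq : π₁ p = π₁ q) : F₂.leafSetoid (π₂ p) (π₂ q) := by
  refine (h.left.isConnected_fibre (π₁ q)).isPreconnected.induction₂
    (fun p q => F₂.leafSetoid (π₂ p) (π₂ q)) (fun p hp => ?_)
    (fun _ _ _ _ _ _ h₁ h₂ => F₂.leafSetoid.trans h₁ h₂)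
    (fun _ _ _ _ h => F₂.leafSetoid.symm h) hpq rfl
  obtain ⟨k, n, pr, Z, hm, h0, -⟩ := F₁.exists_localModel (π₁ p)
  have h1 : ∀ᶠ q in 𝓝[π₁ ⁻¹' {π₁ q}] p, pr (π₁ q) = 0 → F₂.leafSetoid (π₂ p) (π₂ q) :=
    mem_nhdsWithin_of_mem_nhds (h.eventually_leafSetoid hm h0)
  filter_upwards [h1, self_mem_nhdsWithin] with q' h2 h3
  refine h2 ?_
  have h4 : π₁ q' = π₁ p := by rw [h3, hp]
  rw [h4, h0]

lemma leafSetoid_of_leafSetoid (h : IsHausdorffMoritaEquivalence (E₂ := E) F₁ F₂ π₁ π₂) {p q : P}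
    (hpq : F₁.leafSetoid (π₁ p) (π₁ q)) : F₂.leafSetoid (π₂ p) (π₂ q) := by
  suffices key : ∀ a b, F₁.leafSetoid a b → ∀ p q, π₁ p = a → π₁ q = b →
      F₂.leafSetoid (π₂ p) (π₂ q) from key _ _ hpq p q rfl rfl
  intro a b hab
  induction hab with
  | rel x y hxy =>
    obtain ⟨X, hX, γ, hγ, rfl, rfl⟩ := hxy
    -- The curve is not lifted to `P`. Nearby points of it are lifted one at a time, by openness of
    -- `π₁`, and connectedness of `ℝ` chains the local relations; the choice of lifts is immaterial
    -- by the case of a single fibre.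
    refine isPreconnected_univ.induction₂ (fun t s => ∀ p q, π₁ p = γ t → π₁ q = γ s →
      F₂.leafSetoid (π₂ p) (π₂ q)) (fun t _ => ?_) ?_ ?_ (Set.mem_univ (0 : ℝ)) (Set.mem_univ 1)
    · rw [nhdsWithin_univ]
      obtain ⟨p, hp⟩ := h.left.surjective (γ t)
      obtain ⟨k, n, pr, Z, hm, h0, hZ0⟩ := F₁.exists_localModel (γ t)
      have h1 := h.eventually_leafSetoid (p := p) (pr := pr) (Z := Z) (by rwa [hp]) (by rwa [hp])
      have h2 := h.left.isSubmersion.isOpenMap.image_mem_nhds h1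
      rw [hp] at h2
      filter_upwards [hγ.continuous.continuousAt.eventually h2,
        hm.eventually_eq_zero_of_isMIntegralCurve hZ0 h0 hX hγ] with s h3 h4 p' q' hp' hq'
      obtain ⟨q, hq, hqs⟩ := h3
      refine F₂.leafSetoid.trans (h.leafSetoid_of_eq (hp'.trans hp.symm)) (F₂.leafSetoid.trans
        (hq (by rwa [hqs])) (h.leafSetoid_of_eq (hqs.trans hq'.symm)))
    · intro t s u _ _ _ h₁ h₂ p q hp hq
      obtain ⟨r, hr⟩ := h.left.surjective (γ s)
      exact F₂.leafSetoid.trans (h₁ p r hp hr) (h₂ r q hr hq)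
    · intro t s _ _ h₁ p q hp hq
      exact F₂.leafSetoid.symm (h₁ q p hq hp)
  | refl x =>
    intro p q hp hq
    exact h.leafSetoid_of_eq (hp.trans hq.symm)
  | symm x y _ ih =>
    intro p q hp hq
    exact F₂.leafSetoid.symm (ih q p hq hp)
  | trans x y z _ _ ih₁ ih₂ =>
    intro p q hp hq
    obtain ⟨r, hr⟩ := h.left.surjective y
    exact F₂.leafSetoid.trans (ih₁ p r hp hr) (ih₂ r q hr hq)

lemma leafClass_eq_iff (h : IsHausdorffMoritaEquivalence (E₂ := E) F₁ F₂ π₁ π₂) (p q : P) :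
    F₁.leafClass (π₁ p) = F₁.leafClass (π₁ q) ↔ F₂.leafClass (π₂ p) = F₂.leafClass (π₂ q) := by
  simp only [SingularFoliation.leafClass, Quotient.eq]
  exact ⟨h.leafSetoid_of_leafSetoid, h.symm.leafSetoid_of_leafSetoid⟩

lemma isQuotientMap_leafClass (h : IsHausdorffMoritaEquivalence (E₂ := E) F₁ F₂ π₁ π₂) :
    Topology.IsQuotientMap fun p => F₁.leafClass (π₁ p) := by
  have h1 : Topology.IsQuotientMap π₁ := h.left.isSubmersion.isOpenMap.isQuotientMap
    h.left.isSubmersion.contMDiff.continuous h.left.surjective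
  exact isQuotientMap_quotient_mk'.comp h1

/-- Both leaf spaces are topological quotients of `P`, and by `leafClass_eq_iff` the two quotient
maps identify the same points. -/
theorem exists_homeomorph (h : IsHausdorffMoritaEquivalence (E₂ := E) F₁ F₂ π₁ π₂) :
    ∃ Φ : F₁.LeafSpace ≃ₜ F₂.LeafSpace,
      ∀ p, Φ (F₁.leafClass (π₁ p)) = F₂.leafClass (π₂ p) := by
  have h1 := h.isQuotientMap_leafClass
  have h2 := h.symm.isQuotientMap_leafClass
  let f₁ : C(P, F₁.LeafSpace) := ⟨fun p => F₁.leafClass (π₁ p), h1.continuous⟩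
  let f₂ : C(P, F₂.LeafSpace) := ⟨fun p => F₂.leafClass (π₂ p), h2.continuous⟩
  have h12 : Function.FactorsThrough f₂ f₁ := fun p q hpq => (h.leafClass_eq_iff p q).1 hpq
  have h21 : Function.FactorsThrough f₁ f₂ := fun p q hpq => (h.leafClass_eq_iff p q).2 hpq
  have e12 : ∀ p, Topology.IsQuotientMap.lift (f := f₁) h1 f₂ h12 (f₁ p) = f₂ p := fun p =>
    DFunLike.congr_fun (Topology.IsQuotientMap.lift_comp (f := f₁) h1 f₂ h12) p
  have e21 : ∀ p, Topology.IsQuotientMap.lift (f := f₂) h2 f₁ h21 (f₂ p) = f₁ p := fun p =>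
    DFunLike.congr_fun (Topology.IsQuotientMap.lift_comp (f := f₂) h2 f₁ h21) p
  refine ⟨⟨⟨Topology.IsQuotientMap.lift (f := f₁) h1 f₂ h12,
    Topology.IsQuotientMap.lift (f := f₂) h2 f₁ h21, fun a => ?_, fun a => ?_⟩,
    ContinuousMap.continuous _, ContinuousMap.continuous _⟩, e12⟩
  · obtain ⟨p, rfl⟩ := h1.surjective a
    exact (congrArg _ (e12 p)).trans (e21 p)
  · obtain ⟨p, rfl⟩ := h2.surjective a
    exact (congrArg _ (e21 p)).trans (e12 p)

/-- Points in corresponding leaves have the same transverse models. -/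
lemma exists_hasModel (h : IsHausdorffMoritaEquivalence (E₂ := E) F₁ F₂ π₁ π₂) {p : P} {y : M₂}
    (hy : F₂.leafSetoid (π₂ p) y) :
    ∃ (k n : ℕ) (Z : EuclideanSpace ℝ (Fin k) → (Fin n → ℝ) →L[ℝ] EuclideanSpace ℝ (Fin k)),
      F₁.HasModel (π₁ p) Z ∧ F₂.HasModel y Z := by
  obtain ⟨k, n, pr, Z, hm, h0, hZ⟩ := F₁.exists_localModel (π₁ p)
  obtain ⟨k', n', pr', Z', hm', h0', hZ'⟩ := F₂.exists_localModel (π₂ p)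
  have h1 : F₁.HasModel (π₁ p) Z := ⟨hZ, pr, h0, hm⟩
  have h2 : F₂.HasModel (π₂ p) Z' := ⟨hZ', pr', h0', hm'⟩
  refine ⟨k, n, Z, h1, SingularFoliation.HasModel.of_leafSetoid hy ?_⟩
  exact (h.symm.pullbackLE p).hasModel (h.pullbackLE p) (h.symm.mSmoothNear_left p)
    (h.mSmoothNear_left p) (h.symm.surjective_mfderiv_left p) (h.surjective_mfderiv_left p) h2 h1

end IsHausdorffMoritaEquivalence

end LeafCorrespondence

end

noncomputable section

/-! ### The isotropy Lie algebra and the codimension in terms of a model -/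

section Isotropy

lemma SmoothNear.exists_rightInverse {E K : Type*} [NormedAddCommGroup E] [NormedSpace ℝ E]
    [FiniteDimensional ℝ E]
    [NormedAddCommGroup K] [NormedSpace ℝ K] [FiniteDimensional ℝ K] {f : E → K} {x : E}
    (hf : SmoothNear f x) (hs : Function.Surjective (_root_.fderiv ℝ f x)) :
    ∃ R : E → K →L[ℝ] E, SmoothNear R x ∧ ∀ᶠ z in 𝓝 x, ∀ k, _root_.fderiv ℝ f z (R z k) = k := by
  have : CompleteSpace K := FiniteDimensional.complete ℝ K
  obtain ⟨R, hR⟩ := ContinuousLinearMap.exists_comp_eq_id_of_surjective hs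
  have h1 : SmoothNear (fun z => _root_.fderiv ℝ f z ∘L R) x := hf.fderiv.clm_comp (.const R)
  have h2 : (_root_.fderiv ℝ f x ∘L R).IsInvertible := by
    have : _root_.fderiv ℝ f x ∘L R = ContinuousLinearMap.id ℝ K := ContinuousLinearMap.ext hR
    rw [this]
    exact ⟨ContinuousLinearEquiv.refl ℝ K, rfl⟩
  refine ⟨fun z => R ∘L (_root_.fderiv ℝ f z ∘L R).inverse,
    (SmoothNear.const R).clm_comp (h1.inverse h2), ?_⟩
  filter_upwards [h1.continuousAt.eventually h2.eventually] with z hz k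
  exact hz.self_apply_inverse k

/-- Differentiating both relations produces the terms of the bracket and second derivatives of `f`,
which cancel by symmetry. -/
lemma fderiv_lieBracket_of_related {E K : Type*} [NormedAddCommGroup E] [NormedSpace ℝ E]
    [NormedAddCommGroup K] [NormedSpace ℝ K] {f : E → K} {V V' : E → E} {ξ ξ' : K → K} {x : E}
    (hf : SmoothNear f x) (hV : DifferentiableAt ℝ V x) (hV' : DifferentiableAt ℝ V' x)
    (hξ : DifferentiableAt ℝ ξ (f x)) (hξ' : DifferentiableAt ℝ ξ' (f x))
    (h : ∀ᶠ z in 𝓝 x, fderiv ℝ f z (V z) = ξ (f z))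
    (h' : ∀ᶠ z in 𝓝 x, fderiv ℝ f z (V' z) = ξ' (f z)) :
    fderiv ℝ f x (VectorField.lieBracket ℝ V V' x) = VectorField.lieBracket ℝ ξ ξ' (f x) := by
  have hsymm : IsSymmSndFDerivAt ℝ f x := hf.contDiffAt.isSymmSndFDerivAt
    (by simpa using SmoothVF.two_le_infty)
  have hd := hf.fderiv.differentiableAt.hasFDerivAt
  have key : ∀ {V : E → E} {ξ : K → K}, DifferentiableAt ℝ V x → DifferentiableAt ℝ ξ (f x) →
      (∀ᶠ z in 𝓝 x, fderiv ℝ f z (V z) = ξ (f z)) → ∀ u,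
      fderiv ℝ f x (fderiv ℝ V x u) + fderiv ℝ (fderiv ℝ f) x u (V x) =
        fderiv ℝ ξ (f x) (fderiv ℝ f x u) := by
    intro V ξ hV hξ h u
    have h1 := hd.clm_apply hV.hasFDerivAt
    have h2 := (hξ.hasFDerivAt.comp x hf.differentiableAt.hasFDerivAt).congr_of_eventuallyEq h
    have h3 := congrArg (fun L : E →L[ℝ] K => L u) (h1.unique h2)
    simpa using h3
  have h1 := key hV hξ h (V' x)
  have h2 := key hV' hξ' h' (V x)
  rw [h'.self_of_nhds] at h1
  rw [h.self_of_nhds] at h2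
  simp only [VectorField.lieBracket, map_sub]
  rw [← h1, ← h2, hsymm.eq (V x) (V' x)]
  abel

/-- `Q` carries no bracket of its own. It is enough to compare brackets on one choice of
representatives of each pair of classes, because the brackets of both quotients are well defined. -/
lemma LieIdeal.nonempty_quotient_lieEquiv {L₁ L₂ Q : Type*} [LieRing L₁] [LieAlgebra ℝ L₁]
    [LieRing L₂] [LieAlgebra ℝ L₂] [AddCommGroup Q] [Module ℝ Q] {I₁ : LieIdeal ℝ L₁}
    {I₂ : LieIdeal ℝ L₂} {ρ₁ : L₁ →ₗ[ℝ] Q} {ρ₂ : L₂ →ₗ[ℝ] Q}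
    (h₁ : ∀ X, ρ₁ X = 0 ↔ X ∈ I₁) (h₂ : ∀ X, ρ₂ X = 0 ↔ X ∈ I₂)
    (hs₁ : Function.Surjective ρ₁) (hs₂ : Function.Surjective ρ₂)
    (h : ∀ q q', ∃ X X' Y Y', ρ₁ X = q ∧ ρ₁ X' = q' ∧ ρ₂ Y = q ∧ ρ₂ Y' = q' ∧
      ρ₁ ⁅X, X'⁆ = ρ₂ ⁅Y, Y'⁆) : Nonempty ((L₁ ⧸ I₁) ≃ₗ⁅ℝ⁆ (L₂ ⧸ I₂)) := by
  have hk₁ : I₁.toSubmodule = LinearMap.ker ρ₁ := by ext X; exact (h₁ X).symm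
  have hk₂ : I₂.toSubmodule = LinearMap.ker ρ₂ := by ext X; exact (h₂ X).symm
  let e₁ : (L₁ ⧸ I₁) ≃ₗ[ℝ] Q :=
    (Submodule.quotEquivOfEq _ _ hk₁).trans (ρ₁.quotKerEquivOfSurjective hs₁)
  let e₂ : (L₂ ⧸ I₂) ≃ₗ[ℝ] Q :=
    (Submodule.quotEquivOfEq _ _ hk₂).trans (ρ₂.quotKerEquivOfSurjective hs₂)
  have he₁ : ∀ X, e₁ (LieSubmodule.Quotient.mk X) = ρ₁ X := fun X => rfl
  have he₂ : ∀ X, e₂ (LieSubmodule.Quotient.mk X) = ρ₂ X := fun X => rfl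
  let e := e₁.trans e₂.symm
  refine ⟨{ e with
    map_lie' := ?_ }⟩
  intro a b
  obtain ⟨X, X', Y, Y', hX, hX', hY, hY', hb⟩ := h (e₁ a) (e₁ b)
  have ha : a = LieSubmodule.Quotient.mk X := e₁.injective (by rw [he₁, hX])
  have hb' : b = LieSubmodule.Quotient.mk X' := e₁.injective (by rw [he₁, hX'])
  have hea : e a = LieSubmodule.Quotient.mk Y := e₂.injective (by simp [e, he₂, hY])
  have heb : e b = LieSubmodule.Quotient.mk Y' := e₂.injective (by simp [e, he₂, hY'])
  change e ⁅a, b⁆ = ⁅e a, e b⁆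
  rw [hea, heb, ha, hb']
  apply e₂.injective
  exact (e₂.apply_symm_apply _).trans hb

variable {E : Type*} [NormedAddCommGroup E] [NormedSpace ℝ E] [FiniteDimensional ℝ E]
  {M : Type*} [TopologicalSpace M] [ChartedSpace E M] [IsManifold 𝓘(ℝ, E) ∞ M] [T2Space M]
  {K : Type*} [NormedAddCommGroup K] [NormedSpace ℝ K]
  {W : Type*} [NormedAddCommGroup W] [NormedSpace ℝ W]
  {F : SingularFoliation E M} {x : M} {pr : M → K} {Z : K → W →L[ℝ] K}

/-- The values at the origin of the smooth relations between the vector fields `Z · a`. -/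
def relationsAtZero (Z : K → W →L[ℝ] K) : Submodule ℝ W where
  carrier := {t | ∃ a : K → W, SmoothNear a 0 ∧ a 0 = t ∧ ∀ᶠ s in 𝓝 0, Z s (a s) = 0}
  zero_mem' := ⟨0, .const 0, rfl, Eventually.of_forall fun s => map_zero _⟩
  add_mem' := by
    rintro _ _ ⟨a, ha, rfl, ha'⟩ ⟨b, hb, rfl, hb'⟩
    refine ⟨_, ha.add hb, rfl, ?_⟩
    filter_upwards [ha', hb'] with s h1 h2
    rw [map_add, h1, h2, add_zero]
  smul_mem' := by
    rintro c _ ⟨a, ha, rfl, ha'⟩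
    refine ⟨_, (SmoothNear.const c).smul ha, rfl, ?_⟩
    filter_upwards [ha'] with s h1
    rw [map_smul, h1, smul_zero]

/-- Near `x` the vector field `X` is projected by `pr` to `Z · g` for some smooth `g` with
`g x = t`. -/
def HasSymbol (pr : M → K) (Z : K → W →L[ℝ] K) (x : M) (X : SmoothVF E M) (t : W) : Prop :=
  ∃ g : M → W, MSmoothNear E W g x ∧ g x = t ∧
    ∀ᶠ z in 𝓝 x, (mfderiv 𝓘(ℝ, E) 𝓘(ℝ, K) pr z (X z) : K) = Z (pr z) (g z)

namespace HasSymbol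

variable {X X' : SmoothVF E M} {t t' : W}

lemma zero : HasSymbol pr Z x (0 : SmoothVF E M) 0 :=
  ⟨fun _ => 0, .const, rfl, Eventually.of_forall fun z => by
    rw [map_zero]; exact map_zero (mfderiv 𝓘(ℝ, E) 𝓘(ℝ, K) pr z)⟩

lemma add (h : HasSymbol pr Z x X t) (h' : HasSymbol pr Z x X' t') :
    HasSymbol pr Z x (X + X') (t + t') := by
  obtain ⟨g, hg, rfl, h⟩ := h
  obtain ⟨g', hg', rfl, h'⟩ := h'
  refine ⟨fun z => g z + g' z, ?_, rfl, ?_⟩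
  · filter_upwards [hg, hg'] with z h1 h2 using h1.add h2
  · filter_upwards [h, h'] with z h1 h2
    rw [map_add, ← h1, ← h2]
    exact map_add (mfderiv 𝓘(ℝ, E) 𝓘(ℝ, K) pr z) _ _

lemma fsmul (f : SmoothFun E M) (h : HasSymbol pr Z x X t) :
    HasSymbol pr Z x (SmoothVF.fsmul f X) (f x • t) := by
  obtain ⟨g, hg, rfl, h⟩ := h
  refine ⟨fun z => f z • g z, ?_, rfl, ?_⟩
  · filter_upwards [hg] with z h1 using (f.contMDiff z).smul h1
  · filter_upwards [h] with z h1
    rw [map_smul, ← h1]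
    exact map_smul (mfderiv 𝓘(ℝ, E) 𝓘(ℝ, K) pr z) _ _

lemma smul (c : ℝ) (h : HasSymbol pr Z x X t) : HasSymbol pr Z x (c • X) (c • t) := by
  obtain ⟨g, hg, rfl, h⟩ := h
  refine ⟨fun z => c • g z, ?_, rfl, ?_⟩
  · filter_upwards [hg] with z h1 using
      (contMDiffAt_const (I' := 𝓘(ℝ, ℝ)) (c := c)).smul h1
  · filter_upwards [h] with z h1
    rw [map_smul, ← h1]
    exact map_smul (mfderiv 𝓘(ℝ, E) 𝓘(ℝ, K) pr z) _ _

lemma add_relation (h : HasSymbol pr Z x X t) (hpr : MSmoothNear E K pr x) (h0 : pr x = 0)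
    (ht' : t' ∈ relationsAtZero Z) : HasSymbol pr Z x X (t + t') := by
  obtain ⟨g, hg, rfl, h⟩ := h
  obtain ⟨a, ha, rfl, ha'⟩ := ht'
  have ha0 : SmoothNear a (pr x) := by rwa [h0]
  have hc := hpr.continuousAt
  rw [ContinuousAt, h0] at hc
  have h1 := ha0.mcomp hpr
  refine ⟨fun z => g z + a (pr z), ?_, by simp only [h0], ?_⟩
  · filter_upwards [hg, h1] with z h1 h2 using h1.add h2
  · filter_upwards [h, hc.eventually ha'] with z h1 h2
    rw [map_add, h2, add_zero, h1]

end HasSymbol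

namespace LocalModel

variable {X X' : SmoothVF E M} {t t' : W}

lemma exists_hasSymbol (h : LocalModel F x pr Z) (hX : X ∈ F.toSubmodule) :
    ∃ t, HasSymbol pr Z x X t := by
  obtain ⟨g, hg, h'⟩ := (h.eventuallyEq_mem_iff X).1 ⟨X, hX, Eventually.of_forall fun _ => rfl⟩
  exact ⟨g x, g, hg, rfl, h'⟩

/-- The coefficients of `X` in the generators are `C (X, g)`. They vanish at `x` because `X` and `g`
do and `C` is linear. -/
lemma exists_mem_idealMul_eventuallyEq (h : LocalModel F x pr Z)
    (hXx : X x = 0) (hX : HasSymbol pr Z x X 0) :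
    ∃ X' ∈ F.idealMul x ⊓ F.toSubmodule, ∀ᶠ z in 𝓝 x, X z = X' z := by
  obtain ⟨g, hg, hg0, hX⟩ := hX
  have hpr := h.mSmoothNear
  obtain ⟨c, m, Y, hx, hY, -, hp⟩ := h.exists_chart
  obtain ⟨C, hC, hC'⟩ := hp.lift
  have hs : SmoothNear (fun w => (X.coord c w, g ((extChartAt 𝓘(ℝ, E) c).symm w)))
      (extChartAt 𝓘(ℝ, E) c x) :=
    (X.smoothNear_coord hx).prodMk (hg.comp_extChartAt_symm hx).smoothNear
  let b : M → Fin m → ℝ := fun z => C (extChartAt 𝓘(ℝ, E) c z)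
    (X.coord c (extChartAt 𝓘(ℝ, E) c z), g z)
  have hbs : MSmoothNear E (Fin m → ℝ) b x := by
    refine ((hC.clm_apply hs).mcomp (mSmoothNear_extChartAt hx)).congr ?_
    filter_upwards [eventually_mem_source hx] with z hz
    simp only [b, extChartAt_symm_apply_self hz]
  have hXc : X.coord c (extChartAt 𝓘(ℝ, E) c x) = 0 := by
    rw [SmoothVF.coord, VectorField.mpullback_apply, extChartAt_symm_apply_self hx, hXx]
    exact map_zero _
  have hb0 : b x = 0 := by
    simp only [b, hXc, hg0]
    exact map_zero _
  have hbX : ∀ᶠ z in 𝓝 x, X z = ∑ i, b z i • Y i z := by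
    filter_upwards [(mSmoothNear_extChartAt hx).continuousAt.eventually hC', hX,
      eventually_mem_source hx, hpr.eventually] with z h1 h2 h3 h4
    have h5 := h1 (X.coord c (extChartAt 𝓘(ℝ, E) c z)) (g z) ?_
    · rw [SmoothVF.coordFamily_eq_coord] at h5
      have h6 := congrArg (fun v : E => (mfderiv 𝓘(ℝ, E) 𝓘(ℝ, E) (extChartAt 𝓘(ℝ, E) c).symm
        (extChartAt 𝓘(ℝ, E) c z) : E →L[ℝ] E) v) h5
      have hw := (eventually_mem_target h3).self_of_nhds
      have h7 := (SmoothVF.mfderiv_coord (∑ i, b z i • Y i) hw).symm.trans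
        (h6.trans (SmoothVF.mfderiv_coord X hw))
      rw [SmoothVF.sum_smul_apply, extChartAt_symm_apply_self h3] at h7
      exact h7.symm
    · rw [← mfderiv_eq_fderiv_coord h3 h4.mdifferentiableAt X]
      rw [extChartAt_symm_apply_self h3]
      exact h2
  have hbi : ∀ i, MSmoothNear E ℝ (fun z => b z i) x := fun i =>
    SmoothNear.mcomp (g := fun v : Fin m → ℝ => v i)
      (.of_clm (ContinuousLinearMap.proj (R := ℝ) (φ := fun _ : Fin m => ℝ) i)) hbs
  choose b' hb'c _ hb' using fun i => (hbi i).exists_smoothFun univ_mem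
  refine ⟨∑ i, SmoothVF.fsmul (b' i) (Y i), ⟨Submodule.sum_mem _ fun i _ =>
    Submodule.subset_span ⟨b' i, ?_, Y i, hY i, rfl⟩,
    Submodule.sum_mem _ fun i _ => F.fsmul_mem _ (hb'c i) _ (hY i)⟩, ?_⟩
  · rw [(hb' i).self_of_nhds, hb0]; rfl
  · filter_upwards [hbX, eventually_all.2 hb'] with z h1 h2
    rw [h1]
    refine Eq.trans ?_ (map_sum (SmoothVF.eval z) (fun i => SmoothVF.fsmul (b' i) (Y i)) _).symm
    refine Finset.sum_congr rfl fun i _ => ?_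
    rw [← h2 i]
    rfl

/-- The germ `X'` determines membership: `X = X' + (1 - χ)(X - X')` for a bump function `χ`
supported where `X = X'`, and `1 - χ` vanishes at `x`. -/
lemma mem_idealMul (h : LocalModel F x pr Z) (hXF : X ∈ F.toSubmodule) (hXx : X x = 0)
    (hX : HasSymbol pr Z x X 0) : X ∈ F.idealMul x := by
  obtain ⟨X', ⟨hX', hX'F⟩, h'⟩ := h.exists_mem_idealMul_eventuallyEq hXx hX
  obtain ⟨χ, -, hχ, hχ1⟩ := exists_bump (E := E) h'
  have h1 : SmoothVF.fsmul (1 - χ) (X - X') ∈ F.idealMul x := by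
    refine Submodule.subset_span ⟨1 - χ, ?_, _, Submodule.sub_mem _ hXF hX'F, rfl⟩
    change (1 : ℝ) - χ x = 0
    rw [hχ1.self_of_nhds, sub_self]
  have h2 : X = X' + SmoothVF.fsmul (1 - χ) (X - X') := by
    ext z
    change X z = X' z + (1 - χ z) • (X z - X' z)
    by_cases hz : z ∈ tsupport χ
    · have h3 : X z = X' z := hχ hz
      rw [h3, sub_self, smul_zero, add_zero]
    · rw [image_eq_zero_of_notMem_tsupport hz, sub_zero, one_smul, add_sub_cancel]
  rw [h2]
  exact Submodule.add_mem _ hX' h1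

lemma hasSymbol_of_mem_idealMul (h : LocalModel F x pr Z) (hX : X ∈ F.idealMul x) :
    HasSymbol pr Z x X 0 := by
  induction hX using Submodule.span_induction with
  | mem X hX =>
    obtain ⟨f, hf, Y, hY, rfl⟩ := hX
    obtain ⟨t, ht⟩ := h.exists_hasSymbol hY
    simpa [hf] using ht.fsmul f
  | zero => exact .zero
  | add _ _ _ _ h₁ h₂ => simpa using h₁.add h₂
  | smul c _ _ h => simpa using h.smul c

/-- The kernel of the differential of the projection of a local model is the tangent space. -/
lemma tangent_eq_ker (h : LocalModel F x pr Z) (h0 : pr x = 0) (hZ : Z 0 = 0) :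
    F.tangent x = LinearMap.ker (mfderiv 𝓘(ℝ, E) 𝓘(ℝ, K) pr x).toLinearMap := by
  refine le_antisymm ?_ ?_
  · rintro _ ⟨X, hX, rfl⟩
    obtain ⟨t, g, hg, rfl, h'⟩ := h.exists_hasSymbol hX
    have h1 := h'.self_of_nhds
    rw [h0, hZ] at h1
    exact h1
  · intro v hv
    have hpr := h.mSmoothNear
    obtain ⟨c, m, Y, hx, hY, -, hp⟩ := h.exists_chart
    obtain ⟨C, hC, hC'⟩ := hp.lift
    have hw := (eventually_mem_target hx).self_of_nhds
    obtain ⟨e, he⟩ := isInvertible_mfderiv_extChartAt_symm_of_mem hw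
    obtain ⟨v₀, hv₀⟩ : ∃ v₀ : E, (mfderiv 𝓘(ℝ, E) 𝓘(ℝ, E) (extChartAt 𝓘(ℝ, E) c).symm
        (extChartAt 𝓘(ℝ, E) c x) : E →L[ℝ] E) v₀ = v := by
      rw [← he]
      exact e.surjective v
    obtain ⟨V, -, -, hV⟩ := exists_smoothVF_coord hx (.const v₀) (univ_mem (f := 𝓝 x))
    have hVx : V x = v := by
      have h1 := V.mfderiv_coord hw
      rw [hV.self_of_nhds, extChartAt_symm_apply_self hx] at h1
      exact h1.symm.trans hv₀
    have h1 := hC'.self_of_nhds v₀ 0 ?_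
    · rw [SmoothVF.coordFamily_eq_coord] at h1
      refine ⟨∑ i, C (extChartAt 𝓘(ℝ, E) c x) (v₀, 0) i • Y i,
        Submodule.sum_mem _ fun i _ => Submodule.smul_mem _ _ (hY i), ?_⟩
      have h2 := (∑ i, C (extChartAt 𝓘(ℝ, E) c x) (v₀, 0) i • Y i).mfderiv_coord hw
      rw [h1, extChartAt_symm_apply_self hx] at h2
      exact h2.symm.trans hv₀
    · have h2 := mfderiv_eq_fderiv_coord hx hpr.mdifferentiableAt V
      rw [hV.self_of_nhds, hVx] at h2
      rw [← h2, map_zero]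
      exact hv

variable [FiniteDimensional ℝ K]

lemma exists_section (h : LocalModel F x pr Z) (h0 : pr x = 0) :
    ∃ σ : K → M, MSmoothNear K E σ 0 ∧ σ 0 = x ∧ ∀ᶠ s in 𝓝 (0 : K), pr (σ s) = s := by
  obtain ⟨c, m, Y, hx, hY, -, hp⟩ := h.exists_chart
  obtain ⟨σ, hσ, hσx, hσ'⟩ := hp.smooth.exists_section hp.surj.self_of_nhds
  rw [extChartAt_symm_apply_self hx, h0] at hσ hσx hσ'
  refine ⟨fun s => (extChartAt 𝓘(ℝ, E) c).symm (σ s), ?_, ?_, hσ'⟩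
  · refine MSmoothNear.comp ?_ hσ.mSmoothNear
    rw [hσx]
    exact mSmoothNear_extChartAt_symm hx
  · simp only [hσx, extChartAt_symm_apply_self hx]

/-- A symbol is well defined up to relations: restricted to a section of `pr`, the difference of two
coefficient functions is annihilated by `Z`. -/
lemma sub_mem_relationsAtZero (h : LocalModel F x pr Z) (h0 : pr x = 0)
    (ht : HasSymbol pr Z x X t) (ht' : HasSymbol pr Z x X t') : t - t' ∈ relationsAtZero Z := by
  obtain ⟨g, hg, rfl, h1⟩ := ht
  obtain ⟨g', hg', rfl, h2⟩ := ht'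
  obtain ⟨σ, hσ, rfl, hσ'⟩ := h.exists_section h0
  refine ⟨fun s => g (σ s) - g' (σ s), (hg.comp hσ).smoothNear.sub (hg'.comp hσ).smoothNear, rfl, ?_⟩
  filter_upwards [hσ.continuousAt.eventually h1, hσ.continuousAt.eventually h2, hσ'] with s h3 h4 h5
  rw [h5] at h3 h4
  rw [map_sub]
  exact sub_eq_zero.2 (h3.symm.trans h4)

/-- A smooth right inverse of `d pr` lifts `Z · t`. The lift vanishes at `x` since `Z` vanishes at
`0`, and it agrees near `x` with an element of `F`, since its coefficient is the constant `t`. -/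
lemma exists_lift (h : LocalModel F x pr Z) (h0 : pr x = 0) (hZ : Z 0 = 0) (t : W) :
    ∃ X ∈ F.toSubmodule, X x = 0 ∧
      ∀ᶠ z in 𝓝 x, (mfderiv 𝓘(ℝ, E) 𝓘(ℝ, K) pr z (X z) : K) = Z (pr z) t := by
  have hpr := h.mSmoothNear
  obtain ⟨c, m, Y, hx, hY, -, hp⟩ := h.exists_chart
  obtain ⟨R, hR, hR'⟩ := hp.smooth.exists_rightInverse hp.surj.self_of_nhds
  have hZs : SmoothNear Z (pr ((extChartAt 𝓘(ℝ, E) c).symm (extChartAt 𝓘(ℝ, E) c x))) := by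
    rw [extChartAt_symm_apply_self hx]; exact h.smoothNear
  obtain ⟨V, -, -, hV⟩ := exists_smoothVF_coord hx (hR.clm_apply
    ((SmoothNear.comp (f := fun w => pr ((extChartAt 𝓘(ℝ, E) c).symm w)) hZs hp.smooth).clm_apply
      (.const t))) (univ_mem (f := 𝓝 x))
  have hVpr : ∀ᶠ z in 𝓝 x, (mfderiv 𝓘(ℝ, E) 𝓘(ℝ, K) pr z (V z) : K) = Z (pr z) t := by
    have hc := (mSmoothNear_extChartAt hx).continuousAt
    filter_upwards [hc.eventually hR', hc.eventually hV, eventually_mem_source hx, hpr.eventually]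
      with z h1 h2 h3 h4
    have h5 := mfderiv_eq_fderiv_coord h3 h4.mdifferentiableAt V
    rw [h2, h1, extChartAt_symm_apply_self h3] at h5
    exact h5
  have hVx : V x = 0 := by
    have h1 := V.mfderiv_coord (eventually_mem_target hx).self_of_nhds
    rw [hV.self_of_nhds, extChartAt_symm_apply_self hx, h0, hZ] at h1
    rw [← h1, zero_apply, map_zero]
    exact map_zero (mfderiv 𝓘(ℝ, E) 𝓘(ℝ, E) (extChartAt 𝓘(ℝ, E) c).symm (extChartAt 𝓘(ℝ, E) c x))
  obtain ⟨X, hX, hXV⟩ := (h.eventuallyEq_mem_iff V).2 ⟨fun _ => t, .const, hVpr⟩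
  refine ⟨X, hX, by rw [← hXV.self_of_nhds, hVx], ?_⟩
  filter_upwards [hVpr, hXV] with z h1 h2
  rw [← h2, h1]

/-- The bracket of two lifts projects to the bracket of the fields they lift. Its symbols are thus
described on `K` by `Z` alone, with no trace of the foliation, which is what permits comparing two
foliations. -/
lemma hasSymbol_lie_iff (h : LocalModel F x pr Z) (h0 : pr x = 0)
    (hX : ∀ᶠ z in 𝓝 x, (mfderiv 𝓘(ℝ, E) 𝓘(ℝ, K) pr z (X z) : K) = Z (pr z) t)
    (hX' : ∀ᶠ z in 𝓝 x, (mfderiv 𝓘(ℝ, E) 𝓘(ℝ, K) pr z (X' z) : K) = Z (pr z) t') (u : W) :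
    HasSymbol pr Z x ⁅X, X'⁆ u ↔ ∃ b : K → W, SmoothNear b 0 ∧ b 0 = u ∧ ∀ᶠ s in 𝓝 (0 : K),
      VectorField.lieBracket ℝ (fun s => Z s t) (fun s => Z s t') s = Z s (b s) := by
  have hpr := h.mSmoothNear
  have key : ∀ᶠ z in 𝓝 x, (mfderiv 𝓘(ℝ, E) 𝓘(ℝ, K) pr z (⁅X, X'⁆ z) : K) =
      VectorField.lieBracket ℝ (fun s => Z s t) (fun s => Z s t') (pr z) := by
    have hx := mem_chart_source E x
    filter_upwards [eventually_mem_source hx, hpr.eventually, eventually_eventually_nhds.2 hX,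
      eventually_eventually_nhds.2 hX', hpr.continuousAt.eventually h.smoothNear.eventually]
      with z h1 h2 h3 h4 h5
    rw [mfderiv_eq_fderiv_coord h1 h2.mdifferentiableAt, ← SmoothVF.lieBracket_coord h1]
    have hev : ∀ {V : SmoothVF E M} {t : W},
        (∀ᶠ z in 𝓝 z, (mfderiv 𝓘(ℝ, E) 𝓘(ℝ, K) pr z (V z) : K) = Z (pr z) t) →
        ∀ᶠ w in 𝓝 (extChartAt 𝓘(ℝ, E) x z),
          fderiv ℝ (fun w => pr ((extChartAt 𝓘(ℝ, E) x).symm w)) w (V.coord x w) =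
            Z (pr ((extChartAt 𝓘(ℝ, E) x).symm w)) t := by
      intro V t hV
      filter_upwards [(eventually_extChartAt h1).2 hV, (eventually_extChartAt h1).2 h2.eventually,
        eventually_mem_target h1] with w h6 h7 h8
      have h9 : (extChartAt 𝓘(ℝ, E) x).symm w ∈ (chartAt E x).source := by
        simpa using (extChartAt 𝓘(ℝ, E) x).map_target h8
      rw [mfderiv_eq_fderiv_coord h9 h7.mdifferentiableAt] at h6
      rwa [(extChartAt 𝓘(ℝ, E) x).right_inv h8] at h6
    have hd : ∀ t, DifferentiableAt ℝ (fun s => Z s t)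
        (pr ((extChartAt 𝓘(ℝ, E) x).symm (extChartAt 𝓘(ℝ, E) x z))) := fun t => by
      rw [extChartAt_symm_apply_self h1]
      exact (h5.clm_apply (.const t)).differentiableAt
    have h10 := fderiv_lieBracket_of_related (h2.comp_extChartAt_symm h1).smoothNear
      (X.smoothNear_coord h1).differentiableAt (X'.smoothNear_coord h1).differentiableAt
      (hd t) (hd t') (hev h3) (hev h4)
    rwa [extChartAt_symm_apply_self h1] at h10
  constructor
  · rintro ⟨g, hg, rfl, h1⟩
    obtain ⟨σ, hσ, rfl, hσ'⟩ := h.exists_section h0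
    refine ⟨fun s => g (σ s), (hg.comp hσ).smoothNear, rfl, ?_⟩
    filter_upwards [hσ.continuousAt.eventually h1, hσ.continuousAt.eventually key, hσ']
      with s h3 h4 h5
    rw [h4, h5] at h3
    exact h3
  · rintro ⟨b, hb, rfl, hb'⟩
    have hb0 : SmoothNear b (pr x) := by rwa [h0]
    have hc := hpr.continuousAt
    rw [ContinuousAt, h0] at hc
    refine ⟨fun z => b (pr z), hb0.mcomp hpr, by simp only [h0], ?_⟩
    filter_upwards [hc.eventually hb', key] with z h1 h2
    rw [h2, h1]

/-- The symbol, as a linear map on the vector fields in `F` vanishing at `x`. -/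
lemma exists_symbolMap (h : LocalModel F x pr Z) (h0 : pr x = 0) (hZ : Z 0 = 0) :
    ∃ ρ : F.vanishingAt x →ₗ[ℝ] W ⧸ relationsAtZero Z,
      (∀ (X : F.vanishingAt x) t, HasSymbol pr Z x (X : SmoothVF E M) t → ρ X = (relationsAtZero Z).mkQ t) ∧
      (∀ X, ρ X = 0 ↔ X ∈ F.isotropyIdeal x) ∧ Function.Surjective ρ := by
  -- Symbols are chosen arbitrarily; modulo relations the choice does not matter, and linearity
  -- follows.
  choose t ht using fun X : F.vanishingAt x => h.exists_hasSymbol X.2.1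
  have key : ∀ (X : F.vanishingAt x) u, HasSymbol pr Z x (X : SmoothVF E M) u →
      (relationsAtZero Z).mkQ (t X) = (relationsAtZero Z).mkQ u := fun X u hu =>
    (Submodule.Quotient.eq _).2 (h.sub_mem_relationsAtZero h0 (ht X) hu)
  let ρ : F.vanishingAt x →ₗ[ℝ] W ⧸ relationsAtZero Z :=
    { toFun := fun X => (relationsAtZero Z).mkQ (t X)
      map_add' := fun X Y => by rw [key _ _ ((ht X).add (ht Y)), map_add]
      map_smul' := fun c X => by rw [key _ _ ((ht X).smul c), map_smul]; rfl }
  refine ⟨ρ, key, fun X => ⟨fun hX => ?_, fun hX => ?_⟩, fun q => ?_⟩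
  · have h1 : t X ∈ relationsAtZero Z := (Submodule.Quotient.mk_eq_zero _).1 hX
    have h2 := (ht X).add_relation h.mSmoothNear h0 (Submodule.neg_mem _ h1)
    rw [add_neg_cancel] at h2
    exact h.mem_idealMul X.2.1 X.2.2 h2
  · exact (key X 0 (h.hasSymbol_of_mem_idealMul hX)).trans (map_zero _)
  · obtain ⟨u, rfl⟩ := Submodule.mkQ_surjective _ q
    obtain ⟨X, hX, hXx, hXu⟩ := h.exists_lift h0 hZ u
    exact ⟨⟨X, hX, hXx⟩, key ⟨X, hX, hXx⟩ u ⟨fun _ => u, .const, rfl, hXu⟩⟩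

end LocalModel

variable [FiniteDimensional ℝ K] {E' : Type*} [NormedAddCommGroup E'] [NormedSpace ℝ E']
  [FiniteDimensional ℝ E'] {M' : Type*} [TopologicalSpace M'] [ChartedSpace E' M']
  [IsManifold 𝓘(ℝ, E') ∞ M'] [T2Space M'] {F' : SingularFoliation E' M'} {x' : M'}

namespace SingularFoliation.HasModel

/-- Both isotropy algebras are identified with `W ⧸ relationsAtZero Z`. Lifts of the same
coefficients on the two sides have brackets with a common symbol. -/
lemma nonempty_isotropy_lieEquiv (h : F.HasModel x Z) (h' : F'.HasModel x' Z) :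
    Nonempty (F.isotropy x ≃ₗ⁅ℝ⁆ F'.isotropy x') := by
  obtain ⟨hZ, pr, h0, h⟩ := h
  obtain ⟨-, pr', h0', h'⟩ := h'
  obtain ⟨ρ, hρ, hρI, hρs⟩ := h.exists_symbolMap h0 hZ
  obtain ⟨ρ', hρ', hρI', hρs'⟩ := h'.exists_symbolMap h0' hZ
  refine LieIdeal.nonempty_quotient_lieEquiv hρI hρI' hρs hρs' fun q₁ q₂ => ?_
  obtain ⟨t₁, rfl⟩ := Submodule.mkQ_surjective _ q₁
  obtain ⟨t₂, rfl⟩ := Submodule.mkQ_surjective _ q₂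
  obtain ⟨X₁, hX₁, hX₁x, hX₁t⟩ := h.exists_lift h0 hZ t₁
  obtain ⟨X₂, hX₂, hX₂x, hX₂t⟩ := h.exists_lift h0 hZ t₂
  obtain ⟨Y₁, hY₁, hY₁x, hY₁t⟩ := h'.exists_lift h0' hZ t₁
  obtain ⟨Y₂, hY₂, hY₂x, hY₂t⟩ := h'.exists_lift h0' hZ t₂
  obtain ⟨u, hu⟩ := h.exists_hasSymbol (F.lie_mem _ hX₁ _ hX₂)
  have hu' := (h'.hasSymbol_lie_iff h0' hY₁t hY₂t u).2 ((h.hasSymbol_lie_iff h0 hX₁t hX₂t u).1 hu)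
  exact ⟨⟨X₁, hX₁, hX₁x⟩, ⟨X₂, hX₂, hX₂x⟩, ⟨Y₁, hY₁, hY₁x⟩, ⟨Y₂, hY₂, hY₂x⟩,
    hρ _ _ ⟨fun _ => t₁, .const, rfl, hX₁t⟩, hρ _ _ ⟨fun _ => t₂, .const, rfl, hX₂t⟩,
    hρ' _ _ ⟨fun _ => t₁, .const, rfl, hY₁t⟩, hρ' _ _ ⟨fun _ => t₂, .const, rfl, hY₂t⟩,
    (hρ _ u hu).trans (hρ' _ u hu').symm⟩

lemma leafCodim_eq (h : F.HasModel x Z) : F.leafCodim x = Module.finrank ℝ K := by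
  obtain ⟨hZ, pr, h0, h⟩ := h
  rw [SingularFoliation.leafCodim, h.tangent_eq_ker h0 hZ]
  exact ((mfderiv 𝓘(ℝ, E) 𝓘(ℝ, K) pr x).toLinearMap.quotKerEquivOfSurjective
    h.surjective_mfderiv).finrank_eq

end SingularFoliation.HasModel

end Isotropy

end

noncomputable section

/-! ### Slices and the transverse foliation -/

section Slices

variable {E : Type*} [NormedAddCommGroup E] [NormedSpace ℝ E] [FiniteDimensional ℝ E]
  {M : Type*} [TopologicalSpace M] [ChartedSpace E M] [IsManifold 𝓘(ℝ, E) ∞ M]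
  {E' : Type*} [NormedAddCommGroup E'] [NormedSpace ℝ E'] [FiniteDimensional ℝ E']
  {N : Type*} [TopologicalSpace N] [ChartedSpace E' N] [IsManifold 𝓘(ℝ, E') ∞ N]
  {ES : Type*} [NormedAddCommGroup ES] [NormedSpace ℝ ES] [FiniteDimensional ℝ ES]
  {S : Type*} [TopologicalSpace S] [ChartedSpace ES S] [IsManifold 𝓘(ℝ, ES) ∞ S]
  {ET : Type*} [NormedAddCommGroup ET] [NormedSpace ℝ ET] [FiniteDimensional ℝ ET]
  {T : Type*} [TopologicalSpace T] [ChartedSpace ET T] [IsManifold 𝓘(ℝ, ET) ∞ T]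
  {K : Type*} [NormedAddCommGroup K] [NormedSpace ℝ K]
  {W : Type*} [NormedAddCommGroup W] [NormedSpace ℝ W]

lemma SmoothVF.exists_pushforward (ψ : S ≃ₘ^∞⟮𝓘(ℝ, ES), 𝓘(ℝ, ET)⟯ T) (Y : SmoothVF ES S) :
    ∃ X : SmoothVF ET T, ∀ a, X (ψ a) = mfderiv 𝓘(ℝ, ES) 𝓘(ℝ, ET) ψ a (Y a) := by
  have : CompleteSpace ES := FiniteDimensional.complete ℝ ES
  have : CompleteSpace ET := FiniteDimensional.complete ℝ ET
  have hinv : ∀ b, (mfderiv 𝓘(ℝ, ET) 𝓘(ℝ, ES) ψ.symm b).IsInvertible := fun b =>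
    ⟨ψ.symm.mfderivToContinuousLinearEquiv (by simp) b, rfl⟩
  refine ⟨⟨VectorField.mpullback 𝓘(ℝ, ET) 𝓘(ℝ, ES) ψ.symm Y, fun b => ?_⟩, fun a => ?_⟩
  · exact ContMDiffAt.mpullback_vectorField_preimage (n := ∞) (m := ∞) (V := Y)
      (Y.contMDiff _) ψ.symm.contMDiff.contMDiffAt (hinv b) (by simp)
  · change (mfderiv 𝓘(ℝ, ET) 𝓘(ℝ, ES) ψ.symm (ψ a)).inverse (Y (ψ.symm (ψ a))) = _
    have h1 := mfderiv_comp_apply_eq (g := ψ.symm) (π := ψ) (q := a)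
      (ψ.symm.contMDiff.mdifferentiable (by simp) _) (ψ.contMDiff.mdifferentiable (by simp) _) (Y a)
    have h2 : (fun z => ψ.symm (ψ z)) = id := funext ψ.symm_apply_apply
    obtain ⟨e, he⟩ := hinv (ψ a)
    rw [← he, ContinuousLinearMap.inverse_equiv]
    refine (e.symm_apply_eq).2 ?_
    have h3 : e (mfderiv 𝓘(ℝ, ES) 𝓘(ℝ, ET) ψ a (Y a)) =
      mfderiv 𝓘(ℝ, ET) 𝓘(ℝ, ES) ψ.symm (ψ a) (mfderiv 𝓘(ℝ, ES) 𝓘(ℝ, ET) ψ a (Y a)) := by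
      rw [← he]; rfl
    have h4 : (Y (ψ.symm (ψ a)) : ES) = Y a := by rw [ψ.symm_apply_apply]
    rw [h3, ← h1]
    refine h4.trans ?_
    rw [h2, mfderiv_id]
    rfl

lemma OpenPartialHomeomorph.exists_diffeomorph (e : OpenPartialHomeomorph S T)
    (he : ContMDiffOn 𝓘(ℝ, ES) 𝓘(ℝ, ET) ∞ e e.source)
    (he' : ContMDiffOn 𝓘(ℝ, ET) 𝓘(ℝ, ES) ∞ e.symm e.target) :
    ∃ ψ : (⟨e.source, e.open_source⟩ : TopologicalSpace.Opens S) ≃ₘ^∞⟮𝓘(ℝ, ES), 𝓘(ℝ, ET)⟯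
      (⟨e.target, e.open_target⟩ : TopologicalSpace.Opens T), ∀ a, (ψ a : T) = e a := by
  refine ⟨⟨e.toHomeomorphSourceTarget.toEquiv, ?_, ?_⟩, fun a => rfl⟩
  · refine (ContMDiff.subtypeVal_comp_iff _ _).1 ?_
    exact he.comp_contMDiff contMDiff_subtype_val fun a => a.2
  · refine (ContMDiff.subtypeVal_comp_iff _ _).1 ?_
    exact he'.comp_contMDiff contMDiff_subtype_val fun a => a.2

section PullbackDiffeomorph

variable [T2Space S] [T2Space T] {F : SingularFoliation E M} {F' : SingularFoliation E' N}
  {Z : K → W →L[ℝ] K} {pr : M → K} {pr' : N → K} {ι : S → M} {κ : T → N}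
  {ψ : S ≃ₘ^∞⟮𝓘(ℝ, ES), 𝓘(ℝ, ET)⟯ T}

/-- Pulling back along `κ` and then along `ψ` obeys the criterion for `κ ∘ ψ`. One direction expands
an element of the span, the other pushes `Y` forward by the diffeomorphism `ψ`, so no generators of
the intermediate pullback are needed. -/
lemma LocalModel.pullbackGerm_pullbackFoliation_iff {a : S} (h : LocalModel F' (κ (ψ a)) pr' Z)
    (hκ : MSmoothNear ET E' κ (ψ a)) (Y : SmoothVF ES S) :
    PullbackGerm ES ψ (pullbackFoliation (E' := ET) κ F'.toSubmodule)
        (fun p => mfderiv 𝓘(ℝ, ES) 𝓘(ℝ, ET) ψ p (Y p)) a ↔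
      ∃ g : S → W, MSmoothNear ES W g a ∧ ∀ᶠ z in 𝓝 a,
        (mfderiv 𝓘(ℝ, ES) 𝓘(ℝ, K) (fun z => pr' (κ (ψ z))) z (Y z) : K) =
          Z (pr' (κ (ψ z))) (g z) := by
  have hψ : ∀ a, MSmoothNear ES ET ψ a := fun a => .of_contMDiff ψ.contMDiff
  have hψ' : ∀ b, MSmoothNear ET ES ψ.symm b := fun b => .of_contMDiff ψ.symm.contMDiff
  have hf : MSmoothNear ET K (fun b => pr' (κ b)) (ψ a) := h.mSmoothNear.comp hκ
  have hchain : ∀ᶠ z in 𝓝 a, ∀ v : TangentSpace 𝓘(ℝ, ES) z,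
      (mfderiv 𝓘(ℝ, ES) 𝓘(ℝ, K) (fun z => pr' (κ (ψ z))) z v : K) =
      mfderiv 𝓘(ℝ, ET) 𝓘(ℝ, K) (fun b => pr' (κ b)) (ψ z)
        (mfderiv 𝓘(ℝ, ES) 𝓘(ℝ, ET) ψ z v) := by
    filter_upwards [(hψ a).continuousAt.eventually hf.eventually] with z h1 v
    exact mfderiv_comp_apply_eq (g := fun b => pr' (κ b)) h1.mdifferentiableAt
      (hψ z).mdifferentiableAt v
  constructor
  · rintro ⟨ξ, hξ, hξY⟩
    have key : ∃ g : S → W, MSmoothNear ES W g a ∧ ∀ᶠ z in 𝓝 a,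
        (mfderiv 𝓘(ℝ, ET) 𝓘(ℝ, K) (fun b => pr' (κ b)) (ψ z) (ξ z) : K) =
          Z (pr' (κ (ψ z))) (g z) := by
      clear hξY
      induction hξ using Submodule.span_induction with
      | mem ξ hξ =>
        obtain ⟨f, -, X, hX, rfl⟩ := hξ
        obtain ⟨g, hg, hgX⟩ := (h.pullbackGerm_iff hκ X).1 ((mem_pullbackFoliation_iff.1 hX).2 _)
        refine ⟨fun z => f z • g (ψ z), ?_, ?_⟩
        · filter_upwards [hg.comp (hψ a)] with z h1 using (f.contMDiff z).smul h1
        · filter_upwards [(hψ a).continuousAt.eventually hgX] with z h1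
          exact (map_smul (mfderiv 𝓘(ℝ, ET) 𝓘(ℝ, K) (fun b => pr' (κ b)) (ψ z)) _ _).trans
            ((congrArg (fun k : K => f z • k) h1).trans (map_smul (Z _) _ _).symm)
      | zero =>
        refine ⟨fun _ => 0, .const, Eventually.of_forall fun z => ?_⟩
        rw [map_zero]
        exact map_zero (mfderiv 𝓘(ℝ, ET) 𝓘(ℝ, K) (fun b => pr' (κ b)) (ψ z))
      | add ξ η _ _ h₁ h₂ =>
        obtain ⟨g, hg, h₁⟩ := h₁
        obtain ⟨g', hg', h₂⟩ := h₂
        refine ⟨fun z => g z + g' z, ?_, ?_⟩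
        · filter_upwards [hg, hg'] with z h1 h2 using h1.add h2
        · filter_upwards [h₁, h₂] with z h1 h2
          rw [map_add, ← h1, ← h2]
          exact map_add (mfderiv 𝓘(ℝ, ET) 𝓘(ℝ, K) (fun b => pr' (κ b)) (ψ z)) _ _
      | smul c ξ _ h₁ =>
        obtain ⟨g, hg, h₁⟩ := h₁
        refine ⟨fun z => c • g z, ?_, ?_⟩
        · filter_upwards [hg] with z h1 using
            (contMDiffAt_const (I' := 𝓘(ℝ, ℝ)) (c := c)).smul h1
        · filter_upwards [h₁] with z h1
          rw [map_smul, ← h1]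
          exact map_smul (mfderiv 𝓘(ℝ, ET) 𝓘(ℝ, K) (fun b => pr' (κ b)) (ψ z)) _ _
    obtain ⟨g, hg, h1⟩ := key
    refine ⟨g, hg, ?_⟩
    filter_upwards [h1, hξY, hchain] with z h2 h3 h4
    rw [h4, h3, h2]
  · rintro ⟨g, hg, hgY⟩
    obtain ⟨X, hX⟩ := SmoothVF.exists_pushforward ψ Y
    have hga : MSmoothNear ES W g (ψ.symm (ψ a)) := by rwa [ψ.symm_apply_apply]
    have hc := (hψ' (ψ a)).continuousAt
    rw [ContinuousAt, ψ.symm_apply_apply] at hc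
    have h1 := (h.pullbackGerm_iff hκ X).2 ⟨fun b => g (ψ.symm b), hga.comp (hψ' _), by
      filter_upwards [hc.eventually hgY, hc.eventually hchain] with b h2 h3
      rw [h3, ← hX, ψ.apply_symm_apply] at h2
      exact h2⟩
    obtain ⟨X', hX', hXX'⟩ := h1.exists_mem_pullbackFoliation
    refine PullbackGerm.of_sum (m := 1) (X := fun _ => X') (g := fun _ _ => 1) (fun _ => hX')
      (fun _ => .const) ?_
    filter_upwards [(hψ a).continuousAt.eventually hXX'] with z h2
    simp only [one_smul, Finset.univ_unique, Finset.sum_const, Finset.card_singleton]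
    rw [h2, hX]

lemma pullbackFoliation_pullbackFoliation_eq (h : ∀ a, LocalModel F (ι a) pr Z)
    (h' : ∀ b, LocalModel F' (κ b) pr' Z) (hι : ContMDiff 𝓘(ℝ, ES) 𝓘(ℝ, E) ∞ ι)
    (hκ : ContMDiff 𝓘(ℝ, ET) 𝓘(ℝ, E') ∞ κ) (hψ : ∀ a, pr' (κ (ψ a)) = pr (ι a)) :
    pullbackFoliation (E' := ES) ψ (pullbackFoliation (E' := ET) κ F'.toSubmodule) =
      pullbackFoliation (E' := ES) ι F.toSubmodule := by
  ext Y
  rw [mem_pullbackFoliation_iff, mem_pullbackFoliation_iff]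
  refine and_congr_right fun _ => forall_congr' fun a => ?_
  rw [(h' (ψ a)).pullbackGerm_pullbackFoliation_iff (.of_contMDiff hκ) Y,
    (h a).pullbackGerm_iff (.of_contMDiff hι) Y, funext hψ]
  simp only [hψ]
  rfl

end PullbackDiffeomorph

variable [FiniteDimensional ℝ K] [T2Space M] [T2Space N]
  {F : SingularFoliation E M} {F' : SingularFoliation E' N}
  {Z : K → W →L[ℝ] K} {pr : M → K} {ι : S → M} {κ : T → N} {s : S} {t : T}

/-- The projection of a local model restricts to a chart of any slice. -/
lemma SingularFoliation.IsSlice.exists_openPartialHomeomorph (hs : F.IsSlice (E' := ES) ι s)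
    (h : LocalModel F (ι s) pr Z) (h0 : pr (ι s) = 0) (hZ : Z 0 = 0) :
    ∃ e : OpenPartialHomeomorph S K, s ∈ e.source ∧
      (∀ z ∈ e.source, e z = pr (ι z) ∧ LocalModel F (ι z) pr Z) ∧
      ContMDiffOn 𝓘(ℝ, ES) 𝓘(ℝ, K) ∞ e e.source ∧
      ContMDiffOn 𝓘(ℝ, K) 𝓘(ℝ, ES) ∞ e.symm e.target := by
  have hι : MSmoothNear ES E ι s := .of_contMDiff hs.isSmoothEmbedding.contMDiff
  have hf : MSmoothNear ES K (fun z => pr (ι z)) s := h.mSmoothNear.comp hι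
  have hchain := mfderiv_comp_apply_eq (g := pr) h.mSmoothNear.mdifferentiableAt
    hι.mdifferentiableAt
  have htan := h.tangent_eq_ker h0 hZ
  -- The kernel of `d pr` is the tangent space of the leaf, complementary to the slice; so `d (pr ∘
  -- ι)` is injective, and likewise onto.
  have hinj : Function.Injective (mfderiv 𝓘(ℝ, ES) 𝓘(ℝ, K) (fun z => pr (ι z)) s) := by
    refine (injective_iff_map_eq_zero _).2 fun v hv => ?_
    rw [hchain] at hv
    have h1 : mfderiv 𝓘(ℝ, ES) 𝓘(ℝ, E) ι s v ∈ F.tangent (ι s) := by rw [htan]; exact hv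
    have h2 := hs.isCompl.disjoint.le_bot ⟨⟨v, rfl⟩, h1⟩
    exact (hs.isSmoothEmbedding.isImmersion.isImmersionAt s).mfderiv_injective
      (h2.trans (map_zero _).symm)
  have hsurj : Function.Surjective (mfderiv 𝓘(ℝ, ES) 𝓘(ℝ, K) (fun z => pr (ι z)) s) := by
    intro k
    obtain ⟨u, rfl⟩ := h.surjective_mfderiv k
    have h1 : u ∈ LinearMap.range (mfderiv 𝓘(ℝ, ES) 𝓘(ℝ, E) ι s).toLinearMap ⊔ F.tangent (ι s) := by
      rw [hs.isCompl.sup_eq_top]; trivial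
    obtain ⟨_, ⟨v, rfl⟩, w, hw, rfl⟩ := Submodule.mem_sup.1 h1
    rw [htan] at hw
    refine ⟨v, ?_⟩
    rw [hchain, map_add]
    refine (add_zero _).symm.trans (congrArg _ ?_)
    exact hw.symm
  have hrank : Module.finrank ℝ ES = Module.finrank ℝ K :=
    (LinearEquiv.ofBijective (mfderiv 𝓘(ℝ, ES) 𝓘(ℝ, K) (fun z => pr (ι z)) s).toLinearMap
      ⟨hinj, hsurj⟩).finrank_eq
  obtain ⟨e, he, hse, A, hA, hAe⟩ := hf.exists_linearizing_chart hsurj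
  let L : ES ≃L[ℝ] K := (LinearEquiv.ofBijective A.toLinearMap
    ⟨(LinearMap.injective_iff_surjective_of_finrank_eq_finrank hrank).2 hA, hA⟩
      ).toContinuousLinearEquiv
  obtain ⟨O, hO, hOo, hsO⟩ := eventually_nhds_iff.1 (hι.continuousAt.eventually h.eventually)
  let e' : OpenPartialHomeomorph S K :=
    (e.transHomeomorph L.toHomeomorph).restrOpen O hOo
  have hsrc : e'.source = e.source ∩ O := rfl
  refine ⟨e', ⟨hse, hsO⟩, fun z hz => ⟨(hAe z hz.1).symm, hO z hz.2⟩, ?_, ?_⟩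
  · intro z hz
    have h1 : ContMDiffAt 𝓘(ℝ, ES) 𝓘(ℝ, K) ∞ L (e z) := L.contDiff.contDiffAt.contMDiffAt
    exact (h1.comp z (contMDiffAt_of_mem_maximalAtlas he hz.1)).contMDiffWithinAt
  · intro w hw
    have h1 : ContMDiffAt 𝓘(ℝ, K) 𝓘(ℝ, ES) ∞ L.symm w := L.symm.contDiff.contDiffAt.contMDiffAt
    have h2 : L.symm w ∈ e.target := hw.1
    exact ((contMDiffAt_symm_of_mem_maximalAtlas he h2).comp w h1).contMDiffWithinAt

/-- A common model makes both projections charts of the slices with values in the same space `K`.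
The diffeomorphism is one chart followed by the inverse of the other, and by construction it
intertwines the projections. -/
theorem SingularFoliation.HasModel.exists_slice_diffeomorph (h : F.HasModel (ι s) Z)
    (h' : F'.HasModel (κ t) Z) (hs : F.IsSlice (E' := ES) ι s) (ht : F'.IsSlice (E' := ET) κ t) :
    ∃ (A : TopologicalSpace.Opens S) (hs : s ∈ A) (B : TopologicalSpace.Opens T) (ht : t ∈ B)
      (ψ : A ≃ₘ^∞⟮𝓘(ℝ, ES), 𝓘(ℝ, ET)⟯ B), ψ ⟨s, hs⟩ = ⟨t, ht⟩ ∧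
      pullbackFoliation (E := ET) (E' := ES) (ψ : A → B)
          (pullbackFoliation (E := E') (E' := ET) (fun b : B => κ b) F'.toSubmodule) =
        pullbackFoliation (E := E) (E' := ES) (fun a : A => ι a) F.toSubmodule := by
  have : T2Space S := hs.isSmoothEmbedding.isEmbedding.t2Space
  have : T2Space T := ht.isSmoothEmbedding.isEmbedding.t2Space
  obtain ⟨hZ, pr, h0, h⟩ := h
  obtain ⟨-, pr', h0', h'⟩ := h'
  obtain ⟨α, hsα, hα, hαs, hαs'⟩ := hs.exists_openPartialHomeomorph h h0 hZ
  obtain ⟨β, htβ, hβ, hβs, hβs'⟩ := ht.exists_openPartialHomeomorph h' h0' hZ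
  have hαβ : α s = β t := by rw [(hα s hsα).1, (hβ t htβ).1, h0, h0']
  let e := α.trans β.symm
  have hes : ∀ z ∈ e.source, z ∈ α.source ∧ α z ∈ β.target := fun z hz => hz
  have het : ∀ z ∈ e.target, z ∈ β.source ∧ β z ∈ α.target := fun z hz => hz
  have hse : s ∈ e.source := ⟨hsα, by change α s ∈ β.target; rw [hαβ]; exact β.map_source htβ⟩
  have hest : e s = t := by
    change β.symm (α s) = t
    rw [hαβ, β.left_inv htβ]
  obtain ⟨ψ, hψ⟩ := e.exists_diffeomorph (hβs'.comp (hαs.mono fun z hz => (hes z hz).1)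
    fun z hz => (hes z hz).2) (hαs'.comp (hβs.mono fun z hz => (het z hz).1)
    fun z hz => (het z hz).2)
  refine ⟨_, hse, _, by rw [← hest]; exact e.map_source hse, ψ, Subtype.ext ?_, ?_⟩
  · exact (hψ _).trans hest
  · refine pullbackFoliation_pullbackFoliation_eq (pr := pr) (pr' := pr') (Z := Z)
      (fun a => (hα a (hes a a.2).1).2) (fun b => (hβ b (het b b.2).1).2)
      (hs.isSmoothEmbedding.contMDiff.comp contMDiff_subtype_val)
      (ht.isSmoothEmbedding.contMDiff.comp contMDiff_subtype_val) fun a => ?_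
    have h1 := hes a a.2
    rw [hψ, ← (hβ _ (het _ (e.map_source a.2)).1).1, ← (hα a h1.1).1]
    exact β.right_inv h1.2

end Slices

end

noncomputable section

/-! ### Embedded submanifolds and their preimages under submersions -/

section EmbeddedLeaves

variable {E : Type*} [NormedAddCommGroup E] [NormedSpace ℝ E] [FiniteDimensional ℝ E]
  {M : Type*} [TopologicalSpace M] [ChartedSpace E M] [IsManifold 𝓘(ℝ, E) ∞ M]
  {E' : Type*} [NormedAddCommGroup E'] [NormedSpace ℝ E'] [FiniteDimensional ℝ E']
  {P : Type*} [TopologicalSpace P] [ChartedSpace E' P] [IsManifold 𝓘(ℝ, E') ∞ P]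
  {π : P → M} {L : Set M}

lemma restrOpen_mem_maximalAtlas {e : OpenPartialHomeomorph M E}
    (he : e ∈ IsManifold.maximalAtlas 𝓘(ℝ, E) ∞ M) {O : Set M} (hO : IsOpen O) :
    e.restrOpen O hO ∈ IsManifold.maximalAtlas 𝓘(ℝ, E) ∞ M := by
  refine OpenPartialHomeomorph.mem_maximalAtlas_of_contMDiffOn _ ?_ ?_
  · exact (contMDiffOn_of_mem_maximalAtlas he).mono Set.inter_subset_left
  · exact (contMDiffOn_symm_of_mem_maximalAtlas he).mono Set.inter_subset_left

lemma Manifold.IsSubmersion.exists_linearizing_chart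
    (hπ : Manifold.IsSubmersion 𝓘(ℝ, E') 𝓘(ℝ, E) ∞ π) (p : P) {φ : OpenPartialHomeomorph M E}
    (hφ : φ ∈ IsManifold.maximalAtlas 𝓘(ℝ, E) ∞ M) (hp : π p ∈ φ.source) :
    ∃ e ∈ IsManifold.maximalAtlas 𝓘(ℝ, E') ∞ P, p ∈ e.source ∧ ∃ A : E' →L[ℝ] E,
      Function.Surjective A ∧ ∀ z ∈ e.source, π z ∈ φ.source ∧ φ (π z) = A (e z) := by
  have hπs : MSmoothNear E' E π p := .of_contMDiff hπ.contMDiff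
  have hφs : MSmoothNear E E φ (π p) := mSmoothNear_of_mem_maximalAtlas hφ hp
  have hsurj : Function.Surjective (mfderiv 𝓘(ℝ, E') 𝓘(ℝ, E) (fun z => φ (π z)) p) := by
    intro k
    obtain ⟨u, hu⟩ := (mdifferentiable_of_mem_maximalAtlas hφ).mfderiv_surjective hp k
    obtain ⟨v, rfl⟩ := (hπ.isSubmersionAt p).mfderiv_surjective u
    exact ⟨v, (mfderiv_comp_apply_eq hφs.mdifferentiableAt hπs.mdifferentiableAt v).trans hu⟩
  obtain ⟨e, he, hpe, A, hA, hAe⟩ := (hφs.comp hπs).exists_linearizing_chart hsurj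
  exact ⟨e.restrOpen _ (φ.open_source.preimage hπ.contMDiff.continuous),
    restrOpen_mem_maximalAtlas he _, ⟨hpe, hp⟩, A, hA, fun z hz => ⟨hz.2, hAe z hz.1⟩⟩

lemma IsEmbeddedSubmanifold.preimage (hL : IsEmbeddedSubmanifold (E := E) L)
    (hπ : Manifold.IsSubmersion 𝓘(ℝ, E') 𝓘(ℝ, E) ∞ π) :
    IsEmbeddedSubmanifold (E := E') (π ⁻¹' L) := by
  intro p hp
  obtain ⟨φ, hφ, hpφ, V, hV⟩ := hL (π p) hp
  obtain ⟨e, he, hpe, A, hA, hAe⟩ := hπ.exists_linearizing_chart p hφ hpφ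
  refine ⟨e, he, hpe, V.comap A.toLinearMap, fun z hz => ?_⟩
  obtain ⟨h1, h2⟩ := hAe z hz
  rw [Set.mem_preimage, hV _ h1, h2]
  rfl

/-- A set with a submersive local defining equation is an embedded submanifold. -/
lemma IsEmbeddedSubmanifold.of_submersion (h : ∀ x ∈ L, ∃ (C : Submodule ℝ E')
    (f : M → C), MSmoothNear E C f x ∧ Function.Surjective (mfderiv 𝓘(ℝ, E) 𝓘(ℝ, C) f x) ∧
      ∀ᶠ z in 𝓝 x, z ∈ L ↔ f z = 0) : IsEmbeddedSubmanifold (E := E) L := by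
  intro x hx
  obtain ⟨C, f, hf, hs, hfL⟩ := h x hx
  obtain ⟨e, he, hxe, A, hA, hAe⟩ := hf.exists_linearizing_chart hs
  obtain ⟨O, hO, hOo, hxO⟩ := eventually_nhds_iff.1 hfL
  refine ⟨e.restrOpen O hOo, restrOpen_mem_maximalAtlas he _, ⟨hxe, hxO⟩,
    LinearMap.ker A.toLinearMap, fun z hz => ?_⟩
  rw [hO z hz.2, hAe z hz.1]
  rfl

/-- In a chart where `π` is the linear map `A`, a defining equation `D = 0` of the preimage is
restricted to an affine subspace that `A` maps isomorphically to `E`. It remains submersive there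
because the preimage is a union of fibres, which makes the derivative of `D` vanish on `ker A`. -/
lemma IsEmbeddedSubmanifold.of_preimage (hL : IsEmbeddedSubmanifold (E := E') (π ⁻¹' L))
    (hπ : Manifold.IsSubmersion 𝓘(ℝ, E') 𝓘(ℝ, E) ∞ π) (hs : Function.Surjective π) :
    IsEmbeddedSubmanifold (E := E) L := by
  refine IsEmbeddedSubmanifold.of_submersion (E' := E') fun x hx => ?_
  obtain ⟨p, rfl⟩ := hs x
  obtain ⟨Ψ, hΨ, hpΨ, V, hV⟩ := hL p hx
  have hφ := IsManifold.chart_mem_maximalAtlas (I := 𝓘(ℝ, E)) (n := ∞) (π p)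
  have hpφ := mem_chart_source E (π p)
  obtain ⟨e, he, hpe, A, hA, hAe⟩ := hπ.exists_linearizing_chart p hφ hpφ
  obtain ⟨R, hR⟩ := ContinuousLinearMap.exists_comp_eq_id_of_surjective hA
  obtain ⟨C, hC⟩ := V.exists_isCompl
  -- The projection onto `C` along `V` has kernel `V`, so `q ∘ Ψ = 0` defines the preimage.
  let q : E' →L[ℝ] C := (Submodule.projectionOnto C V hC.symm).toContinuousLinearMap
  have hq : ∀ v, q v = 0 ↔ v ∈ V := fun v => by
    have := Submodule.ker_projectionOnto hC.symm
    rw [← this]; rfl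
  have hqs : Function.Surjective q := LinearMap.range_eq_top.1
    (Submodule.range_projectionOnto hC.symm)
  have hpe' := e.map_source hpe
  have hpΨ' := Ψ.map_source hpΨ
  have hesymm : MSmoothNear E' E' e.symm (e p) := mSmoothNear_symm_of_mem_maximalAtlas he hpe'
  have hG : SmoothNear (fun u => Ψ (e.symm u)) (e p) := by
    refine (MSmoothNear.comp ?_ hesymm).smoothNear
    rw [e.left_inv hpe]
    exact mSmoothNear_of_mem_maximalAtlas hΨ hpΨ
  have hG' : SmoothNear (fun u => e (Ψ.symm u)) (Ψ p) := by
    refine (MSmoothNear.comp ?_ (mSmoothNear_symm_of_mem_maximalAtlas hΨ hpΨ')).smoothNear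
    rw [Ψ.left_inv hpΨ]
    exact mSmoothNear_of_mem_maximalAtlas he hpe
  let D : E' → C := fun u => q (Ψ (e.symm u))
  have hD : SmoothNear D (e p) := SmoothNear.comp (.of_clm q) hG
  have hDs : Function.Surjective (fderiv ℝ D (e p)) := by
    have hGd : HasFDerivAt (fun u => Ψ (e.symm u)) (fderiv ℝ (fun u => Ψ (e.symm u)) (e p))
        (e (Ψ.symm (Ψ p))) := by
      rw [Ψ.left_inv hpΨ]; exact hG.differentiableAt.hasFDerivAt
    have h1 := HasFDerivAt.comp (Ψ p) (f := fun u => e (Ψ.symm u)) hGd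
      hG'.differentiableAt.hasFDerivAt
    have hc : ContinuousAt Ψ.symm (Ψ p) := Ψ.continuousAt_symm hpΨ'
    have h2 : (fun u => Ψ (e.symm u)) ∘ (fun u => e (Ψ.symm u)) =ᶠ[𝓝 (Ψ p)] id := by
      filter_upwards [hc.eventually (e.open_source.mem_nhds (by rwa [Ψ.left_inv hpΨ])),
        Ψ.open_target.mem_nhds hpΨ'] with u h3 h4
      simp only [Function.comp_apply, e.left_inv h3, Ψ.right_inv h4, id]
    have h5 := h1.unique ((hasFDerivAt_id (Ψ p)).congr_of_eventuallyEq h2)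
    have h6 : fderiv ℝ D (e p) = q ∘L fderiv ℝ (fun u => Ψ (e.symm u)) (e p) :=
      (q.hasFDerivAt.comp (e p) hG.differentiableAt.hasFDerivAt).fderiv
    intro k
    obtain ⟨u, rfl⟩ := hqs k
    refine ⟨fderiv ℝ (fun u => e (Ψ.symm u)) (Ψ p) u, ?_⟩
    rw [h6]
    exact congrArg q (congrArg (fun B : E' →L[ℝ] E' => B u) h5)
  have hDL : ∀ᶠ u in 𝓝 (e p), D u = 0 ↔ (chartAt E (π p)).symm (A u) ∈ L := by
    filter_upwards [hesymm.continuousAt.eventually (Ψ.open_source.mem_nhds (by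
      rwa [e.left_inv hpe])), e.open_target.mem_nhds hpe'] with u h1 h2
    have h3 := hAe _ (e.map_target h2)
    rw [e.right_inv h2] at h3
    rw [hq, ← hV _ h1, Set.mem_preimage, ← h3.2, (chartAt E (π p)).left_inv h3.1]
  have hAp : A (e p) = chartAt E (π p) (π p) := (hAe p hpe).2.symm
  -- Moving from `e p` in a direction of `ker A` does not change the value of `π`, hence stays in
  -- the preimage, where `D` vanishes.
  have hker : ∀ v, A v = 0 → fderiv ℝ D (e p) v = 0 := fun v hv => by
    have hl : HasDerivAt (fun t : ℝ => e p + t • v) v 0 := by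
      simpa using ((hasDerivAt_id (0 : ℝ)).smul_const v).const_add (e p)
    have hDd : HasFDerivAt D (fderiv ℝ D (e p)) (e p + (0 : ℝ) • v) := by
      simpa using hD.differentiableAt.hasFDerivAt
    have h1 := hDd.comp_hasDerivAt (0 : ℝ) hl
    have hc := hl.continuousAt
    rw [ContinuousAt, zero_smul, add_zero] at hc
    have h2 : D ∘ (fun t : ℝ => e p + t • v) =ᶠ[𝓝 0] fun _ => 0 := by
      filter_upwards [hc.eventually hDL] with t h3
      rw [Function.comp_apply, h3, map_add, map_smul, hv, smul_zero, add_zero, hAp,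
        (chartAt E (π p)).left_inv hpφ]
      exact hx
    exact h1.unique ((hasDerivAt_const _ _).congr_of_eventuallyEq h2)
  -- The affine section of `A` through `e p`.
  let j : E → E' := fun w => e p + R (w - A (e p))
  have hj0 : j (A (e p)) = e p := by simp [j]
  have hAj : ∀ w, A (j w) = w := fun w => by simp [j, hR]
  have hjd : ∀ w, HasFDerivAt j R w := fun w =>
    (R.hasFDerivAt.comp w ((hasFDerivAt_id w).sub_const (A (e p)))).const_add (e p)
  have hjs : SmoothNear j (A (e p)) := .of_contDiff
    (contDiff_const.add (R.contDiff.comp (contDiff_id.sub contDiff_const)))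
  have hDj : SmoothNear (fun w => D (j w)) (A (e p)) := hD.comp_of_eq hjs hj0
  have hDjs : Function.Surjective (fderiv ℝ (fun w => D (j w)) (A (e p))) := by
    have hDd : HasFDerivAt D (fderiv ℝ D (e p)) (j (A (e p))) := by
      rw [hj0]; exact hD.differentiableAt.hasFDerivAt
    have h1 : fderiv ℝ (fun w => D (j w)) (A (e p)) = fderiv ℝ D (e p) ∘L R :=
      (hDd.comp (A (e p)) (hjd _)).fderiv
    intro k
    obtain ⟨u, rfl⟩ := hDs k
    refine ⟨A u, ?_⟩
    have h2 := hker (u - R (A u)) (by rw [map_sub, hR, sub_self])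
    rw [map_sub, sub_eq_zero] at h2
    rw [h1, h2]
    rfl
  have hφs := mSmoothNear_extChartAt (E := E) hpφ
  have hφp : extChartAt 𝓘(ℝ, E) (π p) (π p) = A (e p) := hAp.symm
  have hf : MSmoothNear E C (fun z => D (j (extChartAt 𝓘(ℝ, E) (π p) z))) (π p) := by
    refine SmoothNear.mcomp (g := fun w => D (j w)) ?_ hφs
    rwa [hφp]
  refine ⟨C, fun z => D (j (extChartAt 𝓘(ℝ, E) (π p) z)), hf, ?_, ?_⟩
  · rw [← surjective_fderiv_extChartAt_symm_iff hpφ hf.mdifferentiableAt]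
    have h1 : (fun w => D (j (extChartAt 𝓘(ℝ, E) (π p) ((extChartAt 𝓘(ℝ, E) (π p)).symm w))))
        =ᶠ[𝓝 (extChartAt 𝓘(ℝ, E) (π p) (π p))] fun w => D (j w) := by
      filter_upwards [eventually_mem_target hpφ] with w hw
      rw [(extChartAt 𝓘(ℝ, E) (π p)).right_inv hw]
    rwa [h1.fderiv_eq, hφp]
  · have hc : ContinuousAt (fun z => j (extChartAt 𝓘(ℝ, E) (π p) z)) (π p) :=
      ContinuousAt.comp (g := j) (hjd _).continuousAt hφs.continuousAt
    rw [ContinuousAt, hφp, hj0] at hc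
    filter_upwards [hc.eventually hDL, eventually_mem_source hpφ] with z h1 h2
    rw [h1, hAj]
    exact iff_of_eq (congrArg (· ∈ L) (extChartAt_symm_apply_self h2).symm)

lemma isEmbeddedSubmanifold_preimage_iff (hπ : Manifold.IsSubmersion 𝓘(ℝ, E') 𝓘(ℝ, E) ∞ π)
    (hs : Function.Surjective π) :
    IsEmbeddedSubmanifold (E := E') (π ⁻¹' L) ↔ IsEmbeddedSubmanifold (E := E) L :=
  ⟨fun h => h.of_preimage hπ hs, fun h => h.preimage hπ⟩

end EmbeddedLeaves

end

theorem mainTheorem3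
    {EM : Type*} [NormedAddCommGroup EM] [NormedSpace ℝ EM] [FiniteDimensional ℝ EM]
    {EN : Type*} [NormedAddCommGroup EN] [NormedSpace ℝ EN] [FiniteDimensional ℝ EN]
    {EP : Type*} [NormedAddCommGroup EP] [NormedSpace ℝ EP] [FiniteDimensional ℝ EP]
    {M : Type*} [TopologicalSpace M] [T2Space M] [SecondCountableTopology M]
    [ChartedSpace EM M] [IsManifold 𝓘(ℝ, EM) ∞ M]
    {N : Type*} [TopologicalSpace N] [T2Space N] [SecondCountableTopology N]
    [ChartedSpace EN N] [IsManifold 𝓘(ℝ, EN) ∞ N]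
    {P : Type*} [TopologicalSpace P] [T2Space P] [SecondCountableTopology P]
    [ChartedSpace EP P] [IsManifold 𝓘(ℝ, EP) ∞ P]
    (FM : SingularFoliation EM M) (FN : SingularFoliation EN N)
    (πM : P → M) (πN : P → N)
    (h : IsHausdorffMoritaEquivalence (E₂ := EP) FM FN πM πN) :
    ∃ Φ : FM.LeafSpace ≃ₜ FN.LeafSpace,
      (∀ p : P, Φ (FM.leafClass (πM p)) = FN.leafClass (πN p)) ∧
      (∀ (x : M) (y : N), Φ (FM.leafClass x) = FN.leafClass y →
        FM.leafCodim x = FN.leafCodim y ∧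
        (IsEmbeddedSubmanifold (E := EM) (FM.leaf x) ↔
          IsEmbeddedSubmanifold (E := EN) (FN.leaf y)) ∧
        Nonempty (FM.isotropy x ≃ₗ⁅ℝ⁆ FN.isotropy y)) ∧
      (∀ (ES : Type*) [NormedAddCommGroup ES] [NormedSpace ℝ ES] [FiniteDimensional ℝ ES]
        (S : Type*) [TopologicalSpace S] [ChartedSpace ES S] [IsManifold 𝓘(ℝ, ES) ∞ S]
        (ET : Type*) [NormedAddCommGroup ET] [NormedSpace ℝ ET] [FiniteDimensional ℝ ET]
        (T : Type*) [TopologicalSpace T] [ChartedSpace ET T] [IsManifold 𝓘(ℝ, ET) ∞ T]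
        (ι : S → M) (s : S) (κ : T → N) (t : T),
        FM.IsSlice (E' := ES) ι s → FN.IsSlice (E' := ET) κ t →
        Φ (FM.leafClass (ι s)) = FN.leafClass (κ t) →
        ∃ (A : TopologicalSpace.Opens S) (hs : s ∈ A)
          (B : TopologicalSpace.Opens T) (ht : t ∈ B)
          (ψ : A ≃ₘ^∞⟮𝓘(ℝ, ES), 𝓘(ℝ, ET)⟯ B),
          ψ ⟨s, hs⟩ = ⟨t, ht⟩ ∧
          pullbackFoliation (E := ET) (E' := ES) (ψ : A → B)
              (pullbackFoliation (E := EN) (E' := ET) (fun b : B => κ b) FN.toSubmodule) =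
            pullbackFoliation (E := EM) (E' := ES) (fun a : A => ι a) FM.toSubmodule) := by
  obtain ⟨Φ, hΦ⟩ := h.exists_homeomorph
  have key : ∀ (x : M) (y : N), Φ (FM.leafClass x) = FN.leafClass y →
      ∃ p, πM p = x ∧ FN.leafSetoid (πN p) y := fun x y hxy => by
    obtain ⟨p, rfl⟩ := h.left.surjective x
    exact ⟨p, rfl, Quotient.exact ((hΦ p).symm.trans hxy)⟩
  refine ⟨Φ, hΦ, fun x y hxy => ?_, ?_⟩
  · obtain ⟨p, rfl, hp⟩ := key x y hxy
    obtain ⟨k, n, Z, h₁, h₂⟩ := h.exists_hasModel hp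
    refine ⟨h₁.leafCodim_eq.trans h₂.leafCodim_eq.symm, ?_, h₁.nonempty_isotropy_lieEquiv h₂⟩
    -- Corresponding leaves have the same preimage in `P`, and embeddedness can be tested there.
    have hpre : πM ⁻¹' FM.leaf (πM p) = πN ⁻¹' FN.leaf y := by
      ext q
      exact ⟨fun hq => FN.leafSetoid.trans (FN.leafSetoid.symm hp) (h.leafSetoid_of_leafSetoid hq),
        fun hq => h.symm.leafSetoid_of_leafSetoid (FN.leafSetoid.trans hp hq)⟩
    rw [← isEmbeddedSubmanifold_preimage_iff h.left.isSubmersion h.left.surjective, hpre,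
      isEmbeddedSubmanifold_preimage_iff h.right.isSubmersion h.right.surjective]
  · intro ES _ _ _ S _ _ _ ET _ _ _ T _ _ _ ι s κ t hs ht hst
    obtain ⟨p, hps, hp⟩ := key _ _ hst
    obtain ⟨k, n, Z, h₁, h₂⟩ := h.exists_hasModel hp
    rw [hps] at h₁
    exact h₁.exists_slice_diffeomorph h₂ hs ht
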